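/- **Setting.** Let $d\ge 2$ and $\alpha\ge 1$ be integers, let $\mathbb A$ be a Borel space with a probability measure $\Theta$, and for $j=1,\dots,\alpha$ let $\varphi_j:(\mathbb R^d\times\mathbb A)^{j+1}\to[0,1]$ be measurable, symmetric and translation-invariant (the value does not change when all Euclidean components are shifted by the same vector). Let $\mathbb M=\prod_{j=1}^{\alpha}[0,1]^{\mathbb N_0^{2j}}$, let $\mathbb Q$ be the law on $\mathbb M$ under which all components are independent and uniform on $[0,1]$, and under $\mathbb P_\beta$, $\beta\in[0,\infty)$, let $\Psi$ be a Poisson process on $\mathbb R^d\times\mathbb A\times\mathbb M$ with intensity measure $\beta\lambda_d\otimes\Theta\otimes\mathbb Q$, and let $V\sim\Theta$ and $U\sim\mathbb Q$ be such that $\Psi,V,U$ are independent. Fix $t>0$ and an enumeration $z_0=\mathbf 0,z_1,\dots$ of $\mathbb Z^d$, and put $Q_m=[-t,t)^d+2tz_m$. The coordinates of a point $(x,a,u)$ of a point process on $\mathbb R^d\times\mathbb A\times\mathbb M$ are $(m,l)$, where $x\in Q_m$ and $l$ is the number of points with position in $Q_m$ that is lexicographically smaller than $x$. For a set $\rho$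 of $j+1$ points, $1\le j\le\alpha$, with positions $x_0<\dots<x_j$ in lexicographic order, let $u(\rho)$ be the component with index $(m_0,l_0,\dots,m_{j-1},l_{j-1})$ of the $\mathbb M$-mark of the point at $x_j$, where $(m_k,l_k)$ are the coordinates of the point at $x_k$. The random simplicial complex built from the process has the (almost surely distinct) points $(x,a)$ as vertices, and a set $\sigma$ of at most $\alpha+1$ vertices is a simplex if and only if $u(\rho)\le\varphi_{|\rho|-1}(x_\rho)$ for all $\rho\subseteq\sigma$ with $|\rho|\ge2$, where $x_\rho$ is the tuple of the elements of $\rho$ (so, given the vertices and all subsimplices of lower dimension, each simplex is added independently with probability $\varphi_{|\sigma|-1}(x_\sigma)$). Let $\Delta^{\mathbf 0}$ be the complex built from $\Psi+\delta_{(\mathbf 0,V,U)}$. For a simplicial complex $K$, the graph $G_q(K)$ has the $q$-simplices of $K$ as vertices, and two distinct $q$-simplices are adjacent if some $(q+1)$-simplex of $K$ contains both (up-connectivity). For $0\le q\le\alpha-1$ let $C_q^\infty$ be the event that some $q$-simplex of $\Delta^{\mathbf 0}$ having a vertex at the position $\mathbf 0$ lies in an infinite connected component of $G_q(\Delta^{\mathbf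 0})$, and let $$\beta_c^{(q)}:=\sup\{\beta\in[0,\infty)\mid \mathbb P_\beta(C_q^\infty)=0\}\in[0,\infty].$$ Let $\kappa_j(x_0,\dots,x_j)=\prod_{J\subseteq\{0,\dots,j\},\,|J|\ge2}\varphi_{|J|-1}(x_J)$ for $x_0,\dots,x_j\in\mathbb R^d\times\mathbb A$, and consider, for $q\in\{0,\dots,\alpha-1\}$: * (V1) There are $\delta,\varepsilon>0$ and a measurable $A\subseteq\mathbb A$ with $\Theta(A)>0$ such that $\kappa_{q+1}((x_0,a_0),\dots,(x_{q+1},a_{q+1}))\ge\varepsilon$ for all $a_0,\dots,a_{q+1}\in A$ and all $x_0,\dots,x_{q+1}\in\mathbb R^d$ with $\operatorname{diam}\{x_0,\dots,x_{q+1}\}\le\delta$. * (V2) There is a $D>0$ such that for all $x_0,\dots,x_{q+1}\in\mathbb R^d$ with $\operatorname{diam}\{x_0,\dots,x_{q+1}\}>D$ one has $\kappa_{q+1}((x_0,a_0),\dots,(x_{q+1},a_{q+1}))=0$ for $\Theta^{q+2}$-almost all $(a_0,\dots,a_{q+1})\in\mathbb A^{q+2}$. **Theorem.** Assume that (V1)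 holds for $q=\alpha-1$ and that (V2) holds for $q=0$. Then $$0<\beta_c^{(0)}\le\beta_c^{(1)}\le\dots\le\beta_c^{(\alpha-1)}<\infty .$$ -/

import Mathlib

open MeasureTheory ProbabilityTheory
open scoped ENNReal NNReal

noncomputable section

namespace SimplicialRCM

/-! ### Point processes and Poisson processes -/

section Poisson

variable {X : Type*} [MeasurableSpace X]

/-- The set `N(X)` of all countable sums of measures with values in the natural numbers. -/
def countingMeasures (X : Type*) [MeasurableSpace X] : Set (Measure X) :=
  {η | ∃ m : ℕ → Measure X,
    (∀ n B, MeasurableSet B → ∃ k : ℕ, m n B = k) ∧ η = Measure.sum m}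

/-- `ξ` is a Poisson process with intensity measure `Λ` under the probability measure `P`: a
random element of `N(X)` such that `ξ(B)` is Poisson distributed with parameter `Λ(B)`
(almost surely infinite if `Λ(B) = ∞`) and such that the numbers of points in pairwise disjoint
measurable sets are independent. Measurability is with respect to the `σ`-field on measures
generated by the evaluations `η ↦ η B`, `B` measurable. -/
structure IsPoissonProcess {Ω : Type*} [MeasurableSpace Ω] (ξ : Ω → Measure X) (Λ : Measure X)
    (P : Measure Ω) : Prop where
  measurable : Measurable ξ
  mem_countingMeasures : ∀ ω, ξ ω ∈ countingMeasures X
  hasLaw : ∀ B, MeasurableSet B → ∀ r : ℝ≥0, Λ B = r →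
    HasLaw (fun ω => ξ ω B) ((poissonMeasure r).map (fun n : ℕ => (n : ℝ≥0∞))) P
  eq_top : ∀ B, MeasurableSet B → Λ B = ∞ → ∀ᵐ ω ∂P, ξ ω B = ∞
  indep : ∀ (m : ℕ) (B : Fin m → Set X), (∀ i, MeasurableSet (B i)) →
    Pairwise (fun i j => Disjoint (B i) (B j)) → iIndepFun (fun i ω => ξ ω (B i)) P

/-- The points (atoms) of a counting measure. -/
def points (η : Measure X) : Set X := {p | η {p} ≠ 0}

end Poisson

/-! ### Up-connectivity -/

/-- The `q`-graph of a simplicial complex `K`: its vertices are the `q`-simplices of `K`, and two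
distinct `q`-simplices are joined by an edge if some `(q+1)`-simplex of `K` contains both. -/
def qGraph {V : Type*} (K : PreAbstractSimplicialComplex V) (q : ℕ) :
    SimpleGraph {σ : Finset V // σ ∈ K.faces ∧ σ.card = q + 1} where
  Adj σ ρ := σ ≠ ρ ∧ ∃ π ∈ K.faces, π.card = q + 2 ∧ σ.1 ⊆ π ∧ ρ.1 ⊆ π
  symm := ⟨fun _ _ h => ⟨h.1.symm, by
    obtain ⟨π, hπ, hc, h1, h2⟩ := h.2
    exact ⟨π, hπ, hc, h2, h1⟩⟩⟩
  loopless := ⟨fun _ h => h.1 rfl⟩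

/-! ### The marks deciding about simplices -/

/-- The space `𝕄 = M^(2) × ⋯ × M^(2α)` with `M^(2j) = [0,1]^(ℕ₀^(2j))`. The entry of `u : 𝕄` at
`⟨k, z⟩` is the component of `u` in `M^(2j)`, `j = k + 1`, with index
`z = ((m₀, l₀), …, (m_{j-1}, l_{j-1}))`. -/
abbrev EdgeMarks (α : ℕ) : Type := (Σ k : Fin α, (Fin (k.1 + 1) → ℕ × ℕ)) → unitInterval

/-- The distribution `ℚ` on `𝕄`: all components are independent and uniform on `[0,1]`. -/
def edgeMarkLaw (α : ℕ) : Measure (EdgeMarks α) :=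
  Measure.infinitePi (fun _ => (volume : Measure unitInterval))

/-- The space `ℝ^d × 𝔸 × 𝕄`. -/
abbrev MPoint (d α : ℕ) (A : Type*) : Type _ := EuclideanSpace ℝ (Fin d) × A × EdgeMarks α

section Model

variable {d α : ℕ} {A : Type*}

/-! ### Connection functions -/

/-- The value of `φ j` at a tuple is only relevant for `1 ≤ j ≤ α`: these functions are measurable,
symmetric, translation invariant and have values in `[0,1]`. -/
structure IsConnectionFamily [MeasurableSpace A] (α : ℕ)
    (φ : (j : ℕ) → (Fin (j + 1) → EuclideanSpace ℝ (Fin d) × A) → ℝ) : Prop where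
  measurable : ∀ j, 1 ≤ j → j ≤ α → Measurable (φ j)
  mem_Icc : ∀ j, 1 ≤ j → j ≤ α → ∀ x, φ j x ∈ Set.Icc (0 : ℝ) 1
  symmetric : ∀ j, 1 ≤ j → j ≤ α → ∀ (s : Equiv.Perm (Fin (j + 1))) x, φ j (x ∘ s) = φ j x
  translation : ∀ j, 1 ≤ j → j ≤ α → ∀ (t : EuclideanSpace ℝ (Fin d)) x,
    φ j (fun i => ((x i).1 + t, (x i).2)) = φ j x

/-- `κ_j(x₀,…,x_j)` is the product of `φ_{|J|-1}(x_J)` over the subsets `J` of `{0,…,j}` with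
`|J| ≥ 2` (the factors with `|J| = 1` are equal to `1`). The subsets with `k + 1` elements are
enumerated as the ranges of the strictly increasing maps from `{0,…,k}` to `{0,…,j}`. -/
def kappa (φ : (j : ℕ) → (Fin (j + 1) → EuclideanSpace ℝ (Fin d) × A) → ℝ) (j : ℕ)
    (x : Fin (j + 1) → EuclideanSpace ℝ (Fin d) × A) : ℝ :=
  ∏ k ∈ Finset.Icc 1 j, ∏ e : Fin (k + 1) ↪o Fin (j + 1), φ k (x ∘ e)

/-- Property (V1) for `q`. -/
def V1 [MeasurableSpace A] (Θ : Measure A)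
    (φ : (j : ℕ) → (Fin (j + 1) → EuclideanSpace ℝ (Fin d) × A) → ℝ) (q : ℕ) : Prop :=
  ∃ δ > 0, ∃ ε > 0, ∃ B : Set A, MeasurableSet B ∧ 0 < Θ B ∧
    ∀ (a : Fin (q + 2) → A) (x : Fin (q + 2) → EuclideanSpace ℝ (Fin d)),
      (∀ i, a i ∈ B) → Metric.diam (Set.range x) ≤ δ →
        ε ≤ kappa φ (q + 1) (fun i => (x i, a i))

/-- Property (V2) for `q`. The exceptional null set of marks may depend on the positions. -/
def V2 [MeasurableSpace A] (Θ : Measure A)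
    (φ : (j : ℕ) → (Fin (j + 1) → EuclideanSpace ℝ (Fin d) × A) → ℝ) (q : ℕ) : Prop :=
  ∃ D > 0, ∀ x : Fin (q + 2) → EuclideanSpace ℝ (Fin d), D < Metric.diam (Set.range x) →
    ∀ᵐ a ∂(Measure.pi fun _ : Fin (q + 2) => Θ), kappa φ (q + 1) (fun i => (x i, a i)) = 0

/-! ### Coordinates of points -/

/-- Lexicographic order on `ℝ^d`. -/
def lexLT (x y : EuclideanSpace ℝ (Fin d)) : Prop := toLex (fun i => x i) < toLex (fun i => y i)

/-- The cube `Q_m^t = [-t,t)^d + 2t z_m`, where `z` is an enumeration of `ℤ^d`. -/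
def cube (t : ℝ) (z : ℕ ≃ (Fin d → ℤ)) (m : ℕ) : Set (EuclideanSpace ℝ (Fin d)) :=
  {x | ∀ i, -t + 2 * t * z m i ≤ x i ∧ x i < t + 2 * t * z m i}

/-- The number of the cube containing `x`, see `mem_cube_iff`. -/
def cubeIndex (t : ℝ) (z : ℕ ≃ (Fin d → ℤ)) (x : EuclideanSpace ℝ (Fin d)) : ℕ :=
  z.symm fun i => ⌊(x i + t) / (2 * t)⌋

theorem mem_cube_iff {t : ℝ} (ht : 0 < t) (z : ℕ ≃ (Fin d → ℤ)) (m : ℕ)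
    (x : EuclideanSpace ℝ (Fin d)) : x ∈ cube t z m ↔ cubeIndex t z x = m := by
  have h2 : (0 : ℝ) < 2 * t := by linarith
  simp only [cube, cubeIndex, Set.mem_ofPred_eq, Equiv.symm_apply_eq, funext_iff, Int.floor_eq_iff,
    le_div_iff₀ h2, div_lt_iff₀ h2]
  refine forall_congr' fun i => ⟨fun h => ⟨?_, ?_⟩, fun h => ⟨?_, ?_⟩⟩ <;> linarith [h.1, h.2]

/-- The coordinates `(m, l)` of a point with position `x` inside the point configuration `S`: `x`
lies in the `m`-th cube, and `l` is the number of points of `S` in this cube whose position is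
lexicographically smaller than `x`. -/
def coords (t : ℝ) (z : ℕ ≃ (Fin d → ℤ)) (S : Set (MPoint d α A))
    (x : EuclideanSpace ℝ (Fin d)) : ℕ × ℕ :=
  (cubeIndex t z x, {p ∈ S | p.1 ∈ cube t z (cubeIndex t z x) ∧ lexLT p.1 x}.ncard)

/-- The number `u(ρ)` for `ρ = {p₀, …, p_j}`, `j = k + 1`, where `p₀, …, p_j` are listed in
lexicographically increasing order of their positions: the component of the mark of `p_j` whose
index consists of the coordinates of `p₀, …, p_{j-1}`. -/
def simplexMark (t : ℝ) (z : ℕ ≃ (Fin d → ℤ)) (S : Set (MPoint d α A)) (k : Fin α)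
    (p : Fin (k.1 + 2) → MPoint d α A) : ℝ :=
  (p (Fin.last (k.1 + 1))).2.2 ⟨k, fun i => coords t z S (p i.castSucc).1⟩

/-! ### The random simplicial complex -/

/-- The simplicial complex `Δ` built from the set `S ⊆ ℝ^d × 𝔸 × 𝕄` of points. A vertex
`(x, a)` is represented by the point `(x, a, u)` of `S` above it (almost surely there is only one).
A nonempty set `σ` of at most `α + 1` points is a simplex if and only if
`u(ρ) ≤ φ_{|ρ|-1}(x_ρ)` for all `ρ ⊆ σ` with `|ρ| ≥ 2`; such `ρ`, with `|ρ| = k + 2`, are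
listed in lexicographically increasing order of the (almost surely distinct) positions. -/
def complex (φ : (j : ℕ) → (Fin (j + 1) → EuclideanSpace ℝ (Fin d) × A) → ℝ) (t : ℝ)
    (z : ℕ ≃ (Fin d → ℤ)) (S : Set (MPoint d α A)) :
    PreAbstractSimplicialComplex (MPoint d α A) where
  faces := {σ | σ.Nonempty ∧ (σ : Set (MPoint d α A)) ⊆ S ∧ σ.card ≤ α + 1 ∧
    ∀ (k : Fin α) (p : Fin (k.1 + 2) → MPoint d α A), (∀ i, p i ∈ σ) →
      (∀ i j, i < j → lexLT (p i).1 (p j).1) →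
        simplexMark t z S k p ≤ φ (k.1 + 1) (fun i => ((p i).1, (p i).2.1))}
  isRelLowerSet_faces := by
    rintro σ ⟨hne, hS, hc, h⟩
    refine ⟨hne, fun ρ hρ hρne => ⟨hρne, ?_, ?_, ?_⟩⟩
    · exact (Finset.coe_subset.2 hρ).trans hS
    · exact (Finset.card_le_card hρ).trans hc
    · exact fun k p hp => h k p fun i => hρ (hp i)

/-- Some `q`-simplex with a vertex at the origin lies in an infinite connected component of the
`q`-graph of `K`. -/
def PercolatesFromOrigin (K : PreAbstractSimplicialComplex (MPoint d α A)) (q : ℕ) : Prop :=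
  ∃ σ : {σ : Finset (MPoint d α A) // σ ∈ K.faces ∧ σ.card = q + 1},
    (∃ p ∈ σ.1, p.1 = 0) ∧ ((qGraph K q).connectedComponentMk σ).supp.Infinite

/-- The event `C_q^∞`, for the complex `Δ⁰` constructed from `Ψ + δ_{(0,V,U)}`. -/
def percolationEvent [MeasurableSpace A]
    (φ : (j : ℕ) → (Fin (j + 1) → EuclideanSpace ℝ (Fin d) × A) → ℝ) (t : ℝ)
    (z : ℕ ≃ (Fin d → ℤ)) {Ω : Type*} (Ψ : Ω → Measure (MPoint d α A)) (V : Ω → A)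
    (U : Ω → EdgeMarks α) (q : ℕ) : Set Ω :=
  {ω | PercolatesFromOrigin
    (complex φ t z (points (Ψ ω + Measure.dirac ((0 : EuclideanSpace ℝ (Fin d)), V ω, U ω)))) q}

/-- The critical intensity `β_c^(q) = sup {β ∈ [0,∞) | ℙ_β(C_q^∞) = 0}`, as an element of
`[0,∞]`. -/
def criticalIntensity [MeasurableSpace A]
    (φ : (j : ℕ) → (Fin (j + 1) → EuclideanSpace ℝ (Fin d) × A) → ℝ) (t : ℝ)
    (z : ℕ ≃ (Fin d → ℤ)) {Ω : Type*} [MeasurableSpace Ω] (P : ℝ≥0 → Measure Ω)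
    (Ψ : Ω → Measure (MPoint d α A)) (V : Ω → A) (U : Ω → EdgeMarks α) (q : ℕ) : ℝ≥0∞ :=
  sSup {b : ℝ≥0∞ | ∃ β : ℝ≥0, b = β ∧ P β (percolationEvent φ t z Ψ V U q) = 0}

end Model

end SimplicialRCM

end

namespace SimplicialRCM

set_option linter.unusedSectionVars false

/-! ### Deterministic facts on up-connectivity -/

section UpConnectivity

variable {V : Type*} {K : PreAbstractSimplicialComplex V} {q : ℕ}

/-! The chain of inequalities is deterministic. Adjacent `(q+1)`-simplices share a `q`-face, and all
`q`-faces of one simplex are up-connected through it, so the `q`-faces of one `(q+1)`-component lie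
in one `q`-component. A finite `q`-component has finitely many vertices, which carry only finitely
many `(q+1)`-simplices (`PercolatesFromOrigin.of_succ`).

The two outer bounds are proved in an explicit model: independent Poisson numbers of independent
points in cubes, each cube split according to whether the `𝔸`-mark lies in a set `B`. The given
Poisson process lives on an arbitrary probability space, and percolation is not shown to be a
measurable event. Therefore a configuration is encoded by countably many bits, which record the
cells of nested partitions that are hit. The law of the bits is determined by the void
probabilities, which agree in the model and for the process (`map_code_eq`). The bits determine the
configuration, and inner approximation by compact sets carries statements about arbitrary events
over to the process (`modelLaw_le_measure`, `ae_points_of_ae_config`).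

Small intensity: by (V2) for `q = 0` there are almost surely no edges longer than `D`. In cubes of
side `D`, edges only join touching cubes, cubes are occupied independently with probability at most
`β D^d`, and the number of lattice paths grows only exponentially. Hence an infinite cluster at the
origin is impossible for small `β` (`exists_ae_not_percolates`).

Large intensity: take a planar array of cubes so small that points in touching cubes are within `δ`.
Given the positions, the marks `u(ρ)` of different sets `ρ` are independent, because coordinates
identify points (`markLaw_bits_eq`). Each full cube holds `k` base batches of `α` points and further
connecting batches. A site is good if its cube is full, some base batch is a simplex and, for every
base batch here and every base batch in a full right or upper neighbour cube, some connecting batch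
joins the two. All pairs are required because the successful base batches are known only afterwards;
this costs a factor of order `k²` against a failure probability exponential in `k`. Trials at
different sites test disjoint families of sets, so the probability that all sites of a finite set
are bad has a product bound (`measure_bad_le`).

Such a bound suffices for percolation by a hierarchical argument: a box of side `3^(n+1)` is bad if
two of its nine sub-boxes are bad. Bad probabilities then decay so fast that all boxes at the corner
are good with large probability, and good boxes contain linked sites arbitrarily far away
(`measure_exists_boxBad_le`, `exists_far_linked`). Finally the origin is joined to all base points
of its own cube. This has positive probability and uses marks not used elsewhere, so the estimate is
made relative to this event (`exists_measurableSet_percolates`). -/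

theorem face_of_subset {σ ρ : Finset V} (hσ : σ ∈ K.faces) (h : ρ ⊆ σ) (hρ : ρ.Nonempty) :
    ρ ∈ K.faces :=
  (K.isRelLowerSet_faces hσ).2 h hρ

/-- If all sets of `q + 1` or `q + 2` vertices in `F` are faces, then all `q`-simplices in `F` are
up-connected. -/
theorem qGraph_reachable_of_skeleton (F : Finset V)
    (hF : ∀ ρ ⊆ F, ρ.card = q + 1 ∨ ρ.card = q + 2 → ρ ∈ K.faces)
    (σ τ : {σ : Finset V // σ ∈ K.faces ∧ σ.card = q + 1}) (hσ : σ.1 ⊆ F) (hτ : τ.1 ⊆ F) :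
    (qGraph K q).Reachable σ τ := by
  classical
  induction hn : (σ.1 \ τ.1).card generalizing σ with
  | zero =>
    have h : σ.1 ⊆ τ.1 := by
      rw [Finset.card_eq_zero, Finset.sdiff_eq_empty_iff_subset] at hn
      exact hn
    have : σ = τ := Subtype.ext (Finset.eq_of_subset_of_card_le h (by rw [σ.2.2, τ.2.2]))
    rw [this]
  | succ n ih =>
    -- Exchange step: a vertex `a` of `σ \ τ` is replaced by a vertex `b` of `τ \ σ`. The old and
    -- the new simplex lie in `insert b σ`, which has `q + 2` vertices.
    obtain ⟨a, ha⟩ : (σ.1 \ τ.1).Nonempty := by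
      rw [← Finset.card_pos]; omega
    obtain ⟨b, hb⟩ : (τ.1 \ σ.1).Nonempty := by
      rw [← Finset.card_pos]
      have h1 := Finset.card_sdiff_add_card_inter σ.1 τ.1
      have h2 := Finset.card_sdiff_add_card_inter τ.1 σ.1
      rw [Finset.inter_comm] at h2
      have := σ.2.2
      have := τ.2.2
      omega
    rw [Finset.mem_sdiff] at ha hb
    have hbe : b ∉ σ.1.erase a := fun h => hb.2 (Finset.mem_of_mem_erase h)
    have hsub : insert b σ.1 ⊆ F := Finset.insert_subset (hτ hb.1) hσ
    have hsub' : insert b (σ.1.erase a) ⊆ insert b σ.1 :=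
      Finset.insert_subset_insert _ (Finset.erase_subset _ _)
    have hcard : (insert b (σ.1.erase a)).card = q + 1 := by
      rw [Finset.card_insert_of_notMem hbe, Finset.card_erase_of_mem ha.1, σ.2.2]; omega
    let σ' : {σ : Finset V // σ ∈ K.faces ∧ σ.card = q + 1} :=
      ⟨insert b (σ.1.erase a), hF _ (hsub'.trans hsub) (Or.inl hcard), hcard⟩
    have hadj : (qGraph K q).Adj σ σ' := by
      have hc : (insert b σ.1).card = q + 2 := by
        rw [Finset.card_insert_of_notMem hb.2, σ.2.2]
      refine ⟨fun h => ?_, insert b σ.1, hF _ hsub (Or.inr hc), hc, Finset.subset_insert _ _, hsub'⟩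
      have : b ∈ σ.1 := by
        rw [h]; exact Finset.mem_insert_self _ _
      exact hb.2 this
    refine hadj.reachable.trans (ih σ' (hsub'.trans hsub) ?_)
    have : σ'.1 \ τ.1 = (σ.1 \ τ.1).erase a := by
      ext y
      simp only [σ', Finset.mem_sdiff, Finset.mem_insert, Finset.mem_erase]
      constructor
      · rintro ⟨rfl | h, h'⟩
        · exact absurd hb.1 h'
        · exact ⟨h.1, h.2, h'⟩
      · rintro ⟨h1, h2, h3⟩
        exact ⟨Or.inr ⟨h1, h2⟩, h3⟩
    rw [this, Finset.card_erase_of_mem (by simpa using ha), hn]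
    omega

theorem qGraph_reachable_of_common_face {σ : Finset V} (hσ : σ ∈ K.faces)
    (a b : {σ : Finset V // σ ∈ K.faces ∧ σ.card = q + 1}) (ha : a.1 ⊆ σ) (hb : b.1 ⊆ σ) :
    (qGraph K q).Reachable a b := by
  refine qGraph_reachable_of_skeleton σ (fun ρ hρ h => face_of_subset hσ hρ ?_) a b ha hb
  rw [← Finset.card_pos]; omega

/-- `q`-faces of up-connected `(q+1)`-simplices are up-connected. -/
theorem qGraph_reachable_of_reachable_succ
    {σ ρ : {σ : Finset V // σ ∈ K.faces ∧ σ.card = q + 1 + 1}}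
    (h : (qGraph K (q + 1)).Reachable σ ρ)
    (a b : {σ : Finset V // σ ∈ K.faces ∧ σ.card = q + 1}) (ha : a.1 ⊆ σ.1) (hb : b.1 ⊆ ρ.1) :
    (qGraph K q).Reachable a b := by
  classical
  obtain ⟨w⟩ := h
  induction w generalizing a with
  | @nil u => exact qGraph_reachable_of_common_face u.2.1 a b ha hb
  | @cons u v w hadj p ih =>
    obtain ⟨-, π, -, hπc, h1, h2⟩ := hadj
    -- Two sets of `q + 2` vertices inside a common set of `q + 3` vertices share at least `q + 1`
    -- of them.
    have hc : q + 1 ≤ (u.1 ∩ v.1).card := by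
      have h3 := Finset.card_union_add_card_inter u.1 v.1
      have h4 := Finset.card_le_card (Finset.union_subset h1 h2)
      have := u.2.2
      have := v.2.2
      omega
    obtain ⟨c, hcs, hcc⟩ := Finset.exists_subset_card_eq hc
    have hcu : c ⊆ u.1 := hcs.trans Finset.inter_subset_left
    have hcv : c ⊆ v.1 := hcs.trans Finset.inter_subset_right
    let c' : {σ : Finset V // σ ∈ K.faces ∧ σ.card = q + 1} :=
      ⟨c, face_of_subset u.2.1 hcu (by rw [← Finset.card_pos]; omega), hcc⟩
    exact (qGraph_reachable_of_common_face u.2.1 a c' ha hcu).trans (ih c' hcv hb)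

theorem exists_face_of_mem (σ : {σ : Finset V // σ ∈ K.faces ∧ σ.card = q + 1 + 1}) {v : V}
    (hv : v ∈ σ.1) :
    ∃ a : {σ : Finset V // σ ∈ K.faces ∧ σ.card = q + 1}, a.1 ⊆ σ.1 ∧ v ∈ a.1 := by
  obtain ⟨c, h1, h2, h3⟩ := Finset.exists_subsuperset_card_eq (s := {v}) (t := σ.1) (n := q + 1)
    (by simpa using hv) (by simp) (by rw [σ.2.2]; omega)
  exact ⟨⟨c, face_of_subset σ.2.1 h2 ⟨v, h1 (by simp)⟩, h3⟩, h2, h1 (by simp)⟩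

end UpConnectivity

/-- If the `q`-component were finite, its simplices would have a finite set `F` of vertices. Each
vertex of a `(q+1)`-simplex in the given component lies on a `q`-face in this `q`-component, so all
these simplices would be subsets of `F`. -/
theorem PercolatesFromOrigin.of_succ {d α : ℕ} {A : Type*}
    {K : PreAbstractSimplicialComplex (MPoint d α A)} {q : ℕ} (h : PercolatesFromOrigin K (q + 1)) :
    PercolatesFromOrigin K q := by
  classical
  obtain ⟨σ, ⟨p, hp, hp0⟩, hinf⟩ := h
  obtain ⟨a, haσ, hpa⟩ := exists_face_of_mem σ hp
  refine ⟨a, ⟨p, hpa, hp0⟩, fun hfin => hinf ?_⟩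
  let F := hfin.toFinset.biUnion fun b => b.1
  have : ((fun σ : {σ : Finset (MPoint d α A) // σ ∈ K.faces ∧ σ.card = q + 1 + 1} => σ.1) ''
      ((qGraph K (q + 1)).connectedComponentMk σ).supp) ⊆ (F.powerset : Set (Finset _)) := by
    rintro _ ⟨ρ, hρ, rfl⟩
    rw [SimpleGraph.ConnectedComponent.mem_supp_iff, SimpleGraph.ConnectedComponent.eq] at hρ
    rw [Finset.mem_coe, Finset.mem_powerset]
    intro v hv
    obtain ⟨b, hb, hvb⟩ := exists_face_of_mem ρ hv
    refine Finset.mem_biUnion.2 ⟨b, ?_, hvb⟩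
    rw [Set.Finite.mem_toFinset, SimpleGraph.ConnectedComponent.mem_supp_iff,
      SimpleGraph.ConnectedComponent.eq]
    exact qGraph_reachable_of_reachable_succ hρ b a hb haσ
  exact Set.Finite.of_finite_image ((Finset.finite_toSet _).subset this)
    Subtype.val_injective.injOn

/-! ### Transfer of events between random elements with the same law -/

section Transfer

/-- A measurable map between standard Borel spaces sends suitable large subsets of measurable sets
to measurable sets. -/
theorem exists_subset_measurableSet_image {D Z : Type*} [MeasurableSpace D] [StandardBorelSpace D]
    [MeasurableSpace Z] [StandardBorelSpace Z] (μ : Measure D) [IsFiniteMeasure μ] {h : D → Z}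
    (hh : Measurable h) {M : Set D} (hM : MeasurableSet M) {ε : ℝ≥0∞} (hε : ε ≠ 0) :
    ∃ K ⊆ M, MeasurableSet (h '' K) ∧ μ M < μ K + ε := by
  let := upgradeStandardBorel D
  let := upgradeStandardBorel Z
  -- A finer Polish topology makes `h` continuous and keeps the Borel sets, so compact inner
  -- approximations have compact images.
  obtain ⟨t', ht', hc, hp⟩ := hh.exists_continuous
  have hb : @BorelSpace D t' _ := by
    constructor
    rw [eq_borel_upgradeStandardBorel D]
    exact (borel_eq_borel_of_le hp
      (show @PolishSpace D (upgradeStandardBorel D).toTopologicalSpace from inferInstance) ht').symm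
  clear * - hb hc hp hM hε
  obtain ⟨K, hK, hKc, hlt⟩ := @MeasurableSet.exists_isCompact_lt_add D _ μ t'
    (by let := t'; let := TopologicalSpace.upgradeIsCompletelyMetrizable D; infer_instance)
    M hM (measure_ne_top _ _) ε hε
  exact ⟨K, hK, (@IsCompact.image D Z t' _ _ _ hKc hc).isClosed.measurableSet, hlt⟩

variable {Ω D Z : Type*} [MeasurableSpace Ω] {P : Measure Ω} [MeasurableSpace D]
  [StandardBorelSpace D] [MeasurableSpace Z] [StandardBorelSpace Z] {μ : Measure D}
  [IsFiniteMeasure μ] {X : Ω → Z} {h : D → Z}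

/-- `C` is arbitrary and `h '' M` need not be Borel. Up to `ε`, the set `M` is replaced by a subset
whose image is measurable, and for this image the equality of laws applies. -/
theorem measure_le_measure_of_map_eq (hX : Measurable X) (hh : Measurable h)
    (hlaw : P.map X = μ.map h) {C : Set Z} {M : Set D} (hM : MeasurableSet M)
    (hMC : ∀ y ∈ M, h y ∈ C) : μ M ≤ P (X ⁻¹' C) := by
  refine ENNReal.le_of_forall_pos_le_add fun ε hε _ => ?_
  obtain ⟨K, hK, hKm, hlt⟩ := exists_subset_measurableSet_image μ hh hM
    (ε := ε) (by simpa using hε.ne')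
  refine hlt.le.trans (add_le_add_left ?_ _)
  calc μ K ≤ μ (h ⁻¹' (h '' K)) := measure_mono (Set.subset_preimage_image _ _)
    _ = P (X ⁻¹' (h '' K)) := by
      rw [← Measure.map_apply hh hKm, ← hlaw, Measure.map_apply hX hKm]
    _ ≤ P (X ⁻¹' C) := by
      refine measure_mono (Set.preimage_mono ?_)
      rintro _ ⟨y, hy, rfl⟩
      exact hMC y (hK hy)

/-- Outside a measurable null set containing the exceptional points there is a subset of almost full
measure with measurable image. This image lies in `C`, and its preimage under `X` has almost full
probability. -/
theorem ae_of_map_eq [IsFiniteMeasure P] (hX : Measurable X) (hh : Measurable h)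
    (hlaw : P.map X = μ.map h) {C : Set Z} (hC : ∀ᵐ y ∂μ, h y ∈ C) : ∀ᵐ ω ∂P, X ω ∈ C := by
  rw [ae_iff] at hC ⊢
  set T := toMeasurable μ {y | h y ∉ C} with hT
  have hT0 : μ T = 0 := by rw [hT, measure_toMeasurable, hC]
  have huniv : P Set.univ = μ Set.univ := by
    rw [← Set.preimage_univ (f := X), ← Measure.map_apply hX .univ, hlaw,
      Measure.map_apply hh .univ, Set.preimage_univ]
  have hTu : μ Tᶜ = μ Set.univ := by
    rw [measure_compl (measurableSet_toMeasurable _ _) (by rw [hT0]; simp), hT0, tsub_zero]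
  refine le_antisymm (ENNReal.le_of_forall_pos_le_add fun ε hε _ => ?_) zero_le
  obtain ⟨K, hK, hKm, hlt⟩ := exists_subset_measurableSet_image μ hh
    (measurableSet_toMeasurable μ {y | h y ∉ C}).compl (ε := ε) (by simpa using hε.ne')
  have h1 : P (X ⁻¹' (h '' K))ᶜ ≤ ε := by
    rw [measure_compl (hX hKm) (measure_ne_top _ _), tsub_le_iff_right, huniv, ← hTu, add_comm]
    refine hlt.le.trans (add_le_add_left ?_ _)
    rw [← Measure.map_apply hX hKm, hlaw, Measure.map_apply hh hKm]
    exact measure_mono (Set.subset_preimage_image _ _)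
  rw [zero_add]
  refine (measure_mono ?_).trans h1
  rintro ω hω ⟨y, hy, hyω⟩
  refine hω ?_
  have h2 : y ∉ T := hK hy
  by_contra h3
  exact h2 (subset_toMeasurable _ _ (by simpa [hyω] using h3))

end Transfer

/-! ### Laws of hitting families -/

/-- Cylinder sets of families of `Bool`s prescribing finitely many values `false`. -/
def falseCylinders (J : Type*) : Set (Set (J → Bool)) :=
  Set.range fun F : Finset J => {f | ∀ j ∈ F, f j = false}

theorem isPiSystem_falseCylinders (J : Type*) : IsPiSystem (falseCylinders J) := by
  classical
  rintro _ ⟨F, rfl⟩ _ ⟨G, rfl⟩ -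
  refine ⟨F ∪ G, ?_⟩
  ext f
  simp only [Finset.mem_union, Set.mem_inter_iff, Set.mem_ofPred_eq]
  exact ⟨fun h => ⟨fun j hj => h j (Or.inl hj), fun j hj => h j (Or.inr hj)⟩,
    fun h j hj => hj.elim (h.1 j) (h.2 j)⟩

theorem generateFrom_falseCylinders (J : Type*) :
    MeasurableSpace.generateFrom (falseCylinders J) = MeasurableSpace.pi := by
  refine le_antisymm (MeasurableSpace.generateFrom_le ?_) ?_
  · rintro _ ⟨F, rfl⟩
    have : {f : J → Bool | ∀ j ∈ F, f j = false} =
        ⋂ j ∈ F, (fun f : J → Bool => f j) ⁻¹' {false} := by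
      ext; simp
    change MeasurableSet {f : J → Bool | ∀ j ∈ F, f j = false}
    rw [this]
    exact Finset.measurableSet_biInter _ fun j _ => measurable_pi_apply j (by simp)
  · refine iSup_le fun j => ?_
    rw [← measurable_iff_comap_le]
    refine @measurable_to_bool _ (MeasurableSpace.generateFrom (falseCylinders J)) _ ?_
    have : (fun f : J → Bool => f j) ⁻¹' {true} = {f | ∀ i ∈ ({j} : Finset J), f i = false}ᶜ := by
      ext; simp
    rw [this]
    exact (MeasurableSpace.measurableSet_generateFrom
      (Set.mem_range_self ({j} : Finset J))).compl

/-- If the events `f j = false`, `j ∈ F`, are independent of the second component, then the law is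
the product of its marginals. -/
theorem eq_prod_of_falseCylinders {J T₁ T₂ : Type*} [MeasurableSpace T₁] [MeasurableSpace T₂]
    {μ : Measure (J → Bool)} [IsProbabilityMeasure μ] {ν₁ : Measure T₁} [IsProbabilityMeasure ν₁]
    {ν₂ : Measure T₂} [IsProbabilityMeasure ν₂] {m : Measure ((J → Bool) × T₁ × T₂)}
    (h : ∀ (F : Finset J) (s : Set T₁) (t : Set T₂), MeasurableSet s → MeasurableSet t →
      m ({f | ∀ j ∈ F, f j = false} ×ˢ s ×ˢ t) =
        μ {f | ∀ j ∈ F, f j = false} * (ν₁ s * ν₂ t)) :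
    m = μ.prod (ν₁.prod ν₂) := by
  symm
  refine Measure.prod_eq_generateFrom (generateFrom_falseCylinders J) generateFrom_prod
    (isPiSystem_falseCylinders J) isPiSystem_prod
    ⟨fun _ => Set.univ, fun _ => ⟨∅, by simp⟩, fun _ => measure_lt_top _ _, Set.iUnion_const _⟩
    ⟨fun _ => Set.univ, fun _ => ⟨Set.univ, .univ, Set.univ, .univ, by simp⟩,
      fun _ => measure_lt_top _ _, Set.iUnion_const _⟩ ?_
  rintro _ ⟨F, rfl⟩ _ ⟨s, hs, t, ht, rfl⟩
  rw [h F s t hs ht, Measure.prod_prod]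

/-! ### Recovering point configurations from hitting families -/

/-- This gap between 0 and 1 survives the limit along shrinking cells and thus produces atoms. -/
theorem one_le_of_mem_countingMeasures {X : Type*} [MeasurableSpace X] {η : Measure X}
    (hη : η ∈ countingMeasures X) {B : Set X}
    (hB : MeasurableSet B) (h0 : η B ≠ 0) : 1 ≤ η B := by
  obtain ⟨m, hm, rfl⟩ := hη
  rw [Measure.sum_apply _ hB] at h0 ⊢
  obtain ⟨n, hn⟩ : ∃ n, m n B ≠ 0 := by
    by_contra! h
    simp [h] at h0
  refine le_trans ?_ (ENNReal.le_tsum n)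
  obtain ⟨k, hk⟩ := hm n B hB
  rw [hk] at hn ⊢
  exact_mod_cast Nat.one_le_iff_ne_zero.2 (by exact_mod_cast hn)

section Decode

variable {X ι : Type*} [MeasurableSpace X] [MeasurableSpace.CountablyGenerated X]

/-- The points of `W c` whose binary expansion agrees with `b` on the first coordinates. -/
noncomputable def hitSet (W : ι → Set X) (j : ι × Σ k : ℕ, (Fin k → Bool)) : Set X :=
  {p ∈ W j.1 | ∀ i : Fin j.2.1, MeasurableSpace.mapNatBool X p i = j.2.2 i}

/-- The binary cell of depth `k` containing `p`. -/
noncomputable def binaryPrefix (k : ℕ) (p : X) : Σ k : ℕ, (Fin k → Bool) :=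
  ⟨k, fun i => MeasurableSpace.mapNatBool X p i⟩

/-- The locally finite configuration with the given hitting family. -/
noncomputable def decode (W : ι → Set X) (f : ι × (Σ k : ℕ, (Fin k → Bool)) → Bool) : Set X :=
  {p | ∀ c k, p ∈ W c → f (c, binaryPrefix k p) = true}

theorem measurableSet_hitSet {W : ι → Set X} (hW : ∀ c, MeasurableSet (W c))
    (j : ι × Σ k : ℕ, (Fin k → Bool)) : MeasurableSet (hitSet W j) := by
  have : hitSet W j = W j.1 ∩ ⋂ i : Fin j.2.1,
      (fun p => MeasurableSpace.mapNatBool X p i) ⁻¹' {j.2.2 i} := by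
    ext; simp [hitSet]
  rw [this]
  refine (hW _).inter (MeasurableSet.iInter fun i => ?_)
  exact ((measurable_pi_apply _).comp (MeasurableSpace.measurable_mapNatBool X)) (by simp)

theorem mem_hitSet_binaryPrefix {W : ι → Set X} {c : ι} {p : X} (k : ℕ) (hp : p ∈ W c) :
    p ∈ hitSet W (c, binaryPrefix k p) :=
  ⟨hp, fun _ => rfl⟩

theorem hitSet_subset (W : ι → Set X) (j : ι × Σ k : ℕ, (Fin k → Bool)) : hitSet W j ⊆ W j.1 :=
  fun _ h => h.1

theorem antitone_hitSet_binaryPrefix (W : ι → Set X) (c : ι) (p : X) :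
    Antitone fun k => hitSet W (c, binaryPrefix k p) := by
  intro k l hkl y hy
  exact ⟨hy.1, fun i => hy.2 ⟨i.1, i.2.trans_le hkl⟩⟩

/-- A point is determined by its binary expansion with respect to a countable generating and
separating family. -/
theorem iInter_hitSet_binaryPrefix [MeasurableSpace.SeparatesPoints X] {W : ι → Set X} {c : ι}
    {p : X} (hp : p ∈ W c) : ⋂ k, hitSet W (c, binaryPrefix k p) = {p} := by
  ext y
  simp only [Set.mem_iInter, Set.mem_singleton_iff]
  constructor
  · intro h
    refine MeasurableSpace.injective_mapNatBool X (funext fun k => ?_)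
    exact (h (k + 1)).2 ⟨k, Nat.lt_succ_self k⟩
  · rintro rfl k
    exact mem_hitSet_binaryPrefix k hp

variable [MeasurableSpace.SeparatesPoints X]

/-- If all binary cells around `p` are hit, finiteness of `S ∩ W c` gives one point of `S` lying in
infinitely many of these nested cells, hence in all of them; this point is `p`. -/
theorem decode_of_finite {W : ι → Set X} (hcov : ⋃ c, W c = Set.univ) {S : Set X}
    (hS : ∀ c, (S ∩ W c).Finite) {f : ι × (Σ k : ℕ, (Fin k → Bool)) → Bool}
    (hf : ∀ j, f j = true ↔ (S ∩ hitSet W j).Nonempty) : decode W f = S := by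
  ext p
  constructor
  · intro h
    obtain ⟨c, hc⟩ := Set.mem_iUnion.1 (hcov.symm ▸ Set.mem_univ p)
    by_contra hp
    have h1 : ∀ k, ∃ y ∈ S ∩ W c, y ∈ hitSet W (c, binaryPrefix k p) := fun k => by
      obtain ⟨y, hy1, hy2⟩ := (hf _).1 (h c k hc)
      exact ⟨y, ⟨hy1, hy2.1⟩, hy2⟩
    choose y hy hy' using h1
    obtain ⟨q, hqS, hq⟩ : ∃ q ∈ S ∩ W c, ∃ᶠ k in Filter.atTop, y k = q := by
      by_contra! h2
      obtain ⟨k, hk⟩ := ((Filter.eventually_all_finite (hS c)).2 h2).exists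
      exact hk _ (hy k) rfl
    have : q ∈ ⋂ k, hitSet W (c, binaryPrefix k p) := Set.mem_iInter.2 fun k => by
      obtain ⟨l, hl, rfl⟩ := Filter.frequently_atTop.1 hq k
      exact antitone_hitSet_binaryPrefix W c p hl (hy' l)
    rw [iInter_hitSet_binaryPrefix hc] at this
    exact hp (this ▸ hqS.1)
  · exact fun hp c k hc => (hf _).2 ⟨p, hp, mem_hitSet_binaryPrefix k hc⟩

/-- The masses of the nested cells around `p` decrease to `η {p}` by continuity from above. If all
cells are hit, each mass is at least one, so `p` is an atom. -/
theorem decode_of_countingMeasure {W : ι → Set X} (hW : ∀ c, MeasurableSet (W c))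
    (hcov : ⋃ c, W c = Set.univ) {η : Measure X} (hη : η ∈ countingMeasures X)
    (hfin : ∀ c, η (W c) ≠ ∞) {f : ι × (Σ k : ℕ, (Fin k → Bool)) → Bool}
    (hf : ∀ j, f j = true ↔ η (hitSet W j) ≠ 0) : decode W f = points η := by
  ext p
  obtain ⟨c, hc⟩ := Set.mem_iUnion.1 (hcov.symm ▸ Set.mem_univ p)
  constructor
  · intro h
    have h1 : Filter.Tendsto (fun k => η (hitSet W (c, binaryPrefix k p))) Filter.atTop
        (nhds (η {p})) := by
      rw [← iInter_hitSet_binaryPrefix hc]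
      exact tendsto_measure_iInter_atTop
        (fun k => (measurableSet_hitSet hW _).nullMeasurableSet)
        (antitone_hitSet_binaryPrefix W c p)
        ⟨0, ((measure_mono (hitSet_subset W _)).trans_lt (hfin c).lt_top).ne⟩
    have h2 : 1 ≤ η {p} := ge_of_tendsto' h1 fun k =>
      one_le_of_mem_countingMeasures hη (measurableSet_hitSet hW _) ((hf _).1 (h c k hc))
    exact (zero_lt_one.trans_le h2).ne'
  · intro hp c k hc
    refine (hf _).2 fun h => hp ?_
    exact measure_mono_null (Set.singleton_subset_iff.2 (mem_hitSet_binaryPrefix k hc)) h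

end Decode

/-! ### An explicit superposition of Poisson processes with marks -/

theorem lintegral_prod_infinitePi {ι : Type*} {X : ι → Type*} [∀ i, MeasurableSpace (X i)]
    (μ : ∀ i, Measure (X i)) [∀ i, IsProbabilityMeasure (μ i)] (s : Finset ι)
    {g : ∀ i, X i → ℝ≥0∞} (hg : ∀ i, Measurable (g i)) :
    ∫⁻ x, ∏ i ∈ s, g i (x i) ∂Measure.infinitePi μ = ∏ i ∈ s, ∫⁻ y, g i y ∂μ i := by
  refine (lintegral_prod_eq_prod_lintegral_of_indepFun (μ := Measure.infinitePi μ) s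
    (fun i x => g i (x i)) (iIndepFun_infinitePi hg) (fun i => by fun_prop)).trans ?_
  refine Finset.prod_congr rfl fun i _ => ?_
  conv_rhs => rw [← Measure.infinitePi_map_eval μ i, lintegral_map (hg i) (by fun_prop)]

/-- The generating function of the Poisson distribution at `1 - b`: each point independently avoids
a set of probability `b`. -/
theorem lintegral_pow_poissonMeasure (r : ℝ≥0) {b : ℝ≥0∞} (hb : b ≤ 1) :
    ∫⁻ n, (1 - b) ^ n ∂poissonMeasure r = ENNReal.ofReal (Real.exp (-(r * b.toReal))) := by
  have hb' : b ≠ ∞ := (hb.trans_lt ENNReal.one_lt_top).ne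
  set x : ℝ := 1 - b.toReal with hx
  have hx0 : 0 ≤ x := by
    rw [hx, sub_nonneg]; exact ENNReal.toReal_le_of_le_ofReal zero_le_one (by simpa using hb)
  have h1 : 1 - b = ENNReal.ofReal x := by
    rw [hx, ENNReal.ofReal_sub _ ENNReal.toReal_nonneg, ENNReal.ofReal_one,
      ENNReal.ofReal_toReal hb']
  rw [poissonMeasure, lintegral_sum_measure]
  simp only [lintegral_smul_measure, lintegral_dirac, h1, smul_eq_mul]
  have h2 : ∀ n : ℕ, ENNReal.ofReal (Real.exp (-r) * r ^ n / n.factorial) * ENNReal.ofReal x ^ n =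
      ENNReal.ofReal (Real.exp (-r) * ((r * x) ^ n / n.factorial)) := fun n => by
    rw [← ENNReal.ofReal_pow hx0, ← ENNReal.ofReal_mul (by positivity)]
    congr 1
    rw [mul_pow]; ring
  have h3 : HasSum (fun n : ℕ => Real.exp (-r) * ((r * x) ^ n / n.factorial))
      (Real.exp (-r) * Real.exp (r * x)) := by
    rw [Real.exp_eq_exp_ℝ]
    exact (NormedSpace.expSeries_div_hasSum_exp (r * x : ℝ)).mul_left _
  simp only [h2]
  rw [← ENNReal.ofReal_tsum_of_nonneg (fun n => by positivity) h3.summable, h3.tsum_eq,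
    ← Real.exp_add, hx]
  congr 2
  ring

section Superposition

variable {R A Y M : Type*} [MeasurableSpace A] [MeasurableSpace Y] [MeasurableSpace M]

/-- Numbers of points in the pieces, mark of the origin, positions and marks of the points. -/
abbrev PointData (R A Y : Type*) : Type _ := (R → ℕ) × A × (R × ℕ → Y)

/-- The law of independent Poisson numbers, the mark at the origin, and points. -/
noncomputable def pointLaw (lam : R → ℝ≥0) (Θ : Measure A) (ν : R → Measure Y) :
    Measure (PointData R A Y) :=
  (Measure.infinitePi fun r => poissonMeasure (lam r)).prod
    (Θ.prod (Measure.infinitePi fun i : R × ℕ => ν i.1))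

/-- The law of independent additional marks of all points and of the origin. -/
noncomputable def markLaw (R : Type*) (Q : Measure M) : Measure (Option (R × ℕ) → M) :=
  Measure.infinitePi fun _ => Q

variable (lam : R → ℝ≥0) (Θ : Measure A) [IsProbabilityMeasure Θ] (ν : R → Measure Y)
  [∀ r, IsProbabilityMeasure (ν r)] (Q : Measure M) [IsProbabilityMeasure Q]

instance : IsProbabilityMeasure (pointLaw lam Θ ν) := by unfold pointLaw; infer_instance

instance : IsProbabilityMeasure (markLaw R Q) := by unfold markLaw; infer_instance

theorem measurableSet_void (s : Finset R) {B : Set (Y × M)} (hB : MeasurableSet B) :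
    MeasurableSet {y : PointData R A Y × (Option (R × ℕ) → M) |
      ∀ r ∈ s, ∀ i < y.1.1 r, (y.1.2.2 (r, i), y.2 (some (r, i))) ∉ B} := by
  simp only [Set.ofPred_forall]
  refine Finset.measurableSet_biInter _ fun r _ => MeasurableSet.iInter fun i => ?_
  have h1 : MeasurableSet {y : PointData R A Y × (Option (R × ℕ) → M) | i < y.1.1 r} :=
    measurableSet_lt (by fun_prop) (by fun_prop)
  have h2 : MeasurableSet {y : PointData R A Y × (Option (R × ℕ) → M) |
      (y.1.2.2 (r, i), y.2 (some (r, i))) ∈ B} := by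
    have : Measurable fun y : PointData R A Y × (Option (R × ℕ) → M) =>
      (y.1.2.2 (r, i), y.2 (some (r, i))) := by fun_prop
    exact this hB
  convert h1.compl.union h2.compl using 1
  ext; simp [imp_iff_not_or]

/-- Integrate out the additional marks, then the positions, then the numbers of points. Given the
numbers, each point of piece `r` avoids `B` independently with the same probability, and the Poisson
generating function turns the powers into an exponential. The origin's marks are carried along to
obtain the joint law. -/
theorem measure_void (s : Finset R) {B : Set (Y × M)} (hB : MeasurableSet B) {TV : Set A}
    (hTV : MeasurableSet TV) {TU : Set M} (hTU : MeasurableSet TU) :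
    ((pointLaw lam Θ ν).prod (markLaw R Q)) {y | y.1.2.1 ∈ TV ∧ y.2 none ∈ TU ∧
      ∀ r ∈ s, ∀ i < y.1.1 r, (y.1.2.2 (r, i), y.2 (some (r, i))) ∉ B} =
    ENNReal.ofReal (Real.exp (-∑ r ∈ s, lam r * ((ν r).prod Q B).toReal)) * (Θ TV * Q TU) := by
  classical
  set f : Y → ℝ≥0∞ := fun y => Q {u | (y, u) ∉ B} with hf
  have hfm : Measurable f := measurable_measure_prodMk_left hB.compl
  have hfint : ∀ r, ∫⁻ y, f y ∂ν r = 1 - (ν r).prod Q B := fun r => by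
    rw [← prob_compl_eq_one_sub hB, Measure.prod_apply hB.compl]; rfl
  have hE : MeasurableSet {y : PointData R A Y × (Option (R × ℕ) → M) | y.1.2.1 ∈ TV ∧
      y.2 none ∈ TU ∧ ∀ r ∈ s, ∀ i < y.1.1 r, (y.1.2.2 (r, i), y.2 (some (r, i))) ∉ B} := by
    refine MeasurableSet.inter ?_ (MeasurableSet.inter ?_ (measurableSet_void s hB))
    · have : Measurable fun y : PointData R A Y × (Option (R × ℕ) → M) => y.1.2.1 := by fun_prop
      exact this hTV
    · have : Measurable fun y : PointData R A Y × (Option (R × ℕ) → M) => y.2 none := by fun_prop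
      exact this hTU
  -- For fixed point data the event is a finite cylinder in the additional marks, with one factor
  -- per present point and one for the origin.
  have hsec : ∀ x : PointData R A Y, markLaw R Q (Prod.mk x ⁻¹' {y | y.1.2.1 ∈ TV ∧
      y.2 none ∈ TU ∧ ∀ r ∈ s, ∀ i < y.1.1 r, (y.1.2.2 (r, i), y.2 (some (r, i))) ∉ B}) =
      TV.indicator 1 x.2.1 * (Q TU * ∏ r ∈ s, ∏ i ∈ Finset.range (x.1 r), f (x.2.2 (r, i))) := by
    rintro ⟨N, v, y⟩
    by_cases hv : v ∈ TV
    · simp only [hv, Set.indicator_of_mem, Pi.one_apply, one_mul, Set.preimage_ofPred_eq, true_and]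
      let L : Finset (R × ℕ) := (s.sigma fun r => Finset.range (N r)).map
        (Equiv.sigmaEquivProd R ℕ).toEmbedding
      let t : Option (R × ℕ) → Set M := fun o => o.elim TU fun i => {u | (y i, u) ∉ B}
      have h1 : {u : Option (R × ℕ) → M | u none ∈ TU ∧ ∀ r ∈ s, ∀ i < N r,
          (y (r, i), u (some (r, i))) ∉ B} = Set.pi (Finset.insertNone L) t := by
        ext u
        simp [Set.mem_pi, t, L, Option.forall]
        exact fun _ => ⟨fun h a b ha hb => h a ha b hb, fun h a ha b hb => h a b ha hb⟩
      rw [h1, markLaw, Measure.infinitePi_pi, Finset.prod_insertNone]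
      · simp [t, L, Finset.prod_sigma, hf]
      · rintro (_ | i) -
        · exact hTU
        · exact measurable_prodMk_left hB.compl
    · simp [hv]
  have hm1 : ∀ N : R → ℕ, Measurable fun y : R × ℕ → Y =>
      ∏ r ∈ s, ∏ i ∈ Finset.range (N r), f (y (r, i)) := fun N =>
    Finset.measurable_fun_prod _ fun r _ => Finset.measurable_fun_prod _ fun i _ =>
      hfm.comp (measurable_pi_apply _)
  rw [Measure.prod_apply hE]
  simp only [hsec]
  have hm2 : Measurable fun x : PointData R A Y =>
      TV.indicator (1 : A → ℝ≥0∞) x.2.1 *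
        (Q TU * ∏ r ∈ s, ∏ i ∈ Finset.range (x.1 r), f (x.2.2 (r, i))) := by
    simp only [← hsec]
    exact measurable_measure_prodMk_left hE
  rw [pointLaw, lintegral_prod _ hm2.aemeasurable]
  -- Averaging over the positions replaces each factor by the probability that one point avoids `B`.
  have hin : ∀ N : R → ℕ, ∫⁻ z : A × (R × ℕ → Y), TV.indicator (1 : A → ℝ≥0∞) z.1 *
        (Q TU * ∏ r ∈ s, ∏ i ∈ Finset.range (N r), f (z.2 (r, i)))
        ∂(Θ.prod (Measure.infinitePi fun i : R × ℕ => ν i.1)) =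
      Θ TV * Q TU * ∏ r ∈ s, (1 - (ν r).prod Q B) ^ N r := fun N => by
    rw [lintegral_prod_mul (μ := Θ) (ν := Measure.infinitePi fun i : R × ℕ => ν i.1)
      (f := TV.indicator 1)
      (g := fun z => Q TU * ∏ r ∈ s, ∏ i ∈ Finset.range (N r), f (z (r, i)))
      ((measurable_one.indicator hTV).aemeasurable) ((hm1 N).const_mul _).aemeasurable,
      lintegral_const_mul _ (hm1 N), lintegral_indicator_one hTV, mul_assoc]
    congr 2
    have := lintegral_prod_infinitePi (fun i : R × ℕ => ν i.1)
      ((s.sigma fun r => Finset.range (N r)).map (Equiv.sigmaEquivProd R ℕ).toEmbedding)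
      (g := fun _ => f) (fun _ => hfm)
    simpa [Finset.prod_sigma, hfint] using this
  simp only [hin]
  rw [lintegral_const_mul _ (Finset.measurable_fun_prod _ fun r _ => by fun_prop), mul_comm]
  congr 1
  rw [lintegral_prod_infinitePi (fun r => poissonMeasure (lam r)) s
    (g := fun r n => (1 - (ν r).prod Q B) ^ n) (fun r => by fun_prop)]
  simp only [lintegral_pow_poissonMeasure _ (prob_le_one (μ := (ν _).prod Q))]
  rw [← ENNReal.ofReal_prod_of_nonneg (fun _ _ => by positivity), ← Real.exp_sum,
    Finset.sum_neg_distrib]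

end Superposition

/-! ### The decomposition into cells -/

section Cells

variable {d : ℕ}

/-- The half-open cube with side length `s` and lower left corner `s c`. -/
def cell (s : ℝ) (c : Fin d → ℤ) : Set (EuclideanSpace ℝ (Fin d)) :=
  {x | ∀ i, s * c i ≤ x i ∧ x i < s * (c i + 1)}

theorem mem_cell_iff {s : ℝ} (hs : 0 < s) {c : Fin d → ℤ} {x : EuclideanSpace ℝ (Fin d)} :
    x ∈ cell s c ↔ (fun i => ⌊x i / s⌋) = c := by
  simp only [cell, Set.mem_ofPred_eq, funext_iff, Int.floor_eq_iff, le_div_iff₀ hs, div_lt_iff₀ hs]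
  refine forall_congr' fun i => ?_
  rw [mul_comm s, mul_comm s]

theorem iUnion_cell {s : ℝ} (hs : 0 < s) : ⋃ c, cell (d := d) s c = Set.univ :=
  Set.eq_univ_of_forall fun _ => Set.mem_iUnion.2 ⟨_, (mem_cell_iff hs).2 rfl⟩

theorem eq_of_mem_cell {s : ℝ} (hs : 0 < s) {c c' : Fin d → ℤ} {x : EuclideanSpace ℝ (Fin d)}
    (h : x ∈ cell s c) (h' : x ∈ cell s c') : c = c' :=
  ((mem_cell_iff hs).1 h).symm.trans ((mem_cell_iff hs).1 h')

theorem cell_eq_preimage (s : ℝ) (c : Fin d → ℤ) :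
    cell s c = (MeasurableEquiv.toLp 2 (Fin d → ℝ)).symm ⁻¹'
      Set.univ.pi fun i => Set.Ico (s * c i) (s * (c i + 1)) := by
  ext x
  simp [cell, Set.mem_pi]

theorem measurableSet_cell (s : ℝ) (c : Fin d → ℤ) : MeasurableSet (cell s c) := by
  rw [cell_eq_preimage]
  exact (MeasurableEquiv.measurable _) (MeasurableSet.univ_pi fun i => measurableSet_Ico)

theorem volume_cell (s : ℝ) (c : Fin d → ℤ) : volume (cell s c) = ENNReal.ofReal s ^ d := by
  rw [cell_eq_preimage, (EuclideanSpace.volume_preserving_symm_measurableEquiv_toLp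
    (Fin d)).measure_preimage (MeasurableSet.univ_pi fun i => measurableSet_Ico).nullMeasurableSet,
    Real.volume_pi_Ico]
  simp [mul_add]

end Cells

section Pieces

variable {d α : ℕ} {A : Type*} [MeasurableSpace A]

/-- The pieces of `ℝ^d × 𝔸`: a cell together with a part of the mark space. -/
abbrev Piece (d : ℕ) : Type := (Fin d → ℤ) × Bool

/-- The set `B` or its complement. -/
def markPart (B : Set A) (b : Bool) : Set A := if b then B else Bᶜ

theorem measurableSet_markPart {B : Set A} (hB : MeasurableSet B) (b : Bool) :
    MeasurableSet (markPart B b) := by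
  cases b <;> simp [markPart, hB]

open Classical in
/-- The mark law conditioned on a part of the mark space. -/
noncomputable def markPartLaw (Θ : Measure A) (B : Set A) (b : Bool) : Measure A :=
  -- The default `Θ` only keeps this a probability measure: such a piece has rate zero, so its
  -- points are almost surely absent.
  if Θ (markPart B b) = 0 then Θ else cond Θ (markPart B b)

instance (Θ : Measure A) [IsProbabilityMeasure Θ] (B : Set A) (b : Bool) :
    IsProbabilityMeasure (markPartLaw Θ B b) := by
  unfold markPartLaw
  split_ifs with h
  · infer_instance
  · exact cond_isProbabilityMeasure h

theorem smul_markPartLaw (Θ : Measure A) [IsProbabilityMeasure Θ] (B : Set A) (b : Bool) :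
    Θ (markPart B b) • markPartLaw Θ B b = Θ.restrict (markPart B b) := by
  unfold markPartLaw
  split_ifs with h
  · rw [h, zero_smul, Measure.restrict_eq_zero.2 h]
  · rw [ProbabilityTheory.cond, smul_smul, ENNReal.mul_inv_cancel h (measure_ne_top _ _), one_smul]

theorem markPartLaw_absolutelyContinuous (Θ : Measure A) (B : Set A) (b : Bool) :
    markPartLaw Θ B b ≪ Θ := by
  unfold markPartLaw
  split_ifs with h
  · exact Measure.AbsolutelyContinuous.rfl
  · exact cond_absolutelyContinuous

/-- The law of a point in a piece. -/
noncomputable def pieceLaw (s : ℝ) (Θ : Measure A) (B : Set A) (r : Piece d) :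
    Measure (EuclideanSpace ℝ (Fin d) × A) :=
  (cond volume (cell s r.1)).prod (markPartLaw Θ B r.2)

/-- The mean number of points in a piece. -/
noncomputable def pieceRate (s : ℝ) (Θ : Measure A) (B : Set A) (β : ℝ≥0) (r : Piece d) : ℝ≥0 :=
  β * (s.toNNReal ^ d * (Θ (markPart B r.2)).toNNReal)

variable {s : ℝ} [hs : Fact (0 < s)] (Θ : Measure A) [IsProbabilityMeasure Θ] {B : Set A}

theorem volume_cell_ne_zero (c : Fin d → ℤ) : volume (cell s c) ≠ 0 := by
  rw [volume_cell]
  exact pow_ne_zero _ (by simpa using hs.out)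

theorem volume_cell_ne_top (s : ℝ) (c : Fin d → ℤ) : volume (cell s c) ≠ ∞ := by
  rw [volume_cell]
  exact ENNReal.pow_ne_top ENNReal.ofReal_ne_top

instance (c : Fin d → ℤ) : IsProbabilityMeasure (cond volume (cell s c)) :=
  cond_isProbabilityMeasure_of_finite (volume_cell_ne_zero c) (volume_cell_ne_top s c)

instance (B : Set A) (r : Piece d) : IsProbabilityMeasure (pieceLaw s Θ B r) := by
  unfold pieceLaw; infer_instance

instance : IsProbabilityMeasure (edgeMarkLaw α) := by unfold edgeMarkLaw; infer_instance

instance standardBorelSpace_edgeMarks (L : Type*) [Countable L] :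
    StandardBorelSpace (L → EdgeMarks α) := StandardBorelSpace.pi_countable

theorem pieceLaw_absolutelyContinuous (B : Set A) (r : Piece d) :
    pieceLaw s Θ B r ≪ (volume : Measure (EuclideanSpace ℝ (Fin d))).prod Θ :=
  Measure.AbsolutelyContinuous.prod cond_absolutelyContinuous
    (markPartLaw_absolutelyContinuous Θ B r.2)

variable (α) in
/-- The intensity measure of the Poisson process. -/
noncomputable def intensity (d : ℕ) (Θ : Measure A) (β : ℝ≥0) : Measure (MPoint d α A) :=
  β • (volume : Measure (EuclideanSpace ℝ (Fin d))).prod (Θ.prod (edgeMarkLaw α))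

/-- The rate contains exactly the normalising constants of the two conditionings, so they cancel. -/
theorem pieceRate_mul_pieceLaw (B : Set A) (β : ℝ≥0) (r : Piece d) {G : Set (MPoint d α A)}
    (hG : MeasurableSet G) :
    pieceRate s Θ B β r * ((pieceLaw s Θ B r).prod (edgeMarkLaw α))
      (MeasurableEquiv.prodAssoc ⁻¹' G) =
    (intensity α d Θ β).restrict (cell s r.1 ×ˢ markPart B r.2 ×ˢ Set.univ) G := by
  have h1 : (volume : Measure (EuclideanSpace ℝ (Fin d))).restrict (cell s r.1) =
      ENNReal.ofReal s ^ d • cond volume (cell s r.1) := by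
    rw [ProbabilityTheory.cond, smul_smul, volume_cell, ENNReal.mul_inv_cancel, one_smul]
    · rw [← volume_cell s r.1]; exact volume_cell_ne_zero _
    · rw [← volume_cell s r.1]; exact volume_cell_ne_top _ _
  have h2 : (pieceRate s Θ B β r : ℝ≥0∞) =
      β * (ENNReal.ofReal s ^ d * Θ (markPart B r.2)) := by
    simp [pieceRate, ENNReal.ofReal, ENNReal.coe_toNNReal (measure_ne_top Θ _)]
  rw [intensity, Measure.restrict_smul, ← Measure.prod_restrict, ← Measure.prod_restrict,
    Measure.restrict_univ, h1, ← smul_markPartLaw, ← Measure.map_apply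
    (MeasurableEquiv.measurable _) hG, pieceLaw, Measure.prodAssoc_prod, h2,
    Measure.prod_smul_left, Measure.prod_smul_left, Measure.prod_smul_right]
  simp only [Measure.smul_apply, smul_eq_mul, ENNReal.smul_def]
  ring

/-- The pieces are disjoint, and those above the cells in `cs` cover `G`. -/
theorem sum_pieceRate_mul_pieceLaw (hB : MeasurableSet B) (β : ℝ≥0) (cs : Finset (Fin d → ℤ))
    {G : Set (MPoint d α A)} (hG : MeasurableSet G) (hGcs : ∀ p ∈ G, ∃ c ∈ cs, p.1 ∈ cell s c) :
    ∑ r ∈ cs ×ˢ (Finset.univ : Finset Bool), pieceRate s Θ B β r *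
      ((pieceLaw s Θ B r).prod (edgeMarkLaw α)) (MeasurableEquiv.prodAssoc ⁻¹' G) =
    intensity α d Θ β G := by
  simp only [pieceRate_mul_pieceLaw Θ B β _ hG, Measure.restrict_apply hG]
  rw [← measure_biUnion_finset]
  · congr 1
    ext p
    simp only [Set.mem_iUnion, Set.mem_inter_iff, Set.mem_prod, Set.mem_univ, and_true]
    constructor
    · rintro ⟨_, -, h, -⟩
      exact h
    · intro hp
      obtain ⟨c, hc, hpc⟩ := hGcs p hp
      by_cases hb : p.2.1 ∈ B
      · exact ⟨(c, true), by simpa using hc, hp, hpc, by simpa [markPart] using hb⟩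
      · exact ⟨(c, false), by simpa using hc, hp, hpc, by simpa [markPart] using hb⟩
  · rintro ⟨c, b⟩ - ⟨c', b'⟩ - hne
    refine Set.disjoint_left.2 fun p hp hp' => hne ?_
    have h1 : c = c' := eq_of_mem_cell hs.out hp.2.1 hp'.2.1
    have h2 : p.2.1 ∈ markPart B b := hp.2.2.1
    have h3 : p.2.1 ∈ markPart B b' := hp'.2.2.1
    cases b <;> cases b' <;> simp_all [markPart]
  · intro r _
    exact hG.inter ((measurableSet_cell _ _).prod ((measurableSet_markPart hB _).prod .univ))

/-- The guard `0 < Θ B` is needed because for a null set `B` the mark in the `true` piece follows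
the default law `Θ`. -/
theorem ae_mem_pieceLaw (hB : MeasurableSet B) (r : Piece d) :
    ∀ᵐ y ∂(pieceLaw s Θ B r), y.1 ∈ cell s r.1 ∧ (0 < Θ B → r.2 = true → y.2 ∈ B) := by
  have h1 : ∀ᵐ x ∂(cond volume (cell s r.1)), x ∈ cell s r.1 :=
    ae_cond_mem (measurableSet_cell _ _)
  have h2 : ∀ᵐ a ∂(markPartLaw Θ B r.2), 0 < Θ B → r.2 = true → a ∈ B := by
    obtain ⟨c, _ | _⟩ := r
    · simp
    · by_cases h : 0 < Θ B
      · have : markPartLaw Θ B true = cond Θ B := by simp [markPartLaw, markPart, h.ne']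
        simp only [this]
        filter_upwards [ae_cond_mem (μ := Θ) hB] with a ha _ _ using ha
      · simp [h]
  filter_upwards [Measure.quasiMeasurePreserving_fst.ae h1,
    Measure.quasiMeasurePreserving_snd.ae h2] with y hy1 hy2 using ⟨hy1, hy2⟩

end Pieces

/-! ### The explicit model -/

section Model

variable {d α : ℕ} {A : Type*} [MeasurableSpace A]

/-- Labels of the points other than the origin. -/
abbrev Label (d : ℕ) : Type := Piece d × ℕ

/-- Sample space of the explicit model. -/
abbrev ModelSpace (d α : ℕ) (A : Type*) : Type _ :=
  PointData (Piece d) A (EuclideanSpace ℝ (Fin d) × A) × (Option (Label d) → EdgeMarks α)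

variable (α) in
/-- The law of the explicit model. -/
noncomputable def modelLaw (s : ℝ) (Θ : Measure A) (B : Set A) (β : ℝ≥0) :
    Measure (ModelSpace d α A) :=
  (pointLaw (pieceRate s Θ B β) Θ (pieceLaw s Θ B)).prod (markLaw (Piece d) (edgeMarkLaw α))

/-- The position of the point with a given label; the label `none` stands for the origin. -/
def pos (x : PointData (Piece d) A (EuclideanSpace ℝ (Fin d) × A)) (o : Option (Label d)) :
    EuclideanSpace ℝ (Fin d) :=
  o.elim 0 fun i => (x.2.2 i).1

/-- The `𝔸`-mark of the point with a given label. -/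
def mk (x : PointData (Piece d) A (EuclideanSpace ℝ (Fin d) × A)) (o : Option (Label d)) : A :=
  o.elim x.2.1 fun i => (x.2.2 i).2

/-- The point with a given label. -/
def pt (y : ModelSpace d α A) (o : Option (Label d)) : MPoint d α A :=
  (pos y.1 o, mk y.1 o, y.2 o)

/-- The labels of the points which are present. -/
def present (x : PointData (Piece d) A (EuclideanSpace ℝ (Fin d) × A)) : Set (Option (Label d)) :=
  {o | ∀ i ∈ o, i.2 < x.1 i.1}

/-- The point configuration of the model, including the origin. -/
def config (y : ModelSpace d α A) : Set (MPoint d α A) := pt y '' present y.1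

/-- The point configuration of the model without the origin. -/
def poissonConfig (y : ModelSpace d α A) : Set (MPoint d α A) :=
  {p | ∃ r, ∃ i < y.1.1 r, p = pt y (some (r, i))}

theorem config_eq (y : ModelSpace d α A) : config y = poissonConfig y ∪ {pt y none} := by
  ext p
  simp only [config, present, poissonConfig, Set.mem_image, Set.mem_ofPred_eq, Set.mem_union,
    Set.mem_singleton_iff]
  constructor
  · rintro ⟨_ | ⟨r, i⟩, h, rfl⟩
    · exact Or.inr rfl
    · exact Or.inl ⟨r, i, h _ rfl, rfl⟩
  · rintro (⟨r, i, h, rfl⟩ | rfl)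
    · refine ⟨some (r, i), ?_, rfl⟩
      rintro _ ⟨⟩
      exact h
    · exact ⟨none, by simp, rfl⟩

variable {s : ℝ} [hs : Fact (0 < s)] (Θ : Measure A) [IsProbabilityMeasure Θ] {B : Set A}

instance (β : ℝ≥0) : IsProbabilityMeasure (modelLaw (d := d) α s Θ B β) := by
  unfold modelLaw; infer_instance

/-- Every labelled point lies in its cell, and has its mark in the right part of the mark space. -/
def InPieces (s : ℝ) (Θ : Measure A) (B : Set A)
    (x : PointData (Piece d) A (EuclideanSpace ℝ (Fin d) × A)) : Prop :=
  ∀ i : Label d, pos x (some i) ∈ cell s i.1.1 ∧ (0 < Θ B → i.1.2 = true → mk x (some i) ∈ B)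

theorem ae_of_ae_pieceLaw {lam : Piece d → ℝ≥0}
    {p : Label d → EuclideanSpace ℝ (Fin d) × A → Prop}
    (h : ∀ i, ∀ᵐ y ∂(pieceLaw s Θ B i.1), p i y) :
    ∀ᵐ x ∂(pointLaw lam Θ (pieceLaw s Θ B)), ∀ i, p i (x.2.2 i) := by
  rw [ae_all_iff]
  intro i
  have h1 : Measure.QuasiMeasurePreserving
      (fun x : PointData (Piece d) A (EuclideanSpace ℝ (Fin d) × A) => x.2.2 i)
      (pointLaw lam Θ (pieceLaw s Θ B)) (pieceLaw s Θ B i.1) :=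
    ((measurePreserving_eval_infinitePi (fun i : Label d => pieceLaw s Θ B i.1)
      i).quasiMeasurePreserving.comp Measure.quasiMeasurePreserving_snd).comp
      Measure.quasiMeasurePreserving_snd
  exact h1.ae (h i)

theorem ae_inPieces (hB : MeasurableSet B) {lam : Piece d → ℝ≥0} :
    ∀ᵐ x ∂(pointLaw lam Θ (pieceLaw s Θ B)), InPieces s Θ B x :=
  ae_of_ae_pieceLaw (B := B) Θ
    (p := fun i y => y.1 ∈ cell s i.1.1 ∧ (0 < Θ B → i.1.2 = true → y.2 ∈ B))
    fun i => ae_mem_pieceLaw Θ hB i.1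

theorem measurable_pos (o : Option (Label d)) :
    Measurable fun x : PointData (Piece d) A (EuclideanSpace ℝ (Fin d) × A) => pos x o := by
  cases o with
  | none => exact measurable_const
  | some i => simp only [pos, Option.elim]; fun_prop

/-- The slab of `ℝ^d × 𝔸 × 𝕄` above a cell. -/
def slab (s : ℝ) (c : Fin d → ℤ) : Set (MPoint d α A) := cell s c ×ˢ Set.univ

theorem measurableSet_slab (s : ℝ) (c : Fin d → ℤ) :
    MeasurableSet (slab s c : Set (MPoint d α A)) :=
  (measurableSet_cell s c).prod .univ

theorem iUnion_slab : ⋃ c, (slab s c : Set (MPoint d α A)) = Set.univ := by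
  refine Set.eq_univ_of_forall fun p => ?_
  obtain ⟨c, hc⟩ := Set.mem_iUnion.1 ((iUnion_cell (d := d) hs.out).symm ▸ Set.mem_univ p.1)
  exact Set.mem_iUnion.2 ⟨c, hc, trivial⟩

/-- A present label over the cell `c` is the origin or belongs to one of the two pieces above `c`,
each of which has finitely many points. -/
theorem finite_present_cell {x : PointData (Piece d) A (EuclideanSpace ℝ (Fin d) × A)}
    (hx : InPieces s Θ B x) (c : Fin d → ℤ) : {o ∈ present x | pos x o ∈ cell s c}.Finite := by
  have : {o ∈ present x | pos x o ∈ cell s c} ⊆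
      insert none ((fun z : Bool × ℕ => some ((c, z.1), z.2)) ''
        ⋃ b : Bool, (fun i => (b, i)) '' Set.Iio (x.1 (c, b))) := by
    rintro (_ | ⟨⟨c', b⟩, i⟩) ⟨h1, h2⟩
    · exact Or.inl rfl
    · obtain rfl : c' = c := eq_of_mem_cell hs.out (hx ((c', b), i)).1 h2
      exact Or.inr ⟨(b, i), Set.mem_iUnion.2 ⟨b, i, h1 _ rfl, rfl⟩, rfl⟩
  refine Set.Finite.subset (Set.Finite.insert _ (Set.Finite.image _ ?_)) this
  exact Set.finite_iUnion fun b => (Set.finite_Iio _).image _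

theorem finite_poissonConfig_inter_slab {y : ModelSpace d α A}
    (hy : InPieces s Θ B y.1) (c : Fin d → ℤ) : (poissonConfig y ∩ slab s c).Finite := by
  refine ((finite_present_cell Θ hy c).image (pt y)).subset ?_
  rintro p ⟨h1, h2⟩
  have : p ∈ config y := by rw [config_eq]; exact Or.inl h1
  obtain ⟨o, ho, rfl⟩ := this
  exact ⟨o, ⟨ho, h2.1⟩, rfl⟩

/-- Almost surely every point lies in its own cell. Then only the finitely many pieces above `cs`
can hit `G`, and the formula for finite superpositions applies. -/
theorem measure_poissonConfig_void [StandardBorelSpace A] (hB : MeasurableSet B) (β : ℝ≥0)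
    {G : Set (MPoint d α A)}
    (hG : MeasurableSet G) {cs : Finset (Fin d → ℤ)} (hGcs : ∀ p ∈ G, ∃ c ∈ cs, p.1 ∈ cell s c)
    {TV : Set A} (hTV : MeasurableSet TV) {TU : Set (EdgeMarks α)} (hTU : MeasurableSet TU) :
    modelLaw α s Θ B β {y | y.1.2.1 ∈ TV ∧ y.2 none ∈ TU ∧ poissonConfig y ∩ G = ∅} =
      ENNReal.ofReal (Real.exp (-(intensity α d Θ β G).toReal)) *
        (Θ TV * edgeMarkLaw α TU) := by
  have h1 := measure_void (pieceRate s Θ B β) Θ (pieceLaw s Θ B) (edgeMarkLaw α)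
    (cs ×ˢ (Finset.univ : Finset Bool)) (B := MeasurableEquiv.prodAssoc ⁻¹' G)
    ((MeasurableEquiv.measurable _) hG) hTV hTU
  have h2 : ∑ r ∈ cs ×ˢ (Finset.univ : Finset Bool), (pieceRate s Θ B β r : ℝ) *
      (((pieceLaw s Θ B r).prod (edgeMarkLaw α)) (MeasurableEquiv.prodAssoc ⁻¹' G)).toReal =
      (intensity α d Θ β G).toReal := by
    rw [← sum_pieceRate_mul_pieceLaw Θ hB β cs hG hGcs, ENNReal.toReal_sum]
    · simp [ENNReal.toReal_mul]
    · exact fun r _ => ENNReal.mul_ne_top ENNReal.coe_ne_top (measure_ne_top _ _)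
  rw [h2] at h1
  rw [← h1]
  refine measure_congr ?_
  have h3 : ∀ᵐ y ∂(modelLaw (d := d) α s Θ B β), InPieces s Θ B y.1 :=
    Measure.quasiMeasurePreserving_fst.ae (ae_inPieces Θ hB)
  filter_upwards [h3] with y hy
  refine propext (and_congr_right fun _ => and_congr_right fun _ => ?_)
  rw [Set.eq_empty_iff_forall_notMem]
  constructor
  · rintro h r - i hi hmem
    exact h (pt y (some (r, i))) ⟨⟨r, i, hi, rfl⟩, hmem⟩
  · rintro h p ⟨⟨r, i, hi, rfl⟩, hmem⟩
    obtain ⟨c, hc, hpc⟩ := hGcs _ hmem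
    obtain rfl : r.1 = c := eq_of_mem_cell hs.out (hy (r, i)).1 hpc
    exact h r (by simpa using hc) i hi hmem

end Model

/-! ### Transfer from the explicit model to Poisson processes -/

section TransferModel

variable {d α : ℕ} {A : Type*} [MeasurableSpace A]

theorem measurable_mk (o : Option (Label d)) :
    Measurable fun x : PointData (Piece d) A (EuclideanSpace ℝ (Fin d) × A) => mk x o := by
  cases o with
  | none => simp only [mk, Option.elim]; fun_prop
  | some i => simp only [mk, Option.elim]; fun_prop

theorem measurable_pt (o : Option (Label d)) :
    Measurable fun y : ModelSpace d α A => pt y o :=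
  ((measurable_pos o).comp measurable_fst).prodMk
    (((measurable_mk o).comp measurable_fst).prodMk (by fun_prop))

theorem measurableSet_lt_count (r : Piece d) (i : ℕ) :
    MeasurableSet {y : ModelSpace d α A | i < y.1.1 r} :=
  measurableSet_lt (by fun_prop) (by fun_prop)

theorem measurableSet_poissonConfig_void {G : Set (MPoint d α A)} (hG : MeasurableSet G) :
    MeasurableSet {y : ModelSpace d α A | poissonConfig y ∩ G = ∅} := by
  have : {y : ModelSpace d α A | poissonConfig y ∩ G = ∅} =
      ⋂ (r : Piece d) (i : ℕ), ({y : ModelSpace d α A | i < y.1.1 r}ᶜ ∪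
        (fun y => pt y (some (r, i))) ⁻¹' Gᶜ) := by
    ext y
    simp only [Set.mem_ofPred_eq, Set.mem_iInter, Set.mem_union, Set.mem_compl_iff,
      Set.mem_preimage, Set.eq_empty_iff_forall_notMem]
    constructor
    · intro h r i
      rw [← imp_iff_not_or]
      exact fun hi hG => h _ ⟨⟨r, i, hi, rfl⟩, hG⟩
    · rintro h p ⟨⟨r, i, hi, rfl⟩, hG⟩
      exact ((h r i).resolve_left (fun h' => h' hi)) hG
  rw [this]
  exact MeasurableSet.iInter fun r => MeasurableSet.iInter fun i =>
    (measurableSet_lt_count r i).compl.union (measurable_pt _ hG.compl)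

/-- The index set of the hitting family. -/
abbrev HitIndex (d : ℕ) : Type := (Fin d → ℤ) × Σ k : ℕ, (Fin k → Bool)

variable [StandardBorelSpace A]

open Classical in
/-- The hitting family of a measure. -/
noncomputable def measureCode (s : ℝ) (η : Measure (MPoint d α A)) (j : HitIndex d) : Bool :=
  decide (η (hitSet (slab s) j) ≠ 0)

open Classical in
/-- The hitting family of the explicit model. -/
noncomputable def modelCode (s : ℝ) (y : ModelSpace d α A) (j : HitIndex d) : Bool :=
  decide ((poissonConfig y ∩ hitSet (slab s) j).Nonempty)

theorem measurable_measureCode (s : ℝ) :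
    Measurable (measureCode (d := d) (α := α) (A := A) s) := by
  refine measurable_pi_lambda _ fun j => measurable_to_bool ?_
  have : (fun η : Measure (MPoint d α A) => measureCode s η j) ⁻¹' {true} =
      ((fun η => η (hitSet (slab s) j)) ⁻¹' {0})ᶜ := by
    ext; simp [measureCode]
  rw [this]
  exact (Measure.measurable_coe (measurableSet_hitSet (measurableSet_slab s) j)
    (measurableSet_singleton _)).compl

theorem measurable_modelCode (s : ℝ) :
    Measurable (modelCode (d := d) (α := α) (A := A) s) := by
  refine measurable_pi_lambda _ fun j => measurable_to_bool ?_
  have : (fun y : ModelSpace d α A => modelCode s y j) ⁻¹' {true} =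
      {y | poissonConfig y ∩ hitSet (slab s) j = ∅}ᶜ := by
    ext; simp [modelCode, Set.nonempty_iff_ne_empty]
  rw [this]
  exact (measurableSet_poissonConfig_void
    (measurableSet_hitSet (measurableSet_slab s) j)).compl

variable {s : ℝ} [hs : Fact (0 < s)] (Θ : Measure A) [IsProbabilityMeasure Θ] {B : Set A}
  (hB : MeasurableSet B) {Ω : Type*} [MeasurableSpace Ω] {P : Measure Ω} [IsProbabilityMeasure P]
  {Ψ : Ω → Measure (MPoint d α A)} {V : Ω → A} {U : Ω → EdgeMarks α} {β : ℝ≥0}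
  (hΨ : IsPoissonProcess Ψ (intensity α d Θ β) P) (hV : Measurable V) (hU : Measurable U)
  (hVU : HasLaw (fun ω => (V ω, U ω)) (Θ.prod (edgeMarkLaw α)) P)
  (hindep : IndepFun Ψ (fun ω => (V ω, U ω)) P)

theorem intensity_slab_ne_top (β : ℝ≥0) (c : Fin d → ℤ) :
    intensity α d Θ β (slab s c) ≠ ∞ := by
  rw [intensity, Measure.smul_apply, slab, Measure.prod_prod, measure_univ, mul_one,
    ENNReal.smul_def, smul_eq_mul]
  exact ENNReal.mul_ne_top ENNReal.coe_ne_top (volume_cell_ne_top s c)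

include hΨ in
theorem measure_eq_zero_of_isPoissonProcess {G : Set (MPoint d α A)} (hG : MeasurableSet G)
    (hfin : intensity α d Θ β G ≠ ∞) :
    P {ω | Ψ ω G = 0} = ENNReal.ofReal (Real.exp (-(intensity α d Θ β G).toReal)) := by
  have h1 := hΨ.hasLaw G hG (intensity α d Θ β G).toNNReal (ENNReal.coe_toNNReal hfin).symm
  have h2 : {ω | Ψ ω G = 0} = (fun ω => Ψ ω G) ⁻¹' {0} := rfl
  rw [h2, ← Measure.map_apply (f := fun ω => Ψ ω G)
    ((Measure.measurable_coe hG).comp hΨ.measurable) (measurableSet_singleton _), h1.map_eq,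
    Measure.map_apply .of_discrete
    (measurableSet_singleton _)]
  have h3 : (fun n : ℕ => (n : ℝ≥0∞)) ⁻¹' {0} = {0} := by ext; simp
  rw [h3, poissonMeasure_singleton]
  simp [ENNReal.toReal]

include hΨ in
theorem ae_measure_slab_ne_top : ∀ᵐ ω ∂P, ∀ c : Fin d → ℤ, Ψ ω (slab s c) ≠ ∞ := by
  rw [ae_all_iff]
  intro c
  have h1 := hΨ.hasLaw (slab s c) (measurableSet_slab s c) _
    (ENNReal.coe_toNNReal (intensity_slab_ne_top (s := s) Θ β c)).symm
  refine (h1.ae_iff (p := fun x => x ≠ ∞) ?_).2 ?_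
  · exact (measurableSet_singleton (∞ : ℝ≥0∞)).compl.mem
  · rw [ae_map_iff (p := fun x => x ≠ ∞) (Measurable.of_discrete).aemeasurable
      (measurableSet_singleton (∞ : ℝ≥0∞)).compl]
    exact Filter.Eventually.of_forall fun n => ENNReal.natCast_ne_top n

include hB hΨ hU hV hVU hindep in
-- Avoiding finitely many hit sets means avoiding their union `G`, so the relevant cylinder
-- probabilities are void probabilities. These are equal for the model and the process, and they
-- determine the law since the cylinders form a generating π-system.
theorem map_code_eq :
    P.map (fun ω => (measureCode s (Ψ ω), V ω, U ω)) =
      (modelLaw α s Θ B β).map (fun y => (modelCode s y, y.1.2.1, y.2 none)) := by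
  have hc : Measurable fun ω => measureCode s (Ψ ω) :=
    (measurable_measureCode s).comp hΨ.measurable
  have : IsProbabilityMeasure (P.map fun ω => measureCode s (Ψ ω)) :=
    Measure.isProbabilityMeasure_map hc.aemeasurable
  have h1 : P.map (fun ω => (measureCode s (Ψ ω), V ω, U ω)) =
      (P.map fun ω => measureCode s (Ψ ω)).prod (Θ.prod (edgeMarkLaw α)) := by
    have := (indepFun_iff_map_prod_eq_prod_map_map hc.aemeasurable
      (hV.prodMk hU).aemeasurable).1 (hindep.comp (measurable_measureCode s) measurable_id)
    rw [hVU.map_eq] at this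
    exact this
  rw [h1]
  symm
  refine eq_prod_of_falseCylinders fun F TV TU hTV hTU => ?_
  set G : Set (MPoint d α A) := ⋃ j ∈ F, hitSet (slab s) j with hGdef
  have hG : MeasurableSet G :=
    Finset.measurableSet_biUnion _ fun j _ => measurableSet_hitSet (measurableSet_slab s) j
  have hGcs : ∀ p ∈ G, ∃ c ∈ F.image Prod.fst, p.1 ∈ cell s c := by
    intro p hp
    obtain ⟨j, hj, hpj⟩ := Set.mem_iUnion₂.1 hp
    exact ⟨j.1, Finset.mem_image_of_mem _ hj, (hitSet_subset _ _ hpj).1⟩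
  have hfin : intensity α d Θ β G ≠ ∞ := by
    refine ((measure_biUnion_finset_le F _).trans_lt (ENNReal.sum_lt_top.2 fun j _ => ?_)).ne
    exact (measure_mono (hitSet_subset _ _)).trans_lt (intensity_slab_ne_top Θ β _).lt_top
  have hF : MeasurableSet {f : HitIndex d → Bool | ∀ j ∈ F, f j = false} := by
    rw [← generateFrom_falseCylinders]
    exact MeasurableSpace.measurableSet_generateFrom (Set.mem_range_self F)
  rw [Measure.map_apply ((measurable_modelCode s).prodMk (by fun_prop)) (hF.prod (hTV.prod hTU)),
    Measure.map_apply hc hF]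
  have h2 : (fun ω => measureCode s (Ψ ω)) ⁻¹' {f | ∀ j ∈ F, f j = false} = {ω | Ψ ω G = 0} := by
    ext ω
    simp [measureCode, hGdef]
  have h3 : (fun y : ModelSpace d α A => (modelCode s y, y.1.2.1, y.2 none)) ⁻¹'
      ({f | ∀ j ∈ F, f j = false} ×ˢ TV ×ˢ TU) =
      {y | y.1.2.1 ∈ TV ∧ y.2 none ∈ TU ∧ poissonConfig y ∩ G = ∅} := by
    ext y
    simp only [modelCode, hGdef, Set.mem_preimage, Set.mem_prod, Set.mem_ofPred_eq,
      decide_eq_false_iff_not, Set.not_nonempty_iff_eq_empty, Set.inter_iUnion,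
      Set.iUnion_eq_empty]
    tauto
  rw [h2, h3, measure_eq_zero_of_isPoissonProcess Θ hΨ hG hfin,
    measure_poissonConfig_void Θ hB β hG hGcs hTV hTU]

theorem points_add_dirac (η : Measure (MPoint d α A)) (p : MPoint d α A) :
    points (η + Measure.dirac p) = points η ∪ {p} := by
  ext x
  simp only [points, Set.mem_ofPred_eq, Measure.add_apply, Set.mem_union, Set.mem_singleton_iff,
    ne_eq, add_eq_zero, not_and_or]
  rw [Measure.dirac_apply' _ (measurableSet_singleton x)]
  by_cases h : p = x <;> simp [h, eq_comm]

theorem decode_modelCode {y : ModelSpace d α A} (hy : InPieces s Θ B y.1) :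
    decode (slab s) (modelCode s y) = poissonConfig y :=
  decode_of_finite iUnion_slab (finite_poissonConfig_inter_slab Θ hy) fun j => by
    simp [modelCode]

theorem decode_measureCode {η : Measure (MPoint d α A)} (hη : η ∈ countingMeasures (MPoint d α A))
    (hfin : ∀ c : Fin d → ℤ, η (slab s c) ≠ ∞) :
    decode (slab s) (measureCode s η) = points η :=
  decode_of_countingMeasure (measurableSet_slab s) iUnion_slab hη hfin fun j => by
    simp [measureCode]

include hB hΨ hU hV hVU hindep in
/-- If the configuration of the explicit model has a property on a measurable set, then the Poisson
process with a point at the origin has this property with at least the same probability. -/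
theorem modelLaw_le_measure (C : Set (Set (MPoint d α A))) {M : Set (ModelSpace d α A)}
    (hM : MeasurableSet M) (hMC : ∀ y ∈ M, InPieces s Θ B y.1 → config y ∈ C) :
    modelLaw α s Θ B β M ≤
      P {ω | points (Ψ ω + Measure.dirac ((0 : EuclideanSpace ℝ (Fin d)), V ω, U ω)) ∈ C} := by
  have h1 : ∀ᵐ y ∂(modelLaw (d := d) α s Θ B β), InPieces s Θ B y.1 :=
    Measure.quasiMeasurePreserving_fst.ae (ae_inPieces Θ hB)
  rw [ae_iff] at h1
  -- Points in wrong cells would spoil the decoding. They are excluded by a measurable null set.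
  set T := toMeasurable (modelLaw (d := d) α s Θ B β) {y | ¬InPieces s Θ B y.1} with hT
  have hT0 : modelLaw (d := d) α s Θ B β T = 0 := by rw [hT, measure_toMeasurable, h1]
  have hMT : modelLaw α s Θ B β M = modelLaw α s Θ B β (M \ T) := (measure_sdiff_null hT0).symm
  rw [hMT]
  refine (measure_le_measure_of_map_eq (C := {z | decode (slab s) z.1 ∪ {(0, z.2.1, z.2.2)} ∈ C})
    (((measurable_measureCode s).comp hΨ.measurable).prodMk (hV.prodMk hU))
    ((measurable_modelCode s).prodMk (by fun_prop))
    (map_code_eq Θ hB hΨ hV hU hVU hindep) (hM.diff (measurableSet_toMeasurable _ _)) ?_).trans ?_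
  · rintro y ⟨hy, hyT⟩
    have hin : InPieces s Θ B y.1 := by
      by_contra h
      exact hyT (subset_toMeasurable _ _ h)
    have h2 := hMC y hy hin
    rw [config_eq] at h2
    change decode (slab s) (modelCode s y) ∪ {(0, y.1.2.1, y.2 none)} ∈ C
    rw [decode_modelCode Θ hin]
    exact h2
  · refine measure_mono_ae ?_
    filter_upwards [ae_measure_slab_ne_top (s := s) Θ hΨ] with ω hω h
    change decode (slab s) (measureCode s (Ψ ω)) ∪ {(0, V ω, U ω)} ∈ C at h
    rw [decode_measureCode (hΨ.mem_countingMeasures ω) hω] at h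
    change points _ ∈ C
    rw [points_add_dirac]
    exact h

include hB hΨ hU hV hVU hindep in
-- The almost sure counterpart of `modelLaw_le_measure`, used to exclude percolation without knowing
-- that the event is measurable.
theorem ae_points_of_ae_config {C : Set (Set (MPoint d α A))}
    (hC : ∀ᵐ y ∂(modelLaw (d := d) α s Θ B β), config y ∈ C) :
    ∀ᵐ ω ∂P, points (Ψ ω + Measure.dirac ((0 : EuclideanSpace ℝ (Fin d)), V ω, U ω)) ∈ C := by
  have h1 : ∀ᵐ y ∂(modelLaw (d := d) α s Θ B β), InPieces s Θ B y.1 :=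
    Measure.quasiMeasurePreserving_fst.ae (ae_inPieces Θ hB)
  have h2 := ae_of_map_eq (C := {z | decode (slab s) z.1 ∪ {(0, z.2.1, z.2.2)} ∈ C})
    (((measurable_measureCode s).comp hΨ.measurable).prodMk (hV.prodMk hU))
    ((measurable_modelCode s).prodMk (by fun_prop))
    (map_code_eq Θ hB hΨ hV hU hVU hindep) (by
      filter_upwards [hC, h1] with y hy hin
      rw [config_eq] at hy
      rw [decode_modelCode Θ hin]
      exact hy)
  filter_upwards [h2, ae_measure_slab_ne_top (s := s) Θ hΨ] with ω h hω
  change decode (slab s) (measureCode s (Ψ ω)) ∪ {(0, V ω, U ω)} ∈ C at h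
  rw [decode_measureCode (hΨ.mem_countingMeasures ω) hω] at h
  rw [points_add_dirac]
  exact h

end TransferModel

/-! ### Almost sure properties of the labelled points -/

section AlmostSure

variable {d : ℕ} {A : Type*} [MeasurableSpace A] {s : ℝ} [hs : Fact (0 < s)] (Θ : Measure A)
  [IsProbabilityMeasure Θ] {B : Set A} {lam : Piece d → ℝ≥0}

theorem ae_of_ae_volume_prod {p : EuclideanSpace ℝ (Fin d) × A → Prop}
    (h : ∀ᵐ y ∂(volume.prod Θ), p y) :
    ∀ᵐ x ∂(pointLaw lam Θ (pieceLaw s Θ B)), ∀ i, p (x.2.2 i) :=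
  ae_of_ae_pieceLaw Θ (p := fun _ y => p y)
    fun i => (pieceLaw_absolutelyContinuous Θ B i.1).ae_le h

theorem ae_pair_of_ae {p : (EuclideanSpace ℝ (Fin d) × A) × (EuclideanSpace ℝ (Fin d) × A) → Prop}
    (h : ∀ᵐ z ∂((volume.prod Θ).prod (volume.prod Θ)), p z) :
    ∀ᵐ x ∂(pointLaw lam Θ (pieceLaw s Θ B)), ∀ i j, i ≠ j → p (x.2.2 i, x.2.2 j) := by
  rw [ae_all_iff]
  intro i
  rw [ae_all_iff]
  intro j
  by_cases hij : i = j
  · simp [hij]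
  have h1 : Measure.QuasiMeasurePreserving
      (fun y : Label d → EuclideanSpace ℝ (Fin d) × A => (y i, y j))
      (Measure.infinitePi fun i : Label d => pieceLaw s Θ B i.1)
      ((pieceLaw s Θ B i.1).prod (pieceLaw s Θ B j.1)) :=
    (⟨by fun_prop, Measure.infinitePi_map_eval_prod
      (P := fun i : Label d => pieceLaw s Θ B i.1) hij⟩ :
        MeasurePreserving _ _ _).quasiMeasurePreserving
  have h2 : Measure.QuasiMeasurePreserving
      (fun x : PointData (Piece d) A (EuclideanSpace ℝ (Fin d) × A) => (x.2.2 i, x.2.2 j))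
      (pointLaw lam Θ (pieceLaw s Θ B)) ((pieceLaw s Θ B i.1).prod (pieceLaw s Θ B j.1)) :=
    (h1.comp Measure.quasiMeasurePreserving_snd).comp Measure.quasiMeasurePreserving_snd
  have h3 := h2.ae (((pieceLaw_absolutelyContinuous Θ B i.1).prod
    (pieceLaw_absolutelyContinuous Θ B j.1)).ae_le h)
  filter_upwards [h3] with x hx _ using hx

theorem ae_origin_pair_of_ae {p : A × (EuclideanSpace ℝ (Fin d) × A) → Prop}
    (h : ∀ᵐ z ∂(Θ.prod (volume.prod Θ)), p z) :
    ∀ᵐ x ∂(pointLaw lam Θ (pieceLaw s Θ B)), ∀ i, p (x.2.1, x.2.2 i) := by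
  rw [ae_all_iff]
  intro i
  have h1 : Measure.QuasiMeasurePreserving
      (fun y : A × (Label d → EuclideanSpace ℝ (Fin d) × A) => (y.1, y.2 i))
      (Θ.prod (Measure.infinitePi fun i : Label d => pieceLaw s Θ B i.1))
      (Θ.prod (pieceLaw s Θ B i.1)) :=
    ((MeasurePreserving.id Θ).prod (measurePreserving_eval_infinitePi
      (fun i : Label d => pieceLaw s Θ B i.1) i)).quasiMeasurePreserving
  have h2 := h1.comp (Measure.quasiMeasurePreserving_snd
    (μ := Measure.infinitePi fun r => poissonMeasure (lam r)))
  have h3 : Measure.AbsolutelyContinuous (Θ.prod (pieceLaw s Θ B i.1)) (Θ.prod (volume.prod Θ)) :=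
    Measure.AbsolutelyContinuous.rfl.prod (pieceLaw_absolutelyContinuous Θ B i.1)
  exact h2.ae (h3.ae_le h)

/-- Positions have laws absolutely continuous with respect to Lebesgue measure, which has no atoms
in positive dimension. -/
theorem ae_injective_pos (hd : 0 < d) :
    ∀ᵐ x ∂(pointLaw lam Θ (pieceLaw s Θ B)), Function.Injective (pos x) := by
  have : Nonempty (Fin d) := ⟨⟨0, hd⟩⟩
  have h1 : ∀ x : EuclideanSpace ℝ (Fin d), ∀ᵐ y ∂(volume.prod Θ), y.1 ≠ x := fun x =>
    (Measure.quasiMeasurePreserving_fst (μ := volume) (ν := Θ)).ae (p := fun y => y ≠ x)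
      (by simp [ae_iff])
  have h2 : ∀ᵐ z ∂((volume.prod Θ).prod (volume.prod Θ)),
      (z : (EuclideanSpace ℝ (Fin d) × A) × (EuclideanSpace ℝ (Fin d) × A)).1.1 ≠ z.2.1 := by
    have hm : MeasurableSet {z : (EuclideanSpace ℝ (Fin d) × A) × (EuclideanSpace ℝ (Fin d) × A) |
        z.1.1 ≠ z.2.1} := (measurableSet_eq_fun (by fun_prop) (by fun_prop)).compl
    rw [Measure.ae_prod_iff_ae_ae hm]
    refine Filter.Eventually.of_forall fun y => ?_
    filter_upwards [h1 y.1] with z hz using hz.symm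
  filter_upwards [ae_of_ae_volume_prod (s := s) (B := B) (lam := lam) Θ (h1 0),
    ae_pair_of_ae (s := s) (B := B) (lam := lam) Θ h2] with x hx hx'
  rintro (_ | i) (_ | j) h
  · rfl
  · exact absurd h.symm (hx j)
  · exact absurd h (hx i)
  · by_contra hne
    exact hx' i j (fun h' => hne (by rw [h'])) h

end AlmostSure

/-! ### Coordinates of the labelled points -/

section Coordinates

variable {d α : ℕ} {A : Type*} [MeasurableSpace A] {t : ℝ} (z : ℕ ≃ (Fin d → ℤ))

/-- The coordinates of the point with a given label. -/
noncomputable def labelCoords (t : ℝ) (z : ℕ ≃ (Fin d → ℤ))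
    (x : PointData (Piece d) A (EuclideanSpace ℝ (Fin d) × A)) (o : Option (Label d)) : ℕ × ℕ :=
  (cubeIndex t z (pos x o), {o' | o' ∈ present x ∧
    pos x o' ∈ cube t z (cubeIndex t z (pos x o)) ∧ lexLT (pos x o') (pos x o)}.ncard)

theorem lexLT_iff {x y : EuclideanSpace ℝ (Fin d)} :
    lexLT x y ↔ ∃ i, (∀ j < i, x j = y j) ∧ x i < y i := Iff.rfl

theorem lexLT_or_lexLT {x y : EuclideanSpace ℝ (Fin d)} (h : x ≠ y) : lexLT x y ∨ lexLT y x := by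
  refine lt_or_gt_of_ne fun h' => h ?_
  ext i
  exact congrFun (toLex.injective h') i

theorem coords_config (t : ℝ) {y : ModelSpace d α A} (hy : Function.Injective (pos y.1))
    (o : Option (Label d)) : coords t z (config y) (pos y.1 o) = labelCoords t z y.1 o := by
  have hpt : Function.Injective (pt y) := fun o o' h => hy (congrArg Prod.fst h)
  rw [coords, labelCoords, ← Set.ncard_image_of_injective _ hpt]
  congr 2
  ext p
  constructor
  · rintro ⟨⟨o', ho', rfl⟩, h1, h2⟩
    exact ⟨o', ⟨ho', h1, h2⟩, rfl⟩
  · rintro ⟨o', ⟨ho', h1, h2⟩, rfl⟩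
    exact ⟨⟨o', ho', rfl⟩, h1, h2⟩

theorem finite_cells_of_cube (s : ℝ) (hs : 0 < s) (t : ℝ) (m : ℕ) :
    {c : Fin d → ℤ | (cell s c ∩ cube t z m).Nonempty}.Finite := by
  refine (Set.finite_Icc (fun i => ⌊(-t + 2 * t * z m i) / s⌋)
    (fun i => ⌊(t + 2 * t * z m i) / s⌋)).subset ?_
  rintro c ⟨x, hxc, hxm⟩
  rw [mem_cell_iff hs] at hxc
  subst hxc
  exact ⟨fun i => Int.floor_le_floor (div_le_div_of_nonneg_right (hxm i).1 hs.le),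
    fun i => Int.floor_le_floor (div_le_div_of_nonneg_right (hxm i).2.le hs.le)⟩

/-- Within a cube the second coordinate strictly increases along the lexicographic order. Local
finiteness is essential here, since `ncard` of an infinite set is zero. -/
theorem injOn_labelCoords (ht : 0 < t) {s : ℝ} [hs : Fact (0 < s)] (Θ : Measure A)
    [IsProbabilityMeasure Θ] {B : Set A}
    {x : PointData (Piece d) A (EuclideanSpace ℝ (Fin d) × A)} (hx : InPieces s Θ B x)
    (hinj : Function.Injective (pos x)) : Set.InjOn (labelCoords t z x) (present x) := by
  have hfin : ∀ m, {o | o ∈ present x ∧ pos x o ∈ cube t z m}.Finite := fun m => by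
    refine ((finite_cells_of_cube z s hs.out t m).biUnion fun c _ =>
      finite_present_cell Θ hx c).subset ?_
    rintro o ⟨ho, hom⟩
    obtain ⟨c, hc⟩ := Set.mem_iUnion.1 ((iUnion_cell (d := d) hs.out).symm ▸ Set.mem_univ (pos x o))
    exact Set.mem_biUnion (x := c) ⟨_, hc, hom⟩ ⟨ho, hc⟩
  have key : ∀ o ∈ present x, ∀ o' ∈ present x, lexLT (pos x o) (pos x o') →
      labelCoords t z x o ≠ labelCoords t z x o' := by
    intro o ho o' ho' hlt heq
    obtain ⟨h1, h2⟩ := Prod.ext_iff.1 heq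
    simp only [labelCoords] at h1 h2
    rw [← h1] at h2
    refine (Set.ncard_lt_ncard (s := {o'' | o'' ∈ present x ∧
      pos x o'' ∈ cube t z (cubeIndex t z (pos x o)) ∧ lexLT (pos x o'') (pos x o)})
      (t := {o'' | o'' ∈ present x ∧ pos x o'' ∈ cube t z (cubeIndex t z (pos x o)) ∧
        lexLT (pos x o'') (pos x o')}) ?_ ?_).ne h2
    · refine ⟨fun o'' h => ⟨h.1, h.2.1, lt_trans h.2.2 hlt⟩, fun h => ?_⟩
      exact lt_irrefl _ (h ⟨ho, (mem_cube_iff ht z _ _).2 rfl, hlt⟩).2.2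
    · exact (hfin (cubeIndex t z (pos x o))).subset fun o'' h => ⟨h.1, h.2.1⟩
  intro o ho o' ho' heq
  by_contra hne
  rcases lexLT_or_lexLT (fun h => hne (hinj h)) with h | h
  · exact key o ho o' ho' h heq
  · exact key o' ho' o ho h heq.symm

theorem measurableSet_lexLT {T : Type*} [MeasurableSpace T] {f g : T → EuclideanSpace ℝ (Fin d)}
    (hf : Measurable f) (hg : Measurable g) : MeasurableSet {y | lexLT (f y) (g y)} := by
  have : {y | lexLT (f y) (g y)} = ⋃ i : Fin d, (⋂ (j : Fin d) (_ : j < i), {y | f y j = g y j}) ∩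
      {y | f y i < g y i} := by
    ext y
    simp [lexLT_iff]
  rw [this]
  exact MeasurableSet.iUnion fun i => (MeasurableSet.iInter fun j => MeasurableSet.iInter fun _ =>
    measurableSet_eq_fun (by fun_prop) (by fun_prop)).inter
    (measurableSet_lt (by fun_prop) (by fun_prop))

theorem measurableSet_cube (t : ℝ) (m : ℕ) : MeasurableSet (cube t z m) := by
  have : cube t z m = ⋂ i : Fin d, {x | -t + 2 * t * z m i ≤ x i} ∩
      {x | x i < t + 2 * t * z m i} := by
    ext y
    simp [cube]
  rw [this]
  exact MeasurableSet.iInter fun i => (measurableSet_le (by fun_prop) (by fun_prop)).inter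
    (measurableSet_lt (by fun_prop) (by fun_prop))

theorem measurable_cubeIndex (ht : 0 < t) : Measurable (cubeIndex t z) := by
  refine measurable_to_countable' fun m => ?_
  have : cubeIndex t z ⁻¹' {m} = cube t z m := by
    ext x; exact (mem_cube_iff ht z m x).symm
  rw [this]
  exact measurableSet_cube z t m

/-- The number of elements of a random subset of a countable set is measurable. -/
theorem measurable_ncard {T ι : Type*} [MeasurableSpace T] [Countable ι] {S : T → Set ι}
    (hS : ∀ i, MeasurableSet {y | i ∈ S y}) : Measurable fun y => (S y).ncard := by
  classical
  have h1 : ∀ y, ∑' i, {y | i ∈ S y}.indicator (1 : T → ℝ≥0∞) y = (S y).encard := fun y => by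
    rw [← ENNReal.tsum_set_one, tsum_subtype (S y) (fun _ => (1 : ℝ≥0∞))]
    rfl
  have h2 : Measurable fun y => (S y).encard.toENNReal := by
    simp only [← h1]
    exact Measurable.tsum fun i => measurable_one.indicator (hS i)
  have h3 : ∀ y, ((S y).ncard : ℝ) = (S y).encard.toENNReal.toReal := fun y => by
    rw [Set.ncard]
    cases h : (S y).encard <;> simp
  refine measurable_to_countable' fun n => ?_
  have : (fun y => (S y).ncard) ⁻¹' {n} =
      (fun y => (S y).encard.toENNReal.toReal) ⁻¹' {(n : ℝ)} := by
    ext y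
    simp [← h3]
  rw [this]
  exact h2.ennreal_toReal (measurableSet_singleton _)

theorem measurableSet_present (o : Option (Label d)) :
    MeasurableSet {x : PointData (Piece d) A (EuclideanSpace ℝ (Fin d) × A) | o ∈ present x} := by
  cases o with
  | none => simp [present]
  | some i =>
    simp only [present, Option.mem_def, Option.some.injEq, Set.mem_ofPred_eq, forall_eq']
    exact measurableSet_lt (by fun_prop) (by fun_prop)

theorem measurable_labelCoords (ht : 0 < t) (o : Option (Label d)) :
    Measurable fun x : PointData (Piece d) A (EuclideanSpace ℝ (Fin d) × A) =>
      labelCoords t z x o := by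
  have hc : ∀ o : Option (Label d), Measurable fun
      x : PointData (Piece d) A (EuclideanSpace ℝ (Fin d) × A) => cubeIndex t z (pos x o) :=
    fun o => (measurable_cubeIndex z ht).comp (measurable_pos o)
  refine (hc o).prodMk (measurable_ncard fun o' => ?_)
  refine (measurableSet_present o').inter (MeasurableSet.inter ?_
    (measurableSet_lexLT (measurable_pos o') (measurable_pos o)))
  have : {x : PointData (Piece d) A (EuclideanSpace ℝ (Fin d) × A) |
      pos x o' ∈ cube t z (cubeIndex t z (pos x o))} =
      {x | cubeIndex t z (pos x o') = cubeIndex t z (pos x o)} := by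
    ext x; exact mem_cube_iff ht z _ _
  change MeasurableSet {x : PointData (Piece d) A (EuclideanSpace ℝ (Fin d) × A) |
      pos x o' ∈ cube t z (cubeIndex t z (pos x o))}
  rw [this]
  exact measurableSet_eq_fun (hc o') (hc o)

end Coordinates

/-! ### Independent events with disjoint supports -/

section IndependentFamilies

variable {Ω ι κ S : Type*} [MeasurableSpace Ω] [MeasurableSpace S] {μ : Measure Ω}
  {X : ι → Ω → S} {E : Set S} {p : ℝ≥0∞}

theorem measure_forall_mem (hX : iIndepFun X μ) (hE : MeasurableSet E)
    (hp : ∀ i, μ (X i ⁻¹' E) = p) (T : Finset ι) :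
    μ {ω | ∀ j ∈ T, X j ω ∈ E} = p ^ T.card := by
  have h := hX.measure_inter_preimage_eq_mul T (sets := fun _ => E) (fun _ _ => hE)
  simp only [hp, Finset.prod_const] at h
  rw [← h]
  congr 1
  ext; simp

theorem measure_forall_mem_exists_notMem (hX : iIndepFun X μ) (hm : ∀ i, Measurable (X i))
    (hE : MeasurableSet E) (hp : ∀ i, μ (X i ⁻¹' E) = p) (T₀ : Finset ι) (T : κ → Finset ι)
    (I : Finset κ) (h₀ : ∀ i ∈ I, Disjoint T₀ (T i))
    (hT : (I : Set κ).PairwiseDisjoint T) :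
    μ {ω | (∀ j ∈ T₀, X j ω ∈ E) ∧ ∀ i ∈ I, ∃ j ∈ T i, X j ω ∉ E} =
      p ^ T₀.card * ∏ i ∈ I, (1 - p ^ (T i).card) := by
  classical
  have : IsProbabilityMeasure μ := hX.isProbabilityMeasure
  induction I using Finset.induction_on with
  | empty => simp [measure_forall_mem hX hE hp]
  | insert a I ha ih =>
    have h1 : Disjoint (T₀ ∪ I.biUnion T) (T a) := by
      rw [Finset.disjoint_union_left, Finset.disjoint_biUnion_left]
      refine ⟨h₀ a (Finset.mem_insert_self _ _), fun i hi => ?_⟩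
      exact hT (Finset.mem_coe.2 (Finset.mem_insert_of_mem hi))
        (Finset.mem_coe.2 (Finset.mem_insert_self _ _)) (fun h => ha (h ▸ hi))
    have h2 := hX.indepFun_finset _ _ h1 hm
    let s₁ : Set (↥(T₀ ∪ I.biUnion T) → S) :=
      {f | (∀ j : (T₀ ∪ I.biUnion T : Finset ι), j.1 ∈ T₀ → f j ∈ E) ∧
        ∀ i ∈ I, ∃ j : (T₀ ∪ I.biUnion T : Finset ι), j.1 ∈ T i ∧ f j ∉ E}
    let s₂ : Set (↥(T a) → S) := {f | ∃ j, f j ∉ E}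
    have hs₁ : MeasurableSet s₁ := by
      have : s₁ = (⋂ (j : (T₀ ∪ I.biUnion T : Finset ι)) (_ : j.1 ∈ T₀), (fun f => f j) ⁻¹' E) ∩
          ⋂ i ∈ I, ⋃ (j : (T₀ ∪ I.biUnion T : Finset ι)) (_ : j.1 ∈ T i),
            (fun f => f j) ⁻¹' Eᶜ := by
        ext f
        simp [s₁]
      rw [this]
      exact (MeasurableSet.iInter fun j => MeasurableSet.iInter fun _ =>
        measurable_pi_apply j hE).inter (Finset.measurableSet_biInter _ fun i _ =>
        MeasurableSet.iUnion fun j => MeasurableSet.iUnion fun _ =>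
          measurable_pi_apply j hE.compl)
    have hs₂ : MeasurableSet s₂ := by
      have : s₂ = ⋃ j : (T a : Finset ι), (fun f => f j) ⁻¹' Eᶜ := by
        ext f
        simp [s₂]
      rw [this]
      exact MeasurableSet.iUnion fun j => measurable_pi_apply j hE.compl
    have h3 := h2.measure_inter_preimage_eq_mul s₁ s₂ hs₁ hs₂
    have h4 : (fun (ω : Ω) (i : (T₀ ∪ I.biUnion T : Finset ι)) => X i ω) ⁻¹' s₁ =
        {ω | (∀ j ∈ T₀, X j ω ∈ E) ∧ ∀ i ∈ I, ∃ j ∈ T i, X j ω ∉ E} := by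
      ext ω
      simp only [s₁, Set.mem_preimage, Set.mem_ofPred_eq]
      refine and_congr ⟨fun h j hj => h ⟨j, Finset.mem_union_left _ hj⟩ hj,
        fun h j hj => h j.1 hj⟩ (forall₂_congr fun i hi => ?_)
      exact ⟨fun ⟨j, h, h'⟩ => ⟨j.1, h, h'⟩, fun ⟨j, h, h'⟩ =>
        ⟨⟨j, Finset.mem_union_right _ (Finset.mem_biUnion.2 ⟨i, hi, h⟩)⟩, h, h'⟩⟩
    have h5 : (fun (ω : Ω) (i : (T a : Finset ι)) => X i ω) ⁻¹' s₂ =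
        {ω | ∀ j ∈ T a, X j ω ∈ E}ᶜ := by
      ext ω
      simp [s₂]
    have h6 : MeasurableSet {ω | ∀ j ∈ T a, X j ω ∈ E} := by
      have : {ω | ∀ j ∈ T a, X j ω ∈ E} = ⋂ j ∈ T a, X j ⁻¹' E := by
        ext; simp
      rw [this]
      exact Finset.measurableSet_biInter _ fun j _ => hm j hE
    rw [h4, h5, ih (fun i hi => h₀ i (Finset.mem_insert_of_mem hi))
      (hT.subset (by simp)), prob_compl_eq_one_sub h6,
      measure_forall_mem hX hE hp] at h3
    rw [Finset.prod_insert ha, mul_comm (1 - p ^ (T a).card), ← mul_assoc, ← h3]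
    congr 1
    ext ω
    simp only [Finset.mem_insert, Set.mem_ofPred_eq, Set.mem_inter_iff, Set.mem_compl_iff]
    push Not
    constructor
    · rintro ⟨h, h'⟩
      exact ⟨⟨h, fun i hi => h' i (Or.inr hi)⟩, h' a (Or.inl rfl)⟩
    · rintro ⟨⟨h, h'⟩, h''⟩
      refine ⟨h, fun i hi => ?_⟩
      rcases hi with rfl | hi
      · exact h''
      · exact h' i hi

end IndependentFamilies

/-! ### The events deciding about simplices -/

section Bits

variable {d α : ℕ} {A : Type*} [MeasurableSpace A] {t : ℝ} (z : ℕ ≃ (Fin d → ℤ))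

/-- The mark `u(ρ)` of the set `ρ` of labelled points is at most `e`. -/
def Bit (t : ℝ) (z : ℕ ≃ (Fin d → ℤ)) (e : ℝ) (y : ModelSpace d α A)
    (ρ : Finset (Option (Label d))) : Prop :=
  ∀ (k : Fin α) (l : Fin (k.1 + 2) → Option (Label d)), (∀ i, l i ∈ ρ) → ρ.card = k.1 + 2 →
    (∀ i j, i < j → lexLT (pos y.1 (l i)) (pos y.1 (l j))) →
      (y.2 (l (Fin.last (k.1 + 1))) ⟨k, fun i => labelCoords t z y.1 (l i.castSucc)⟩ : ℝ) ≤ e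

/-- The component of the mark that is inspected depends on the random coordinates; the event is
split according to their countably many values `w`. -/
theorem measurableSet_bit (ht : 0 < t) (e : ℝ) (ρ : Finset (Option (Label d))) :
    MeasurableSet {y : ModelSpace d α A | Bit t z e y ρ} := by
  have : {y : ModelSpace d α A | Bit t z e y ρ} = ⋂ (k : Fin α)
      (l : Fin (k.1 + 2) → Option (Label d)) (_ : ∀ i, l i ∈ ρ) (_ : ρ.card = k.1 + 2),
      ((⋂ (i) (j) (_ : i < j), {y : ModelSpace d α A | lexLT (pos y.1 (l i)) (pos y.1 (l j))})ᶜ ∪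
        ⋃ w : Fin (k.1 + 1) → ℕ × ℕ, (⋂ i, {y | labelCoords t z y.1 (l i.castSucc) = w i}) ∩
          {y | (y.2 (l (Fin.last (k.1 + 1))) ⟨k, w⟩ : ℝ) ≤ e}) := by
    ext y
    simp only [Bit, Set.mem_ofPred_eq, Set.mem_iInter, Set.mem_union, Set.mem_compl_iff,
      Set.mem_iUnion, Set.mem_inter_iff]
    refine forall₄_congr fun k l _ _ => ?_
    rw [imp_iff_not_or]
    refine or_congr_right ⟨fun h => ⟨_, fun i => rfl, h⟩, ?_⟩
    rintro ⟨w, hw, h⟩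
    simpa only [hw] using h
  rw [this]
  refine MeasurableSet.iInter fun k => MeasurableSet.iInter fun l => MeasurableSet.iInter fun _ =>
    MeasurableSet.iInter fun _ => MeasurableSet.union ?_ ?_
  · refine (MeasurableSet.iInter fun i => MeasurableSet.iInter fun j =>
      MeasurableSet.iInter fun _ => ?_).compl
    exact measurableSet_lexLT ((measurable_pos _).comp measurable_fst)
      ((measurable_pos _).comp measurable_fst)
  · refine MeasurableSet.iUnion fun w => (MeasurableSet.iInter fun i => ?_).inter ?_
    · exact ((measurable_labelCoords z ht _).comp measurable_fst) (measurableSet_singleton (w i))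
    · refine measurableSet_le ?_ measurable_const
      have : Measurable fun y : ModelSpace d α A => y.2 (l (Fin.last (k.1 + 1))) := by fun_prop
      exact measurable_subtype_coe.comp ((measurable_pi_apply _).comp this)

/-- The labels of a finite set can be listed in lexicographic order of their positions in exactly
one way. -/
theorem exists_unique_sorted {x : PointData (Piece d) A (EuclideanSpace ℝ (Fin d) × A)}
    (hinj : Function.Injective (pos x)) {n : ℕ} {ρ : Finset (Option (Label d))}
    (hρ : ρ.card = n) :
    ∃ l : Fin n → Option (Label d), (∀ i, l i ∈ ρ) ∧
      (∀ i j, i < j → lexLT (pos x (l i)) (pos x (l j))) ∧ (∀ o ∈ ρ, ∃ i, l i = o) ∧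
      ∀ l' : Fin n → Option (Label d), (∀ i, l' i ∈ ρ) →
        (∀ i j, i < j → lexLT (pos x (l' i)) (pos x (l' j))) → l' = l := by
  classical
  let g : Option (Label d) → Lex (Fin d → ℝ) := fun o => toLex fun i => pos x o i
  have hg : Function.Injective g := by
    intro o o' h
    refine hinj ?_
    ext i
    exact congrFun (toLex.injective h) i
  have hcard : (ρ.image g).card = n := by rw [Finset.card_image_of_injective _ hg, hρ]
  have h1 : ∀ i : Fin n, ∃ o ∈ ρ, g o = (ρ.image g).orderEmbOfFin hcard i := fun i =>
    Finset.mem_image.1 (Finset.orderEmbOfFin_mem _ hcard i)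
  choose l hl hlg using h1
  refine ⟨l, hl, fun i j hij => ?_, fun o ho => ?_, fun l' hl' hs' => ?_⟩
  · change g (l i) < g (l j)
    rw [hlg, hlg]
    exact (OrderEmbedding.lt_iff_lt _).2 hij
  · have : g o ∈ Set.range ((ρ.image g).orderEmbOfFin hcard) := by
      rw [Finset.range_orderEmbOfFin]
      exact Finset.mem_coe.2 (Finset.mem_image_of_mem _ ho)
    obtain ⟨i, hi⟩ := this
    exact ⟨i, hg ((hlg i).trans hi)⟩
  · have := Finset.orderEmbOfFin_unique hcard (f := fun i => g (l' i))
      (fun i => Finset.mem_image_of_mem _ (hl' i)) (fun i j hij => hs' i j hij)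
    funext i
    exact hg ((congrFun this i).trans (hlg i).symm)

/-- The finite sets of labels with a mark. -/
def IsMarked (α : ℕ) (x : PointData (Piece d) A (EuclideanSpace ℝ (Fin d) × A))
    (ρ : Finset (Option (Label d))) : Prop :=
  (ρ : Set (Option (Label d))) ⊆ present x ∧ 2 ≤ ρ.card ∧ ρ.card ≤ α + 1

theorem apply_eq_of_sigma_eq {X : Type*} {k k' : Fin α} {f : Fin (k.1 + 1) → X}
    {f' : Fin (k'.1 + 1) → X}
    (h : (⟨k, f⟩ : Σ k : Fin α, (Fin (k.1 + 1) → X)) = ⟨k', f'⟩) (j : Fin (k.1 + 1)) :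
    f j = f' (Fin.cast (by have h' : k = k' := congrArg Sigma.fst h; rw [h']) j) := by
  cases h
  rfl

/-- Different sets of labels use different components of the marks. -/
theorem exists_mark_index {x : PointData (Piece d) A (EuclideanSpace ℝ (Fin d) × A)}
    (hinj : Function.Injective (pos x)) (hK : Set.InjOn (labelCoords t z x) (present x)) (e : ℝ) :
    ∃ J : {ρ // IsMarked α x ρ} → Option (Label d) × (Σ k : Fin α, (Fin (k.1 + 1) → ℕ × ℕ)),
      Function.Injective J ∧ ∀ ρ (u : Option (Label d) → EdgeMarks α),
        Bit t z e (x, u) ρ.1 ↔ (u (J ρ).1 (J ρ).2 : ℝ) ≤ e := by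
  have h1 : ∀ ρ : {ρ // IsMarked α x ρ}, ∃ (k : Fin α) (l : Fin (k.1 + 2) → Option (Label d)),
      ρ.1.card = k.1 + 2 ∧ (∀ i, l i ∈ ρ.1) ∧
      (∀ i j, i < j → lexLT (pos x (l i)) (pos x (l j))) ∧ (∀ o ∈ ρ.1, ∃ i, l i = o) ∧
      ∀ l' : Fin (k.1 + 2) → Option (Label d), (∀ i, l' i ∈ ρ.1) →
        (∀ i j, i < j → lexLT (pos x (l' i)) (pos x (l' j))) → l' = l := by
    rintro ⟨ρ, hρ, h2, hα⟩
    have hk : ρ.card = (ρ.card - 2) + 2 := by omega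
    exact ⟨⟨ρ.card - 2, by omega⟩, (exists_unique_sorted hinj hk).imp fun l hl => ⟨hk, hl⟩⟩
  choose k l hcard hl hs hsurj huniq using h1
  refine ⟨fun ρ => (l ρ (Fin.last _), ⟨k ρ, fun i => labelCoords t z x (l ρ i.castSucc)⟩), ?_, ?_⟩
  · intro ρ ρ' h
    obtain ⟨h2, h3⟩ := Prod.ext_iff.1 h
    -- The index shows whose mark is read, which is the lexicographically last label; the other
    -- labels are recovered from their coordinates by injectivity.
    have hsub : ∀ ρ ρ' : {ρ // IsMarked α x ρ}, l ρ (Fin.last _) = l ρ' (Fin.last _) →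
        (⟨k ρ, fun i => labelCoords t z x (l ρ i.castSucc)⟩ :
          (Σ k : Fin α, (Fin (k.1 + 1) → ℕ × ℕ))) =
        ⟨k ρ', fun i => labelCoords t z x (l ρ' i.castSucc)⟩ → ρ.1 ⊆ ρ'.1 := by
      intro ρ ρ' h2 h3 o ho
      obtain ⟨i, rfl⟩ := hsurj ρ o ho
      induction i using Fin.lastCases with
      | last => rw [h2]; exact hl _ _
      | cast i =>
        rw [hK (ρ.2.1 (hl ρ _)) (ρ'.2.1 (hl ρ' _)) (apply_eq_of_sigma_eq h3 i)]
        exact hl _ _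
    exact Subtype.ext (Finset.Subset.antisymm (hsub ρ ρ' h2 h3) (hsub ρ' ρ h2.symm h3.symm))
  · intro ρ u
    constructor
    · exact fun h => h (k ρ) (l ρ) (hl ρ) (hcard ρ) (hs ρ)
    · intro h k' l' hl' hcard' hs'
      have hk : k ρ = k' := Fin.ext (by have := hcard ρ; omega)
      subst hk
      obtain rfl := huniq ρ l' hl' hs'
      exact h

theorem volume_setOf_le {e : ℝ} (he0 : 0 ≤ e) (he1 : e ≤ 1) :
    (volume : Measure unitInterval) {v | (v : ℝ) ≤ e} = ENNReal.ofReal e :=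
  unitInterval.volume_Iic ⟨e, he0, he1⟩

variable {x : PointData (Piece d) A (EuclideanSpace ℝ (Fin d) × A)} {e : ℝ}

/-- For given positions, the marks of different sets of points are independent. -/
theorem markLaw_bits_eq (hinj : Function.Injective (pos x))
    (hK : Set.InjOn (labelCoords t z x) (present x)) (he0 : 0 ≤ e) (he1 : e ≤ 1) {κ : Type*}
    (T₀ : Finset (Finset (Option (Label d)))) (T : κ → Finset (Finset (Option (Label d))))
    (I : Finset κ) (hm₀ : ∀ ρ ∈ T₀, IsMarked α x ρ) (hm : ∀ i ∈ I, ∀ ρ ∈ T i, IsMarked α x ρ)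
    (h₀ : ∀ i ∈ I, Disjoint T₀ (T i)) (hT : (I : Set κ).PairwiseDisjoint T) :
    markLaw (Piece d) (edgeMarkLaw α) {u | (∀ ρ ∈ T₀, Bit t z e (x, u) ρ) ∧
      ∀ i ∈ I, ∃ ρ ∈ T i, ¬Bit t z e (x, u) ρ} =
    ENNReal.ofReal e ^ T₀.card * ∏ i ∈ I, (1 - ENNReal.ofReal e ^ (T i).card) := by
  classical
  obtain ⟨J, hJ, hbit⟩ := exists_mark_index (α := α) z hinj hK e
  let X : {ρ // IsMarked α x ρ} → (Option (Label d) → EdgeMarks α) → unitInterval :=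
    fun ρ u => u (J ρ).1 (J ρ).2
  have hXm : ∀ ρ, Measurable (X ρ) := fun ρ =>
    (measurable_pi_apply _).comp (measurable_pi_apply _)
  -- Reading an independent doubly indexed family along the injection `J` keeps independence.
  have hXi : iIndepFun X (markLaw (Piece d) (edgeMarkLaw α)) :=
    (iIndepFun_uncurry_infinitePi' (X := fun (_ : Option (Label d))
      (_ : Σ k : Fin α, (Fin (k.1 + 1) → ℕ × ℕ)) (v : unitInterval) => v)
      (fun _ _ => volume) (fun _ _ => measurable_id)).precomp hJ
  have hE : MeasurableSet {v : unitInterval | (v : ℝ) ≤ e} :=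
    measurableSet_le measurable_subtype_coe measurable_const
  have hp : ∀ ρ, markLaw (Piece d) (edgeMarkLaw α) (X ρ ⁻¹' {v | (v : ℝ) ≤ e}) =
      ENNReal.ofReal e := fun ρ => by
    have : MeasurePreserving (X ρ) (markLaw (Piece d) (edgeMarkLaw α)) volume :=
      (measurePreserving_eval_infinitePi
        (fun _ : Σ k : Fin α, (Fin (k.1 + 1) → ℕ × ℕ) => (volume : Measure unitInterval))
        (J ρ).2).comp
        (measurePreserving_eval_infinitePi (fun _ : Option (Label d) => edgeMarkLaw α) (J ρ).1)
    rw [this.measure_preimage hE.nullMeasurableSet, volume_setOf_le he0 he1]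
  have hsub : ∀ F : Finset (Finset (Option (Label d))), (∀ ρ ∈ F, IsMarked α x ρ) →
      (F.subtype (IsMarked α x)).card = F.card := fun F hF => by
    rw [Finset.card_subtype, Finset.filter_true_of_mem hF]
  have hdis : ∀ F G : Finset (Finset (Option (Label d))), Disjoint F G →
      Disjoint (F.subtype (IsMarked α x)) (G.subtype (IsMarked α x)) := fun F G h => by
    rw [Finset.disjoint_left] at h ⊢
    intro ρ h1 h2
    exact h (Finset.mem_subtype.1 h1) (Finset.mem_subtype.1 h2)
  have := measure_forall_mem_exists_notMem hXi hXm hE hp (T₀.subtype (IsMarked α x))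
    (fun i => (T i).subtype (IsMarked α x)) I (fun i hi => hdis _ _ (h₀ i hi))
    (fun i hi j hj hij => hdis _ _ (hT hi hj hij))
  rw [hsub T₀ hm₀, Finset.prod_congr rfl (g := fun i => 1 - ENNReal.ofReal e ^ (T i).card)
    (fun i hi => by rw [hsub _ (hm i hi)])] at this
  rw [← this]
  congr 1
  ext u
  simp only [Set.mem_ofPred_eq, Finset.mem_subtype, X, ← hbit]
  refine and_congr ⟨fun h ρ hρ => h _ hρ, fun h ρ hρ => h ⟨ρ, hm₀ ρ hρ⟩ hρ⟩
    (forall₂_congr fun i hi => ?_)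
  exact ⟨fun ⟨ρ, hρ, h⟩ => ⟨⟨ρ, hm i hi ρ hρ⟩, hρ, h⟩, fun ⟨ρ, hρ, h⟩ => ⟨ρ.1, hρ, h⟩⟩

/-- A simplex criterion in terms of the events `Bit`. -/
theorem image_mem_faces {φ : (j : ℕ) → (Fin (j + 1) → EuclideanSpace ℝ (Fin d) × A) → ℝ}
    {y : ModelSpace d α A} (hinj : Function.Injective (pos y.1)) [DecidableEq (MPoint d α A)]
    {F : Finset (Option (Label d))} (hne : F.Nonempty)
    (hF : (F : Set (Option (Label d))) ⊆ present y.1) (hcard : F.card ≤ α + 1)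
    (hφ : ∀ (k : Fin α) (l : Fin (k.1 + 2) → Option (Label d)), (∀ i, l i ∈ F) →
      e ≤ φ (k.1 + 1) fun i => (pos y.1 (l i), mk y.1 (l i)))
    (hbit : ∀ ρ ⊆ F, 2 ≤ ρ.card → Bit t z e y ρ) :
    F.image (pt y) ∈ (complex φ t z (config y)).faces := by
  classical
  refine ⟨hne.image _, ?_, Finset.card_image_le.trans hcard, ?_⟩
  · rw [Finset.coe_image]
    exact Set.image_mono hF
  · intro k p hp hs
    have h1 : ∀ i, ∃ o ∈ F, pt y o = p i := fun i => Finset.mem_image.1 (hp i)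
    choose l hl hlp using h1
    obtain rfl : (fun i => pt y (l i)) = p := funext hlp
    have hlinj : Function.Injective l := by
      intro i j hij
      by_contra hne
      rcases lt_or_gt_of_ne hne with h | h
      · have := hs _ _ h
        simp only [hij] at this
        exact lt_irrefl _ this
      · have := hs _ _ h
        simp only [hij] at this
        exact lt_irrefl _ this
    refine le_trans ?_ (hφ k l hl)
    have hc : (Finset.univ.image l).card = k.1 + 2 := by
      rw [Finset.card_image_of_injective _ hlinj]; simp
    have := hbit (Finset.univ.image l) (by
      intro o ho
      obtain ⟨i, -, rfl⟩ := Finset.mem_image.1 ho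
      exact hl i) (by omega) k l (fun i => Finset.mem_image_of_mem _ (Finset.mem_univ _)) hc hs
    simp only [simplexMark]
    have h2 : ∀ i : Fin (k.1 + 1), coords t z (config y) (pt y (l i.castSucc)).1 =
        labelCoords t z y.1 (l i.castSucc) := fun i => coords_config z t hinj _
    simp only [h2]
    exact this

end Bits

/-! ### Hierarchical site percolation in the quarter plane -/

section Hierarchical

/-- The `3 × 3` sub-boxes of a box. -/
def subBox (g : ℕ × ℕ) (a : Fin 3 × Fin 3) : ℕ × ℕ := (3 * g.1 + a.1, 3 * g.2 + a.2)

/-- A box of level `n + 1` is bad if at least two of its sub-boxes are bad. -/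
def BoxBad (bad : ℕ × ℕ → Prop) : ℕ → ℕ × ℕ → Prop
  | 0, g => bad g
  | n + 1, g => ∃ a b, a ≠ b ∧ BoxBad bad n (subBox g a) ∧ BoxBad bad n (subBox g b)

/-- The sites in a box which are in good boxes on all lower levels. -/
def boxCore (bad : ℕ × ℕ → Prop) : ℕ → ℕ × ℕ → Set (ℕ × ℕ)
  | 0, g => {g}
  | n + 1, g => {x | ∃ a, ¬BoxBad bad n (subBox g a) ∧ x ∈ boxCore bad n (subBox g a)}

theorem subBox_inj {g g' : ℕ × ℕ} {a a' : Fin 3 × Fin 3} (h : subBox g a = subBox g' a') :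
    g = g' ∧ a = a' := by
  obtain ⟨g1, g2⟩ := g
  obtain ⟨g1', g2'⟩ := g'
  obtain ⟨a1, a2⟩ := a
  obtain ⟨a1', a2'⟩ := a'
  simp only [subBox, Prod.mk.injEq, Fin.ext_iff] at h ⊢
  omega

/-- A relation between sites which contains the nearest neighbour relation of good sites. -/
structure IsLinking (good : ℕ × ℕ → Prop) (R : ℕ × ℕ → ℕ × ℕ → Prop) : Prop where
  refl : ∀ g, good g → R g g
  symm : ∀ g h, R g h → R h g
  -- At higher levels, boxes are related if all their core sites are; transitivity then needs a
  -- nonempty core in the middle box.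
  trans : ∀ g h k, good h → R g h → R h k → R g k
  right : ∀ i j, good (i, j) → good (i + 1, j) → R (i, j) (i + 1, j)
  up : ∀ i j, good (i, j) → good (i, j + 1) → R (i, j) (i, j + 1)

variable {good : ℕ × ℕ → Prop} {R : ℕ × ℕ → ℕ × ℕ → Prop}

theorem IsLinking.row (hR : IsLinking good R) {g : ℕ × ℕ} {j : Fin 3}
    (hj : ∀ i, good (subBox g (i, j))) (i i' : Fin 3) :
    R (subBox g (i, j)) (subBox g (i', j)) := by
  have h1 : R (subBox g (0, j)) (subBox g (1, j)) := hR.right _ _ (hj 0) (hj 1)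
  have h2 : R (subBox g (1, j)) (subBox g (2, j)) := hR.right _ _ (hj 1) (hj 2)
  have h3 := hR.trans _ _ _ (hj 1) h1 h2
  fin_cases i <;> fin_cases i' <;>
    first
      | exact hR.refl _ (hj _)
      | exact h1
      | exact h2
      | exact h3
      | exact hR.symm _ _ h1
      | exact hR.symm _ _ h2
      | exact hR.symm _ _ h3

theorem IsLinking.col (hR : IsLinking good R) {g : ℕ × ℕ} {i : Fin 3}
    (hi : ∀ j, good (subBox g (i, j))) (j j' : Fin 3) :
    R (subBox g (i, j)) (subBox g (i, j')) := by
  have h1 : R (subBox g (i, 0)) (subBox g (i, 1)) := hR.up _ _ (hi 0) (hi 1)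
  have h2 : R (subBox g (i, 1)) (subBox g (i, 2)) := hR.up _ _ (hi 1) (hi 2)
  have h3 := hR.trans _ _ _ (hi 1) h1 h2
  fin_cases j <;> fin_cases j' <;>
    first
      | exact hR.refl _ (hi _)
      | exact h1
      | exact h2
      | exact h3
      | exact hR.symm _ _ h1
      | exact hR.symm _ _ h2
      | exact hR.symm _ _ h3

/-- At most one sub-box is bad, and it cannot spoil two different rows. -/
theorem row_or_row {g : ℕ × ℕ} (hg : ∀ a b, a ≠ b → good (subBox g a) ∨ good (subBox g b))
    {j j' : Fin 3} (h : j ≠ j') :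
    (∀ i, good (subBox g (i, j))) ∨ ∀ i, good (subBox g (i, j')) := by
  by_contra! hc
  obtain ⟨⟨i, hi⟩, i', hi'⟩ := hc
  rcases hg (i, j) (i', j') (fun h' => h (Prod.ext_iff.1 h').2) with h' | h'
  · exact hi h'
  · exact hi' h'

theorem col_or_col {g : ℕ × ℕ} (hg : ∀ a b, a ≠ b → good (subBox g a) ∨ good (subBox g b))
    {i i' : Fin 3} (h : i ≠ i') :
    (∀ j, good (subBox g (i, j))) ∨ ∀ j, good (subBox g (i', j)) := by
  by_contra! hc
  obtain ⟨⟨j, hj⟩, j', hj'⟩ := hc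
  rcases hg (i, j) (i', j') (fun h' => h (Prod.ext_iff.1 h').1) with h' | h'
  · exact hj h'
  · exact hj' h'

/-- Some row and some column are entirely good and cross in `(i₀, j₀)`. The single possible bad
sub-box is not in both the row and the column of a given good sub-box, so the latter reaches the
crossing along a good line. -/
theorem IsLinking.box (hR : IsLinking good R) {g : ℕ × ℕ}
    (hg : ∀ a b, a ≠ b → good (subBox g a) ∨ good (subBox g b)) {a b : Fin 3 × Fin 3}
    (ha : good (subBox g a)) (hb : good (subBox g b)) : R (subBox g a) (subBox g b) := by
  obtain ⟨j₀, hj₀⟩ : ∃ j, ∀ i, good (subBox g (i, j)) :=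
    (row_or_row hg (j := 0) (j' := 1) (by decide)).elim (fun h => ⟨_, h⟩) fun h => ⟨_, h⟩
  obtain ⟨i₀, hi₀⟩ : ∃ i, ∀ j, good (subBox g (i, j)) :=
    (col_or_col hg (i := 0) (i' := 1) (by decide)).elim (fun h => ⟨_, h⟩) fun h => ⟨_, h⟩
  have key : ∀ a, good (subBox g a) → R (subBox g a) (subBox g (i₀, j₀)) := by
    rintro ⟨i, j⟩ hij
    have : (∀ i, good (subBox g (i, j))) ∨ ∀ j, good (subBox g (i, j)) := by
      by_contra! hc
      obtain ⟨⟨i', hi'⟩, j', hj'⟩ := hc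
      rcases hg (i', j) (i, j') (fun h' => hi' (by
        obtain rfl : i' = i := (Prod.ext_iff.1 h').1
        exact hij)) with h' | h'
      · exact hi' h'
      · exact hj' h'
    rcases this with h | h
    · exact hR.trans _ _ _ (h i₀) (hR.row h i i₀) (hR.col hi₀ j j₀)
    · exact hR.trans _ _ _ (h j₀) (hR.col h j j₀) (hR.row hj₀ i i₀)
  exact hR.trans _ _ _ (hj₀ i₀) (key a ha) (hR.symm _ _ (key b hb))

/-- Each property fails for at most one of three indices, so some index satisfies both. -/
theorem exists_common {p p' : Fin 3 → Prop} (h : ∀ i j, i ≠ j → p i ∨ p j)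
    (h' : ∀ i j, i ≠ j → p' i ∨ p' j) : ∃ i, p i ∧ p' i := by
  have h01 := h 0 1 (by decide)
  have h02 := h 0 2 (by decide)
  have h12 := h 1 2 (by decide)
  have h01' := h' 0 1 (by decide)
  have h02' := h' 0 2 (by decide)
  have h12' := h' 1 2 (by decide)
  by_contra! hc
  have := hc 0
  have := hc 1
  have := hc 2
  tauto

/-- Both boxes have at most one bad row, so among three rows one is good in both and crosses the
common side. -/
theorem IsLinking.box_right (hR : IsLinking good R) {i j : ℕ}
    (hg : ∀ a b, a ≠ b → good (subBox (i, j) a) ∨ good (subBox (i, j) b))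
    (hg' : ∀ a b, a ≠ b → good (subBox (i + 1, j) a) ∨ good (subBox (i + 1, j) b))
    {a b : Fin 3 × Fin 3} (ha : good (subBox (i, j) a)) (hb : good (subBox (i + 1, j) b)) :
    R (subBox (i, j) a) (subBox (i + 1, j) b) := by
  obtain ⟨k, hk, hk'⟩ := exists_common (fun _ _ h => row_or_row hg h)
    (fun _ _ h => row_or_row hg' h)
  have h1 : subBox (i + 1, j) (0, k) = (3 * i + 2 + 1, 3 * j + k) := by
    ext <;> simp [subBox]; omega
  have h2 : R (subBox (i, j) (2, k)) (subBox (i + 1, j) (0, k)) := by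
    have h3 := hk' 0
    rw [h1] at h3 ⊢
    exact hR.right _ _ (hk 2) h3
  exact hR.trans _ _ _ (hk 2) (hR.box hg ha (hk 2))
    (hR.trans _ _ _ (hk' 0) h2 (hR.box hg' (hk' 0) hb))

theorem IsLinking.box_up (hR : IsLinking good R) {i j : ℕ}
    (hg : ∀ a b, a ≠ b → good (subBox (i, j) a) ∨ good (subBox (i, j) b))
    (hg' : ∀ a b, a ≠ b → good (subBox (i, j + 1) a) ∨ good (subBox (i, j + 1) b))
    {a b : Fin 3 × Fin 3} (ha : good (subBox (i, j) a)) (hb : good (subBox (i, j + 1) b)) :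
    R (subBox (i, j) a) (subBox (i, j + 1) b) := by
  obtain ⟨k, hk, hk'⟩ := exists_common (fun _ _ h => col_or_col hg h)
    (fun _ _ h => col_or_col hg' h)
  have h1 : subBox (i, j + 1) (k, 0) = (3 * i + k, 3 * j + 2 + 1) := by
    ext <;> simp [subBox]; omega
  have h2 : R (subBox (i, j) (k, 2)) (subBox (i, j + 1) (k, 0)) := by
    have h3 := hk' 0
    rw [h1] at h3 ⊢
    exact hR.up _ _ (hk 2) h3
  exact hR.trans _ _ _ (hk 2) (hR.box hg ha (hk 2))
    (hR.trans _ _ _ (hk' 0) h2 (hR.box hg' (hk' 0) hb))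

variable {bad : ℕ × ℕ → Prop}

theorem not_boxBad_succ {n : ℕ} {g : ℕ × ℕ} (h : ¬BoxBad bad (n + 1) g) (a b : Fin 3 × Fin 3)
    (hab : a ≠ b) : ¬BoxBad bad n (subBox g a) ∨ ¬BoxBad bad n (subBox g b) := by
  by_contra! hc
  exact h ⟨a, b, hab, hc.1, hc.2⟩

theorem boxCore_nonempty (n : ℕ) {g : ℕ × ℕ} (h : ¬BoxBad bad n g) :
    (boxCore bad n g).Nonempty := by
  induction n generalizing g with
  | zero => exact ⟨g, rfl⟩
  | succ n ih =>
    rcases not_boxBad_succ h (0, 0) (1, 0) (by decide) with h' | h'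
    all_goals
      obtain ⟨x, hx⟩ := ih h'
      exact ⟨x, _, h', hx⟩

theorem not_bad_of_mem_boxCore (n : ℕ) {g x : ℕ × ℕ} (h : ¬BoxBad bad n g)
    (hx : x ∈ boxCore bad n g) : ¬bad x := by
  induction n generalizing g with
  | zero =>
    obtain rfl : x = g := hx
    exact h
  | succ n ih =>
    obtain ⟨a, ha, hx⟩ := hx
    exact ih ha hx

theorem le_of_mem_boxCore (n : ℕ) {g x : ℕ × ℕ} (hx : x ∈ boxCore bad n g) :
    3 ^ n * g.1 ≤ x.1 ∧ 3 ^ n * g.2 ≤ x.2 := by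
  induction n generalizing g with
  | zero =>
    obtain rfl : x = g := hx
    simp
  | succ n ih =>
    obtain ⟨a, -, hx⟩ := hx
    have h1 := ih hx
    have h2 : 3 ^ n * (3 * g.1) ≤ 3 ^ n * (3 * g.1 + a.1) := Nat.mul_le_mul_left _ (by omega)
    have h3 : 3 ^ n * (3 * g.2) ≤ 3 ^ n * (3 * g.2 + a.2) := Nat.mul_le_mul_left _ (by omega)
    rw [pow_succ, mul_assoc, mul_assoc]
    exact ⟨h2.trans h1.1, h3.trans h1.2⟩

/-- Cores of neighbouring good boxes of the same level are linked. -/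
theorem isLinking_boxCore (hR : IsLinking (fun g => ¬bad g) R) (n : ℕ) :
    IsLinking (fun g => ¬BoxBad bad n g)
      fun g h => ∀ x ∈ boxCore bad n g, ∀ y ∈ boxCore bad n h, R x y := by
  induction n with
  | zero =>
    constructor
    · rintro g hg x rfl y rfl
      exact hR.refl _ hg
    · rintro g h hgh x rfl y rfl
      exact hR.symm _ _ (hgh _ rfl _ rfl)
    · rintro g h k hh h1 h2 x rfl y rfl
      exact hR.trans _ _ _ hh (h1 _ rfl _ rfl) (h2 _ rfl _ rfl)
    · rintro i j h1 h2 x rfl y rfl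
      exact hR.right _ _ h1 h2
    · rintro i j h1 h2 x rfl y rfl
      exact hR.up _ _ h1 h2
  | succ n ih =>
    constructor
    · rintro g hg x ⟨a, ha, hx⟩ y ⟨b, hb, hy⟩
      exact ih.box (not_boxBad_succ hg) ha hb x hx y hy
    · exact fun g h hgh x hx y hy => hR.symm _ _ (hgh y hy x hx)
    · intro g h k hh h1 h2 x hx y hy
      obtain ⟨w, hw⟩ := boxCore_nonempty _ hh
      exact hR.trans _ _ _ (not_bad_of_mem_boxCore _ hh hw) (h1 x hx w hw) (h2 w hw y hy)
    · rintro i j h1 h2 x ⟨a, ha, hx⟩ y ⟨b, hb, hy⟩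
      exact ih.box_right (not_boxBad_succ h1) (not_boxBad_succ h2) ha hb x hx y hy
    · rintro i j h1 h2 x ⟨a, ha, hx⟩ y ⟨b, hb, hy⟩
      exact ih.box_up (not_boxBad_succ h1) (not_boxBad_succ h2) ha hb x hx y hy

/-- If the boxes of all levels at the corner are good, then the corner is linked to good sites
arbitrarily far away. -/
theorem exists_far_linked (hR : IsLinking (fun g => ¬bad g) R) (h : ∀ n, ¬BoxBad bad n (0, 0))
    (n : ℕ) : ∃ x, ¬bad x ∧ 3 ^ n ≤ x.1 + x.2 ∧ R (0, 0) x := by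
  have h0 : ∀ n, (0, 0) ∈ boxCore bad n (0, 0) := by
    intro n
    induction n with
    | zero => exact rfl
    | succ n ih => exact ⟨(0, 0), h n, ih⟩
  -- Of the two sub-boxes next to the corner one is good, and all its sites have coordinate sum at
  -- least `3 ^ n`.
  obtain ⟨a, ha, ha'⟩ : ∃ a : Fin 3 × Fin 3, 1 ≤ (a.1 : ℕ) + a.2 ∧
      ¬BoxBad bad n (subBox (0, 0) a) := by
    rcases not_boxBad_succ (h (n + 1)) (1, 0) (0, 1) (by decide) with h' | h'
    · exact ⟨_, by decide, h'⟩
    · exact ⟨_, by decide, h'⟩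
  obtain ⟨x, hx⟩ := boxCore_nonempty n ha'
  refine ⟨x, not_bad_of_mem_boxCore n ha' hx, ?_, ?_⟩
  · have h1 := le_of_mem_boxCore n hx
    have h2 : 3 ^ n * 1 ≤ 3 ^ n * ((a.1 : ℕ) + a.2) := Nat.mul_le_mul_left _ ha
    simp only [subBox, mul_zero, zero_add] at h1
    rw [mul_add] at h2
    omega
  · exact (isLinking_boxCore hR (n + 1)).refl _ (h (n + 1)) _ (h0 (n + 1)) _ ⟨a, ha', hx⟩

variable {Ω : Type*} [MeasurableSpace Ω] {μ : Measure Ω} {Bad : Ω → ℕ × ℕ → Prop} {C : ℝ≥0∞}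

/-- Union bound over the 72 ordered pairs of sub-boxes in each box. Sub-boxes of different boxes are
different, so a choice of pairs gives `2 |S|` boxes of the level below. The bounds `p_n = 144⁻¹ 2⁻ⁿ`
satisfy `72 p_n² ≤ p_{n+1}`. Only the bound on finite sets is propagated; no independence is needed.
-/
theorem measure_boxBad_le (hbad : ∀ S : Finset (ℕ × ℕ),
      μ {ω | ∀ g ∈ S, Bad ω g} ≤ C * (144⁻¹ : ℝ≥0∞) ^ S.card) (n : ℕ) (S : Finset (ℕ × ℕ)) :
    μ {ω | ∀ g ∈ S, BoxBad (Bad ω) n g} ≤ C * (144⁻¹ * 2⁻¹ ^ n : ℝ≥0∞) ^ S.card := by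
  classical
  induction n generalizing S with
  | zero => simpa [BoxBad] using hbad S
  | succ n ih =>
    let Pr := {p : (Fin 3 × Fin 3) × (Fin 3 × Fin 3) // p.1 ≠ p.2}
    have hPr : Fintype.card Pr = 72 := by decide
    let Sf : (S → Pr) → Finset (ℕ × ℕ) := fun f =>
      Finset.univ.biUnion fun g : S => {subBox g (f g).1.1, subBox g (f g).1.2}
    have hSf : ∀ f, (Sf f).card = S.card * 2 := fun f => by
      have : ∀ g : S, ({subBox g (f g).1.1, subBox g (f g).1.2} : Finset (ℕ × ℕ)).card = 2 :=
        fun g => Finset.card_pair fun h => (f g).2 (subBox_inj h).2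
      rw [Finset.card_biUnion, Finset.sum_congr rfl (fun g _ => this g)]
      · simp
      · intro g _ g' _ hgg'
        rw [Function.onFun, Finset.disjoint_left]
        intro x hx hx'
        simp only [Finset.mem_insert, Finset.mem_singleton] at hx hx'
        refine hgg' (Subtype.ext ?_)
        rcases hx with rfl | rfl <;> rcases hx' with h | h <;> exact (subBox_inj h).1
    have hsub : {ω | ∀ g ∈ S, BoxBad (Bad ω) (n + 1) g} ⊆
        ⋃ f : S → Pr, {ω | ∀ g ∈ Sf f, BoxBad (Bad ω) n g} := by
      intro ω hω
      choose a b hab h1 h2 using fun g : S => hω g.1 g.2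
      refine Set.mem_iUnion.2 ⟨fun g => ⟨(a g, b g), hab g⟩, fun g' hg' => ?_⟩
      obtain ⟨g, -, hg⟩ := Finset.mem_biUnion.1 hg'
      rcases Finset.mem_insert.1 hg with rfl | hg
      · exact h1 g
      · rw [Finset.mem_singleton.1 hg]
        exact h2 g
    have hnum : (72 : ℝ≥0∞) * (144⁻¹ * 2⁻¹ ^ n) ^ 2 ≤ 144⁻¹ * 2⁻¹ ^ (n + 1) := by
      have e1 : (72 : ℝ≥0∞) * 144⁻¹ = 2⁻¹ := by
        have : (144 : ℝ≥0∞) = 72 * 2 := by norm_num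
        rw [this, ENNReal.mul_inv (by simp) (by simp), ← mul_assoc,
          ENNReal.mul_inv_cancel (by simp) (by simp), one_mul]
      calc (72 : ℝ≥0∞) * (144⁻¹ * 2⁻¹ ^ n) ^ 2
          = (72 * 144⁻¹) * (144⁻¹ * 2⁻¹ ^ n) * 2⁻¹ ^ n := by ring
        _ = 144⁻¹ * 2⁻¹ ^ (n + 1) * 2⁻¹ ^ n := by rw [e1]; ring
        _ ≤ 144⁻¹ * 2⁻¹ ^ (n + 1) * 1 := by
          gcongr
          exact pow_le_one' (by simp) n
        _ = _ := mul_one _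
    calc μ {ω | ∀ g ∈ S, BoxBad (Bad ω) (n + 1) g}
        ≤ ∑ f : S → Pr, μ {ω | ∀ g ∈ Sf f, BoxBad (Bad ω) n g} :=
          (measure_mono hsub).trans (measure_iUnion_fintype_le _ _)
      _ ≤ ∑ _f : S → Pr, C * (144⁻¹ * 2⁻¹ ^ n : ℝ≥0∞) ^ (S.card * 2) := by
          refine Finset.sum_le_sum fun f _ => ?_
          rw [← hSf f]
          exact ih (Sf f)
      _ = C * ((72 : ℝ≥0∞) * (144⁻¹ * 2⁻¹ ^ n) ^ 2) ^ S.card := by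
          rw [Finset.sum_const, Finset.card_univ, Fintype.card_fun, hPr, Fintype.card_coe,
            nsmul_eq_mul, mul_pow, mul_comm S.card, pow_mul]
          push_cast
          ring
      _ ≤ _ := by gcongr

/-- The geometric series over all levels doubles the bound `C / 144` of level zero. -/
theorem measure_exists_boxBad_le (hbad : ∀ S : Finset (ℕ × ℕ),
      μ {ω | ∀ g ∈ S, Bad ω g} ≤ C * (144⁻¹ : ℝ≥0∞) ^ S.card) :
    μ {ω | ∃ n, BoxBad (Bad ω) n (0, 0)} ≤ C * 72⁻¹ := by
  have h1 : {ω | ∃ n, BoxBad (Bad ω) n (0, 0)} = ⋃ n, {ω | BoxBad (Bad ω) n (0, 0)} := by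
    ext; simp
  have h2 : ∀ n, μ {ω | BoxBad (Bad ω) n (0, 0)} ≤ C * 144⁻¹ * 2⁻¹ ^ n := fun n => by
    simpa [mul_assoc] using measure_boxBad_le hbad n {(0, 0)}
  rw [h1]
  refine (measure_iUnion_le _).trans ((ENNReal.tsum_le_tsum h2).trans ?_)
  rw [ENNReal.tsum_mul_left, ENNReal.tsum_geometric, ENNReal.one_sub_inv_two, inv_inv, mul_assoc]
  gcongr
  have : (144 : ℝ≥0∞) = 72 * 2 := by norm_num
  rw [this, ENNReal.mul_inv (by simp) (by simp), mul_assoc,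
    ENNReal.inv_mul_cancel (by simp) (by simp), mul_one]

end Hierarchical

/-! ### Lattice paths of occupied cells -/

section LatticePaths

variable {d : ℕ}

/-- Two cells with distance at most one. -/
def CellsTouch (a b : Fin d → ℤ) : Prop := ∀ i, |a i - b i| ≤ 1

theorem CellsTouch.symm {a b : Fin d → ℤ} (h : CellsTouch a b) : CellsTouch b a := fun i => by
  rw [abs_sub_comm]; exact h i

/-- `a 0, …, a n` is a self-avoiding lattice path which starts at `0`. -/
structure IsLatticePath (n : ℕ) (a : ℕ → Fin d → ℤ) : Prop where
  start : a 0 = 0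
  step : ∀ i < n, CellsTouch (a i) (a (i + 1))
  inj : Set.InjOn a (Set.Iic n)

/-- The graph of touching cells in the union of a set of cells and the cell of the origin. -/
def cellGraph (occ : (Fin d → ℤ) → Prop) : SimpleGraph (Fin d → ℤ) where
  Adj a b := a ≠ b ∧ CellsTouch a b ∧ (a ≠ 0 → occ a) ∧ (b ≠ 0 → occ b)
  symm := ⟨fun _ _ h => ⟨h.1.symm, h.2.1.symm, h.2.2.2, h.2.2.1⟩⟩
  loopless := ⟨fun _ h => h.1 rfl⟩

theorem abs_sub_le_length {occ : (Fin d → ℤ) → Prop} {a b : Fin d → ℤ}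
    (w : (cellGraph occ).Walk a b) (i : Fin d) : |a i - b i| ≤ w.length := by
  induction w with
  | nil => simp
  | @cons u v w h p ih =>
    rw [SimpleGraph.Walk.length_cons]
    push_cast
    have := abs_sub_le (u i) (v i) (w i)
    have := h.2.1 i
    omega

/-- An infinite cluster leaves the box of radius `n`, so a self-avoiding walk from `0` to a point
outside has more than `n` steps. -/
theorem exists_latticePath {occ : (Fin d → ℤ) → Prop}
    (h : {b | (cellGraph occ).Reachable 0 b}.Infinite) (n : ℕ) :
    ∃ a, IsLatticePath n a ∧ ∀ i < n, occ (a (i + 1)) := by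
  have hfin : (Set.univ.pi fun _ : Fin d => Set.Icc (-(n : ℤ)) n).Finite :=
    Set.Finite.pi fun _ => Set.finite_Icc _ _
  obtain ⟨b, hb, hbn⟩ := h.exists_notMem_finite hfin
  obtain ⟨w, hw⟩ := SimpleGraph.Reachable.exists_isPath hb
  obtain ⟨i, hi⟩ : ∃ i, (n : ℤ) < |b i| := by
    by_contra! hc
    exact hbn fun i _ => abs_le.1 (hc i)
  have hlen : n < w.length := by
    have := abs_sub_le_length w i
    rw [Pi.zero_apply, zero_sub, abs_neg] at this
    exact_mod_cast hi.trans_le this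
  have hinj := hw.getVert_injOn
  refine ⟨w.getVert, ⟨by simp, fun i hi => ?_, fun i hi j hj hij => ?_⟩, fun i hi => ?_⟩
  · exact (w.adj_getVert_succ (i := i) (by omega)).2.1
  · exact hinj (by simp only [Set.mem_Iic, Set.mem_ofPred_eq] at *; omega)
      (by simp only [Set.mem_Iic, Set.mem_ofPred_eq] at *; omega) hij
  -- The cell of the origin need not be occupied, but a self-avoiding walk does not return to it.
  · refine (w.adj_getVert_succ (i := i) (by omega)).2.2.2 fun h0 => ?_
    have : i + 1 = 0 := hinj (by simp only [Set.mem_ofPred_eq]; omega)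
      (by simp) (by simpa using h0)
    omega

open Finset in
/-- The number of lattice paths grows at most exponentially. -/
theorem exists_latticePath_family (d : ℕ) : ∃ K : ℕ, ∀ n : ℕ,
    ∃ 𝒮 : Finset ((Fin d → ℤ) × Finset (Fin d → ℤ)),
    𝒮.card ≤ K ^ n ∧ ∀ a : ℕ → Fin d → ℤ, a 0 = 0 → (∀ i < n, CellsTouch (a i) (a (i + 1))) →
      (a n, (Finset.range n).image fun i => a (i + 1)) ∈ 𝒮 := by
  classical
  -- The possible steps, `3 ^ d` in number. The endpoint is recorded with the set of visited cells
  -- so that the family can be extended.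
  let box : Finset (Fin d → ℤ) := Fintype.piFinset fun _ => Finset.Icc (-1) 1
  refine ⟨box.card, fun n => ?_⟩
  induction n with
  | zero => exact ⟨{(0, ∅)}, by simp, fun a h _ => by simp [h]⟩
  | succ n ih =>
    obtain ⟨𝒮, hc, hS⟩ := ih
    refine ⟨(𝒮 ×ˢ box).image fun x => (x.1.1 + x.2, insert (x.1.1 + x.2) x.1.2), ?_, ?_⟩
    · refine Finset.card_image_le.trans ?_
      rw [Finset.card_product, pow_succ]
      gcongr
    · intro a h0 hs
      rw [Finset.mem_image]
      refine ⟨((a n, (Finset.range n).image fun i => a (i + 1)), a (n + 1) - a n), ?_, ?_⟩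
      · rw [Finset.mem_product]
        refine ⟨hS a h0 fun i hi => hs i (by omega), ?_⟩
        rw [Fintype.mem_piFinset]
        intro i
        rw [Finset.mem_Icc, ← abs_le]
        exact (hs n (by omega)).symm i
      · simp [Finset.range_add_one, Finset.image_insert]

/-- If cells are occupied with a small probability, there are no long paths of occupied cells. -/
theorem ae_not_forall_exists_latticePath (d : ℕ) : ∃ p₀ > 0, ∀ {Ω : Type*} [MeasurableSpace Ω]
    (μ : Measure Ω) (occ : Ω → (Fin d → ℤ) → Prop) (p : ℝ≥0∞), p ≤ p₀ →
    (∀ S : Finset (Fin d → ℤ), μ {ω | ∀ c ∈ S, occ ω c} ≤ p ^ S.card) →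
    ∀ᵐ ω ∂μ, ¬∀ n, ∃ a, IsLatticePath n a ∧ ∀ i < n, occ ω (a (i + 1)) := by
  classical
  obtain ⟨K, hK⟩ := exists_latticePath_family d
  -- This threshold gives `K p ≤ 1/2`, so the union bound over paths of length `n` is at most `2⁻ⁿ`.
  -- The summand 1 spares checking that `K` is positive.
  refine ⟨(2 * (K + 1 : ℝ≥0∞))⁻¹, by simp [ENNReal.mul_eq_top], fun {Ω} _ μ occ p hp hocc => ?_⟩
  have h1 : ∀ n, μ {ω | ¬¬∀ n, ∃ a, IsLatticePath n a ∧ ∀ i < n, occ ω (a (i + 1))} ≤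
      (2⁻¹ : ℝ≥0∞) ^ n := by
    intro n
    obtain ⟨𝒮, hc, hS⟩ := hK n
    calc μ {ω | ¬¬∀ n, ∃ a, IsLatticePath n a ∧ ∀ i < n, occ ω (a (i + 1))}
        ≤ μ (⋃ x ∈ 𝒮.filter fun x => x.2.card = n, {ω | ∀ c ∈ x.2, occ ω c}) := by
          refine measure_mono fun ω hω => ?_
          rw [Set.mem_ofPred_eq, not_not] at hω
          obtain ⟨a, ha, hao⟩ := hω n
          refine Set.mem_iUnion₂.2 ⟨_, Finset.mem_filter.2 ⟨hS a ha.start ha.step, ?_⟩, ?_⟩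
          -- Self-avoidance yields `n` distinct cells, hence the full power `p ^ n`.
          · rw [Finset.card_image_of_injOn, Finset.card_range]
            intro i hi j hj hij
            have hi' := Finset.mem_range.1 hi
            have hj' := Finset.mem_range.1 hj
            have := ha.inj (Set.mem_Iic.2 (by omega : i + 1 ≤ n))
              (Set.mem_Iic.2 (by omega : j + 1 ≤ n)) hij
            omega
          · intro c hc
            obtain ⟨i, hi, rfl⟩ := Finset.mem_image.1 hc
            exact hao i (Finset.mem_range.1 hi)
      _ ≤ ∑ x ∈ 𝒮.filter fun x => x.2.card = n, μ {ω | ∀ c ∈ x.2, occ ω c} :=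
          measure_biUnion_finset_le _ _
      _ ≤ ∑ x ∈ 𝒮.filter fun x => x.2.card = n, p ^ n := by
          refine Finset.sum_le_sum fun x hx => ?_
          rw [← (Finset.mem_filter.1 hx).2]
          exact hocc _
      _ ≤ (K : ℝ≥0∞) ^ n * p ^ n := by
          rw [Finset.sum_const, nsmul_eq_mul]
          gcongr
          exact_mod_cast (Finset.card_filter_le _ _).trans hc
      _ ≤ (2⁻¹ : ℝ≥0∞) ^ n := by
          rw [← mul_pow]
          refine pow_le_pow_left' ?_ n
          calc (K : ℝ≥0∞) * p ≤ (K + 1) * (2 * (K + 1 : ℝ≥0∞))⁻¹ :=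
                mul_le_mul' le_self_add hp
            _ = 2⁻¹ := by
                rw [ENNReal.mul_inv (by simp) (by simp), mul_comm, mul_assoc,
                  ENNReal.inv_mul_cancel (by simp) (by finiteness), mul_one]
  have h2 := ENNReal.tendsto_pow_atTop_nhds_zero_of_lt_one (r := 2⁻¹) (by simp)
  rw [ae_iff]
  exact le_antisymm (ge_of_tendsto' h2 h1) zero_le

end LatticePaths

/-! ### Edges between distant points -/

section LongEdges

variable {d α : ℕ} {A : Type*} [MeasurableSpace A]

/-- The only strictly increasing self-map of a two-element chain is the identity. Thus (V2) for `q =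
0` is a statement about `φ 1`. -/
theorem kappa_one (φ : (j : ℕ) → (Fin (j + 1) → EuclideanSpace ℝ (Fin d) × A) → ℝ)
    (x : Fin 2 → EuclideanSpace ℝ (Fin d) × A) : kappa φ 1 x = φ 1 x := by
  have h : ∀ e : Fin 2 ↪o Fin 2, (e : Fin 2 → Fin 2) = id := fun e => by
    have h1 : e 0 < e 1 := e.strictMono Fin.zero_lt_one
    ext i
    fin_cases i <;> simp <;> omega
  have hs : Subsingleton (Fin 2 ↪o Fin 2) :=
    ⟨fun e e' => DFunLike.coe_injective ((h e).trans (h e').symm)⟩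
  unfold kappa
  rw [Finset.Icc_self, Finset.prod_singleton]
  exact (Fintype.prod_subsingleton _ (RelEmbedding.refl _ : Fin 2 ↪o Fin 2)).trans rfl

variable {Θ : Measure A} [IsProbabilityMeasure Θ]

/-- The exceptional marks may depend on both positions, while the product measure integrates the
first mark before the second position; Fubini exchanges these two. -/
theorem ae_ae_prod_prod {μ ν : Measure (EuclideanSpace ℝ (Fin d))} [SFinite μ] [SFinite ν]
    {p : (EuclideanSpace ℝ (Fin d) × A) × (EuclideanSpace ℝ (Fin d) × A) → Prop}
    (hp : MeasurableSet {z | p z})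
    (h : ∀ x x', ∀ᵐ a ∂Θ, ∀ᵐ a' ∂Θ, p ((x, a), (x', a'))) :
    ∀ᵐ z ∂((μ.prod Θ).prod (ν.prod Θ)), p z := by
  rw [Measure.ae_prod_iff_ae_ae hp]
  have hm : MeasurableSet {y : (EuclideanSpace ℝ (Fin d) × A) × EuclideanSpace ℝ (Fin d) |
      ∀ᵐ a' ∂Θ, p (y.1, (y.2, a'))} := by
    have h1 : MeasurableSet {y : ((EuclideanSpace ℝ (Fin d) × A) × EuclideanSpace ℝ (Fin d)) × A |
        ¬p (y.1.1, (y.1.2, y.2))} :=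
      hp.compl.preimage (f := fun y : ((EuclideanSpace ℝ (Fin d) × A) ×
        EuclideanSpace ℝ (Fin d)) × A => (y.1.1, (y.1.2, y.2))) (by fun_prop)
    exact (measurable_measure_prodMk_left h1) (measurableSet_singleton 0)
  have h2 : ∀ᵐ x ∂(μ.prod Θ), ∀ᵐ x' ∂ν, ∀ᵐ a' ∂Θ, p (x, (x', a')) := by
    have h3 : MeasurableSet {x : EuclideanSpace ℝ (Fin d) × A |
        ∀ᵐ x' ∂ν, ∀ᵐ a' ∂Θ, p (x, (x', a'))} :=
      (measurable_measure_prodMk_left hm.compl) (measurableSet_singleton 0)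
    rw [Measure.ae_prod_iff_ae_ae h3]
    refine Filter.Eventually.of_forall fun x => ?_
    rw [Measure.ae_ae_comm]
    · exact Filter.Eventually.of_forall fun x' => h x x'
    · exact hm.preimage (f := fun y : A × EuclideanSpace ℝ (Fin d) => ((x, y.1), y.2))
        (by fun_prop)
  filter_upwards [h2] with x hx
  rw [Measure.ae_prod_iff_ae_ae]
  · exact hx
  · exact hp.preimage (f := fun y : EuclideanSpace ℝ (Fin d) × A => (x, y)) (by fun_prop)

theorem ae_ae_of_ae_pi {p : A → A → Prop}
    (h : ∀ᵐ a ∂(Measure.pi fun _ : Fin 2 => Θ), p (a 0) (a 1)) :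
    ∀ᵐ a ∂Θ, ∀ᵐ a' ∂Θ, p a a' := by
  have h1 := (measurePreserving_finTwoArrow Θ).symm.quasiMeasurePreserving.ae h
  exact Measure.ae_ae_of_ae_prod h1

end LongEdges

/-! ### No percolation at small intensities -/

section NoPercolation

variable {d α : ℕ} {A : Type*} [MeasurableSpace A]

/-- The cell containing a point. -/
noncomputable def cellIndex (s : ℝ) (x : EuclideanSpace ℝ (Fin d)) : Fin d → ℤ :=
  fun i => ⌊x i / s⌋

theorem cellsTouch_of_dist_le {s : ℝ} (hs : 0 < s) {x y : EuclideanSpace ℝ (Fin d)}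
    (h : dist x y ≤ s) : CellsTouch (cellIndex s x) (cellIndex s y) := by
  have key : ∀ x y : EuclideanSpace ℝ (Fin d), dist x y ≤ s → ∀ i,
      ⌊x i / s⌋ ≤ ⌊y i / s⌋ + 1 := by
    intro x y h i
    have h1 : ‖(x - y) i‖ ≤ ‖x - y‖ := PiLp.norm_apply_le _ _
    rw [PiLp.sub_apply, Real.norm_eq_abs, ← dist_eq_norm] at h1
    have h2 : x i - y i ≤ s := (le_abs_self _).trans (h1.trans h)
    rw [← Int.floor_add_one]
    refine Int.floor_le_floor ?_
    rw [div_le_iff₀ hs, add_mul, div_mul_cancel₀ _ hs.ne']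
    linarith
  intro i
  rw [abs_le]
  have h1 := key x y h i
  have h2 := key y x (by rwa [dist_comm]) i
  simp only [cellIndex]
  omega

variable {φ : (j : ℕ) → (Fin (j + 1) → EuclideanSpace ℝ (Fin d) × A) → ℝ} {t : ℝ}
  {z : ℕ ≃ (Fin d → ℤ)}

/-- Adjacent points are connected with positive probability. -/
theorem connection_pos_of_mem_faces (hα : 1 ≤ α) {S : Set (MPoint d α A)}
    (hS : ∀ p ∈ S, ∀ j, 0 < (p.2.2 j : ℝ)) {π : Finset (MPoint d α A)}
    (hπ : π ∈ (complex φ t z S).faces) {p p' : MPoint d α A} (hp : p ∈ π) (hp' : p' ∈ π)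
    (hlex : lexLT p.1 p'.1) : 0 < φ 1 ![(p.1, p.2.1), (p'.1, p'.2.1)] := by
  obtain ⟨-, hsub, -, h⟩ := hπ
  have h1 := h ⟨0, hα⟩ ![p, p'] (by
    intro i; fin_cases i <;> simp [hp, hp']) (by
    intro i j hij; fin_cases i <;> fin_cases j <;> simp_all)
  have h2 : 0 < simplexMark t z S (⟨0, hα⟩ : Fin α) ![p, p'] :=
    hS _ (hsub hp') _
  refine (h2.trans_le h1).trans_le (le_of_eq ?_)
  congr 1
  funext i
  fin_cases i <;> rfl

variable {s : ℝ} [hs : Fact (0 < s)] {Θ : Measure A} [IsProbabilityMeasure Θ] {B : Set A}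

/-- If there are no long edges and the origin percolates, then infinitely many cells are connected
to the cell of the origin in the graph of occupied cells. -/
theorem infinite_reachable_cells (hα : 1 ≤ α) {y : ModelSpace d α A}
    (hinj : Function.Injective (pos y.1)) (hin : InPieces s Θ B y.1)
    (hmark : ∀ o j, 0 < (y.2 o j : ℝ)) (hfalse : ∀ c, y.1.1 (c, false) = 0)
    (hlong : ∀ o o', o ≠ o' → s < dist (pos y.1 o) (pos y.1 o') →
      φ 1 ![(pos y.1 o, mk y.1 o), (pos y.1 o', mk y.1 o')] = 0)
    (hperc : PercolatesFromOrigin (complex φ t z (config y)) 0) :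
    {b | (cellGraph fun c => 0 < y.1.1 (c, true)).Reachable 0 b}.Infinite := by
  obtain ⟨σ₀, ⟨p₀, hp₀, hp₀0⟩, hinf⟩ := hperc
  have hone : ∀ σ : {σ : Finset (MPoint d α A) // σ ∈ (complex φ t z (config y)).faces ∧
      σ.card = 0 + 1}, ∃ o ∈ present y.1, σ.1 = {pt y o} := fun σ => by
    obtain ⟨p, hp⟩ := Finset.card_eq_one.1 σ.2.2
    obtain ⟨o, ho, rfl⟩ := σ.2.1.2.1 (by
      rw [hp]; exact Finset.mem_coe.2 (Finset.mem_singleton_self p))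
    exact ⟨o, ho, hp⟩
  choose f hfp hf using hone
  have hocc : ∀ o ∈ present y.1, cellIndex s (pos y.1 o) ≠ 0 →
      0 < y.1.1 (cellIndex s (pos y.1 o), true) := by
    rintro (_ | ⟨⟨c, b⟩, i⟩) ho hne
    · exact absurd (by funext i; simp [cellIndex, pos]) hne
    · have h1 : cellIndex s (pos y.1 (some ((c, b), i))) = c :=
        (mem_cell_iff hs.out).1 (hin ((c, b), i)).1
      have h2 : i < y.1.1 (c, b) := ho _ rfl
      rw [h1]
      cases b with
      | false => rw [hfalse] at h2; omega
      | true => omega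
  have hadj : ∀ σ τ, (qGraph (complex φ t z (config y)) 0).Adj σ τ →
      (cellGraph fun c => 0 < y.1.1 (c, true)).Reachable (cellIndex s (pos y.1 (f σ)))
        (cellIndex s (pos y.1 (f τ))) := by
    rintro σ τ ⟨hne, π, hπ, -, hσ, hτ⟩
    rw [hf, Finset.singleton_subset_iff] at hσ hτ
    have hne' : f σ ≠ f τ := fun h => hne (Subtype.ext (by rw [hf, hf, h]))
    have hS : ∀ p ∈ config y, ∀ j, 0 < (p.2.2 j : ℝ) := by
      rintro _ ⟨o, -, rfl⟩ j
      exact hmark o j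
    have hdist : dist (pos y.1 (f σ)) (pos y.1 (f τ)) ≤ s := by
      by_contra! hlt
      rcases lexLT_or_lexLT (fun h => hne' (hinj h)) with h | h
      · exact (connection_pos_of_mem_faces hα hS hπ hσ hτ h).ne' (hlong _ _ hne' hlt)
      · exact (connection_pos_of_mem_faces hα hS hπ hτ hσ h).ne'
          (hlong _ _ hne'.symm (by rwa [dist_comm]))
    by_cases hc : cellIndex s (pos y.1 (f σ)) = cellIndex s (pos y.1 (f τ))
    · rw [hc]
    · exact SimpleGraph.Adj.reachable ⟨hc, cellsTouch_of_dist_le hs.out hdist,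
        hocc _ (hfp σ), hocc _ (hfp τ)⟩
  have hreach : ∀ σ τ, (qGraph (complex φ t z (config y)) 0).Reachable σ τ →
      (cellGraph fun c => 0 < y.1.1 (c, true)).Reachable (cellIndex s (pos y.1 (f σ)))
        (cellIndex s (pos y.1 (f τ))) := by
    rintro σ τ ⟨w⟩
    induction w with
    | nil => exact SimpleGraph.Reachable.refl _
    | cons h _ ih => exact (hadj _ _ h).trans ih
  have h0 : cellIndex s (pos y.1 (f σ₀)) = 0 := by
    have : pt y (f σ₀) = p₀ := by
      rw [hf] at hp₀
      exact (Finset.mem_singleton.1 hp₀).symm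
    have : pos y.1 (f σ₀) = 0 := by rw [← hp₀0, ← this]; rfl
    rw [this]
    funext i
    simp [cellIndex]
  -- Each cell contains finitely many points, so finitely many cells could carry only a finite
  -- component.
  intro hfin
  refine hinf (Set.Finite.of_finite_fibers (fun τ => cellIndex s (pos y.1 (f τ)))
    (hfin.subset ?_) fun c _ => ?_)
  · rintro _ ⟨τ, hτ, rfl⟩
    have h1 := hreach σ₀ τ (SimpleGraph.ConnectedComponent.exact
      ((SimpleGraph.ConnectedComponent.mem_supp_iff _ _).1 hτ).symm)
    rwa [h0] at h1
  · refine Set.Finite.of_finite_image (f := fun τ => f τ)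
      ((finite_present_cell Θ hin c).subset ?_) ?_
    · rintro _ ⟨τ, ⟨-, hτ⟩, rfl⟩
      exact ⟨hfp τ, (mem_cell_iff hs.out).2 hτ⟩
    · intro τ _ τ' _ h
      exact Subtype.ext (by rw [hf, hf]; simp only at h; rw [h])

variable (Θ) in
theorem measurePreserving_count (β : ℝ≥0) :
    MeasurePreserving (fun y : ModelSpace d α A => y.1.1) (modelLaw α s Θ B β)
      (Measure.infinitePi fun r => poissonMeasure (pieceRate s Θ B β r)) :=
  (measurePreserving_fst).comp measurePreserving_fst

variable (Θ) in
theorem ae_mark_pos (β : ℝ≥0) :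
    ∀ᵐ y ∂(modelLaw (d := d) α s Θ B β), ∀ o j, 0 < (y.2 o j : ℝ) := by
  rw [ae_all_iff]
  intro o
  rw [ae_all_iff]
  intro j
  have h1 : MeasurePreserving (fun y : ModelSpace d α A => y.2 o j) (modelLaw α s Θ B β) volume :=
    ((measurePreserving_eval_infinitePi (fun _ : Σ k : Fin α, (Fin (k.1 + 1) → ℕ × ℕ) =>
      (volume : Measure unitInterval)) j).comp (measurePreserving_eval_infinitePi
        (fun _ : Option (Label d) => edgeMarkLaw α) o)).comp measurePreserving_snd
  refine h1.quasiMeasurePreserving.ae (p := fun v : unitInterval => 0 < (v : ℝ)) ?_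
  rw [ae_iff]
  have := volume_setOf_le (e := 0) le_rfl zero_le_one
  simpa only [not_lt, ENNReal.ofReal_zero] using this

theorem poissonMeasure_pos_le (r : ℝ≥0) : poissonMeasure r {n | 0 < n} ≤ r := by
  have h1 : {n : ℕ | 0 < n} = {0}ᶜ := by ext n; simp [Nat.pos_iff_ne_zero]
  rw [h1, prob_compl_eq_one_sub (measurableSet_singleton 0), poissonMeasure_singleton]
  have h2 : (1 : ℝ) - r ≤ Real.exp (-r) := Real.one_sub_le_exp_neg r
  rw [tsub_le_iff_left]
  have h3 : (1 : ℝ≥0∞) = ENNReal.ofReal (1 : ℝ) := by simp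
  have h4 : (r : ℝ≥0∞) = ENNReal.ofReal (r : ℝ) := by simp
  rw [h3, h4, add_comm, ← ENNReal.ofReal_add (NNReal.coe_nonneg r) (by positivity)]
  refine ENNReal.ofReal_le_ofReal ?_
  simp
  linarith

theorem pieceRate_univ_true (β : ℝ≥0) (c : Fin d → ℤ) :
    pieceRate s Θ Set.univ β (c, true) = β * s.toNNReal ^ d := by
  simp [pieceRate, markPart]

theorem pieceRate_univ_false (β : ℝ≥0) (c : Fin d → ℤ) :
    pieceRate s Θ Set.univ β (c, false) = 0 := by
  simp [pieceRate, markPart]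

theorem measure_occupied_le (β : ℝ≥0) (S : Finset (Fin d → ℤ)) :
    modelLaw α s Θ Set.univ β {y | ∀ c ∈ S, 0 < y.1.1 (c, true)} ≤
      ((β * s.toNNReal ^ d : ℝ≥0) : ℝ≥0∞) ^ S.card := by
  classical
  have h1 : {y : ModelSpace d α A | ∀ c ∈ S, 0 < y.1.1 (c, true)} = (fun y => y.1.1) ⁻¹'
      (Set.pi (S.image fun c => (c, true)) fun _ => {n : ℕ | 0 < n}) := by
    ext y
    simp [Set.mem_pi]
  rw [h1, (measurePreserving_count Θ β).measure_preimage, Measure.infinitePi_pi,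
    Finset.prod_image (fun c _ c' _ h => (Prod.ext_iff.1 h).1)]
  · refine (Finset.prod_le_prod' fun c _ => poissonMeasure_pos_le _).trans ?_
    rw [Finset.prod_congr rfl fun c _ => by rw [pieceRate_univ_true]]
    simp
  · exact fun _ _ => .of_discrete
  · exact (MeasurableSet.pi (Finset.countable_toSet _) fun _ _ => .of_discrete).nullMeasurableSet

theorem ae_count_false (β : ℝ≥0) :
    ∀ᵐ y ∂(modelLaw (d := d) α s Θ Set.univ β), ∀ c, y.1.1 (c, false) = 0 := by
  rw [ae_all_iff]
  intro c
  have h1 : MeasurePreserving (fun y : ModelSpace d α A => y.1.1 (c, false))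
      (modelLaw α s Θ Set.univ β) (poissonMeasure (pieceRate s Θ Set.univ β (c, false))) :=
    (measurePreserving_eval_infinitePi (fun r : Piece d =>
      poissonMeasure (pieceRate s Θ Set.univ β r)) (c, false)).comp (measurePreserving_count Θ β)
  refine h1.quasiMeasurePreserving.ae (p := fun n : ℕ => n = 0) ?_
  rw [pieceRate_univ_false, ae_iff]
  have := poissonMeasure_pos_le 0
  simpa [Nat.pos_iff_ne_zero] using this

/-- There are almost surely no edges between points with large distance. -/
theorem ae_no_long_edge (hα : 1 ≤ α) (hφ : IsConnectionFamily α φ)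
    (hV2 : ∀ x : Fin 2 → EuclideanSpace ℝ (Fin d), s < Metric.diam (Set.range x) →
      ∀ᵐ a ∂(Measure.pi fun _ : Fin 2 => Θ), kappa φ 1 (fun i => (x i, a i)) = 0) (β : ℝ≥0) :
    ∀ᵐ y ∂(modelLaw (d := d) α s Θ B β), ∀ o o', o ≠ o' →
      s < dist (pos y.1 o) (pos y.1 o') →
        φ 1 ![(pos y.1 o, mk y.1 o), (pos y.1 o', mk y.1 o')] = 0 := by
  have hm : MeasurableSet {z : (EuclideanSpace ℝ (Fin d) × A) × (EuclideanSpace ℝ (Fin d) × A) |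
      s < dist z.1.1 z.2.1 → φ 1 ![z.1, z.2] = 0} := by
    have h1 : Measurable fun z : (EuclideanSpace ℝ (Fin d) × A) ×
        (EuclideanSpace ℝ (Fin d) × A) => φ 1 ![z.1, z.2] := by
      refine (hφ.measurable 1 le_rfl hα).comp (measurable_pi_lambda _ fun i => ?_)
      fin_cases i
      · exact measurable_fst
      · exact measurable_snd
    have h2 : MeasurableSet {z : (EuclideanSpace ℝ (Fin d) × A) ×
        (EuclideanSpace ℝ (Fin d) × A) | s < dist z.1.1 z.2.1} :=
      measurableSet_lt measurable_const (by fun_prop)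
    exact h2.imp (h1 (measurableSet_singleton 0))
  have hp : ∀ x x' : EuclideanSpace ℝ (Fin d), ∀ᵐ a ∂Θ, ∀ᵐ a' ∂Θ,
      s < dist x x' → φ 1 ![(x, a), (x', a')] = 0 := by
    intro x x'
    by_cases h : s < dist x x'
    · have h1 := hV2 ![x, x'] (by
        rw [Matrix.range_cons_cons_empty, Metric.diam_pair]; exact h)
      have h2 : ∀ᵐ a ∂(Measure.pi fun _ : Fin 2 => Θ), φ 1 ![(x, a 0), (x', a 1)] = 0 := by
        filter_upwards [h1] with a ha
        rw [kappa_one] at ha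
        rw [← ha]
        congr 1
        funext i
        fin_cases i <;> rfl
      filter_upwards [ae_ae_of_ae_pi (p := fun a a' => φ 1 ![(x, a), (x', a')] = 0) h2] with a ha
      filter_upwards [ha] with a' ha' _ using ha'
    · exact Filter.Eventually.of_forall fun a => Filter.Eventually.of_forall fun a' h' =>
        absurd h' h
  have h1 : ∀ᵐ x ∂(pointLaw (pieceRate s Θ B β) Θ (pieceLaw s Θ B)), ∀ i j, i ≠ j →
      s < dist (x.2.2 i).1 (x.2.2 j).1 → φ 1 ![x.2.2 i, x.2.2 j] = 0 :=
    ae_pair_of_ae (s := s) (B := B) Θ (p := fun z => s < dist z.1.1 z.2.1 → φ 1 ![z.1, z.2] = 0)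
      (ae_ae_prod_prod hm hp)
  have h2 : ∀ᵐ x ∂(pointLaw (pieceRate s Θ B β) Θ (pieceLaw s Θ B)), ∀ i,
      s < dist (0 : EuclideanSpace ℝ (Fin d)) (x.2.2 i).1 → φ 1 ![(0, x.2.1), x.2.2 i] = 0 := by
    refine ae_origin_pair_of_ae (s := s) (B := B) Θ
      (p := fun z => s < dist (0 : EuclideanSpace ℝ (Fin d)) z.2.1 → φ 1 ![(0, z.1), z.2] = 0) ?_
    rw [Measure.ae_prod_iff_ae_ae]
    -- The origin is treated as a point whose position has the Dirac law at zero.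
    · have h3 := ae_ae_prod_prod (μ := Measure.dirac 0) (ν := volume) hm hp
      rw [Measure.dirac_prod] at h3
      have h4 := Measure.ae_ae_of_ae_prod h3
      exact ae_of_ae_map (f := fun a : A => ((0 : EuclideanSpace ℝ (Fin d)), a)) (by fun_prop) h4
    · exact hm.preimage (f := fun z : A × (EuclideanSpace ℝ (Fin d) × A) =>
        ((0, z.1), z.2)) (by fun_prop)
  have hsymm : ∀ p p' : EuclideanSpace ℝ (Fin d) × A, φ 1 ![p, p'] = φ 1 ![p', p] := by
    intro p p'
    rw [← hφ.symmetric 1 le_rfl hα (Equiv.swap 0 1) ![p', p]]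
    congr 1
    funext i
    fin_cases i <;> simp
  refine Measure.quasiMeasurePreserving_fst.ae (p := fun x => ∀ o o', o ≠ o' →
      s < dist (pos x o) (pos x o') → φ 1 ![(pos x o, mk x o), (pos x o', mk x o')] = 0) ?_
  filter_upwards [h1, h2] with x hx1 hx2
  rintro (_ | i) (_ | j) hne hlt
  · exact absurd rfl hne
  · exact hx2 j hlt
  · rw [hsymm]
    exact hx2 i (by rw [dist_comm]; exact hlt)
  · exact hx1 i j (fun h => hne (congrArg some h)) hlt

/-- At small intensities, the explicit model does not percolate. -/
theorem exists_ae_not_percolates (hd : 0 < d) (hα : 1 ≤ α) (hφ : IsConnectionFamily α φ)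
    (hV2 : ∀ x : Fin 2 → EuclideanSpace ℝ (Fin d), s < Metric.diam (Set.range x) →
      ∀ᵐ a ∂(Measure.pi fun _ : Fin 2 => Θ), kappa φ 1 (fun i => (x i, a i)) = 0) :
    ∃ β : ℝ≥0, 0 < β ∧ ∀ᵐ y ∂(modelLaw (d := d) α s Θ Set.univ β),
      ¬PercolatesFromOrigin (complex φ t z (config y)) 0 := by
  obtain ⟨p₀, hp₀, h⟩ := ae_not_forall_exists_latticePath d
  -- `β` is chosen such that the mean number of points in a cell is below the path-counting
  -- threshold. With `B = univ`, all points belong to `true` pieces.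
  obtain ⟨β, hβ, hlt⟩ := ENNReal.exists_nnreal_pos_mul_lt
    (ENNReal.coe_ne_top (r := s.toNNReal ^ d)) hp₀.ne'
  refine ⟨β, hβ, ?_⟩
  have h1 := h (modelLaw (d := d) α s Θ Set.univ β) (fun y c => 0 < y.1.1 (c, true))
    (β * s.toNNReal ^ d : ℝ≥0) (by rw [ENNReal.coe_mul]; exact hlt.le) (measure_occupied_le β)
  have h2 : ∀ᵐ y ∂(modelLaw (d := d) α s Θ Set.univ β), Function.Injective (pos y.1) :=
    Measure.quasiMeasurePreserving_fst.ae (ae_injective_pos Θ hd)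
  have h3 : ∀ᵐ y ∂(modelLaw (d := d) α s Θ Set.univ β), InPieces s Θ Set.univ y.1 :=
    Measure.quasiMeasurePreserving_fst.ae (ae_inPieces Θ .univ)
  filter_upwards [h1, h2, h3, ae_mark_pos Θ β, ae_count_false β,
    ae_no_long_edge hα hφ hV2 β] with y hy1 hinj hin hmark hfalse hlong hperc
  exact hy1 fun n => exists_latticePath
    (infinite_reachable_cells hα hinj hin hmark hfalse hlong hperc) n

end NoPercolation

/-! ### Batches of points in a planar array of cells -/

section Batches

variable {d α k : ℕ}

/-- The cells which form a planar array. -/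
def cellOf (d : ℕ) (g : ℕ × ℕ) : Fin d → ℤ :=
  fun i => if i.1 = 0 then g.1 else if i.1 = 1 then g.2 else 0

theorem cellOf_injective (hd : 2 ≤ d) : Function.Injective (cellOf d) := by
  intro g g' h
  have h0 := congrFun h ⟨0, by omega⟩
  have h1 := congrFun h ⟨1, by omega⟩
  simp only [cellOf, if_true, one_ne_zero, if_false, Nat.cast_inj] at h0 h1
  exact Prod.ext h0 h1

/-- The places of points in a cell: there are three layers which consist of `k` batches of `α`
points. -/
abbrev Slot (α k : ℕ) : Type := Fin 3 × Fin k × Fin α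

/-- The label of the point of a cell with a given place. -/
noncomputable def lab (d : ℕ) (g : ℕ × ℕ) (w : Slot α k) : Option (Label d) :=
  some ((cellOf d g, true), Fintype.equivFin (Slot α k) w)

theorem lab_inj (hd : 2 ≤ d) {g g' : ℕ × ℕ} {w w' : Slot α k} (h : lab d g w = lab d g' w') :
    g = g' ∧ w = w' := by
  simp only [lab, Option.some.injEq, Prod.mk.injEq, and_true, Fin.val_inj,
    EmbeddingLike.apply_eq_iff_eq] at h
  exact ⟨cellOf_injective hd h.1, h.2⟩

/-- The labels of a batch. -/
noncomputable def batch (d α : ℕ) (g : ℕ × ℕ) (y : Fin 3) (m : Fin k) :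
    Finset (Option (Label d)) :=
  Finset.univ.image fun l : Fin α => lab d g (y, m, l)

theorem mem_batch {g : ℕ × ℕ} {y : Fin 3} {m : Fin k} {o : Option (Label d)} :
    o ∈ batch d α g y m ↔ ∃ l : Fin α, lab d g (y, m, l) = o := by
  simp [batch]

theorem lab_mem_batch (hd : 2 ≤ d) {g g' : ℕ × ℕ} {y y' : Fin 3} {m m' : Fin k} {l : Fin α} :
    lab d g (y, m, l) ∈ batch d α g' y' m' ↔ g = g' ∧ y = y' ∧ m = m' := by
  rw [mem_batch]
  constructor
  · rintro ⟨l', h⟩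
    obtain ⟨h1, h2⟩ := lab_inj hd h
    simp only [Prod.mk.injEq] at h2
    exact ⟨h1.symm, h2.1.symm, h2.2.1.symm⟩
  · rintro ⟨rfl, rfl, rfl⟩
    exact ⟨l, rfl⟩

theorem card_batch (hd : 2 ≤ d) (g : ℕ × ℕ) (y : Fin 3) (m : Fin k) :
    (batch d α g y m).card = α := by
  rw [batch, Finset.card_image_of_injective, Finset.card_univ, Fintype.card_fin]
  intro l l' h
  have := (lab_inj hd h).2
  simpa using this

/-- The right and the upper neighbour of a site. -/
def neighbour (dir : Bool) (g : ℕ × ℕ) : ℕ × ℕ := if dir then (g.1, g.2 + 1) else (g.1 + 1, g.2)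

/-- The possible requirements for a good site: a batch forms a simplex, or two batches in
neighbouring cells are connected via a third one. -/
abbrev Task (k : ℕ) : Type := Option (Bool × Fin k × Fin k)

/-- The layer of the points which are used in a task. -/
def layerOf : Task k → Fin 3
  | none => 0
  | some (false, _) => 1
  | some (true, _) => 2

/-- The points which are involved in a trial for a task. -/
noncomputable def region (d α : ℕ) (g : ℕ × ℕ) (r : Task k) (m : Fin k) :
    Finset (Option (Label d)) :=
  r.elim ∅ (fun w => batch d α g 0 w.2.1 ∪ batch d α (neighbour w.1 g) 0 w.2.2) ∪
    batch d α g (layerOf r) m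

open Classical in
/-- The sets of points which have to satisfy `Bit` in a trial for a task. -/
noncomputable def trial (d α : ℕ) (g : ℕ × ℕ) (r : Task k) (m : Fin k) :
    Finset (Finset (Option (Label d))) :=
  (region d α g r m).powerset.filter fun ρ =>
    -- Sets without a point of the trial's own batch are left out: those inside one base batch are
    -- tested by the task `none`, and using them twice would destroy independence.
    2 ≤ ρ.card ∧ ρ.card ≤ α + 1 ∧ ∃ l : Fin α, lab d g (layerOf r, m, l) ∈ ρ

theorem mem_trial {g : ℕ × ℕ} {r : Task k} {m : Fin k} {ρ : Finset (Option (Label d))} :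
    ρ ∈ trial d α g r m ↔ ρ ⊆ region d α g r m ∧ 2 ≤ ρ.card ∧ ρ.card ≤ α + 1 ∧
      ∃ l : Fin α, lab d g (layerOf r, m, l) ∈ ρ := by
  simp [trial]

theorem none_notMem_region {g : ℕ × ℕ} {r : Task k} {m : Fin k} : none ∉ region d α g r m := by
  rcases r with _ | ⟨dir, j, j'⟩ <;> simp [region, mem_batch, lab]

theorem card_region_le (hd : 2 ≤ d) (g : ℕ × ℕ) (r : Task k) (m : Fin k) :
    (region d α g r m).card ≤ 3 * α := by
  refine (Finset.card_union_le _ _).trans ?_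
  rcases r with _ | ⟨dir, j, j'⟩
  · simp only [Option.elim, card_batch hd, Finset.card_empty]
    omega
  · simp only [Option.elim]
    have := Finset.card_union_le (batch d α g 0 j) (batch d α (neighbour dir g) 0 j')
    simp only [card_batch hd] at *
    omega

/-- A crude bound, uniform in the trial: each trial succeeds with probability at least `e ^ (2 ^ (3
* α))`. -/
theorem card_trial_le (hd : 2 ≤ d) (g : ℕ × ℕ) (r : Task k) (m : Fin k) :
    (trial d α g r m).card ≤ 2 ^ (3 * α) := by
  classical
  rw [trial]
  refine (Finset.card_filter_le _ _).trans ?_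
  rw [Finset.card_powerset]
  exact Nat.pow_le_pow_right (by norm_num) (card_region_le hd g r m)

/-- Trials for different sites may share labels in layer 0 only. A label in another layer belongs to
the trial's own batch, and for the task `none` that batch is the whole region. -/
theorem eq_of_lab_mem_trial (hd : 2 ≤ d) {g g' : ℕ × ℕ} {r : Task k} {m m' : Fin k} {y' : Fin 3}
    {l' : Fin α} {ρ : Finset (Option (Label d))} (hρ : ρ ∈ trial d α g r m)
    (hl : lab d g' (y', m', l') ∈ ρ) (h : y' ≠ 0 ∨ layerOf r = 0) : g' = g ∧ m' = m := by
  have h1 := (mem_trial.1 hρ).1 hl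
  rcases r with _ | ⟨dir, j, j'⟩
  · simp only [region, Option.elim, Finset.empty_union, lab_mem_batch hd] at h1
    exact ⟨h1.1, h1.2.2⟩
  · have h2 : layerOf (some (dir, j, j')) ≠ 0 := by cases dir <;> simp [layerOf]
    simp only [region, Option.elim, Finset.mem_union, lab_mem_batch hd] at h1
    tauto

/-- Different trials use different sets of points. -/
theorem disjoint_trial (hd : 2 ≤ d) {g g' : ℕ × ℕ} {r r' : Task k} {m m' : Fin k}
    (h : (g, m) ≠ (g', m')) : Disjoint (trial d α g r m) (trial d α g' r' m') := by
  rw [Finset.disjoint_left]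
  intro ρ hρ hρ'
  obtain ⟨l, hl⟩ := (mem_trial.1 hρ).2.2.2
  obtain ⟨l', hl'⟩ := (mem_trial.1 hρ').2.2.2
  by_cases h0 : layerOf r = 0
  · obtain ⟨h1, h2⟩ := eq_of_lab_mem_trial hd hρ hl' (Or.inr h0)
    exact h (by rw [h1, h2])
  · obtain ⟨h1, h2⟩ := eq_of_lab_mem_trial hd hρ' hl (Or.inl h0)
    exact h (by rw [h1, h2])

variable (α k) in
/-- The points in the base layer of the cell of the origin. -/
noncomputable def baseLayer (d : ℕ) : Finset (Option (Label d)) :=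
  Finset.univ.biUnion fun m : Fin k => batch d α (0, 0) 0 m

variable (α k) in
/-- The sets consisting of the origin and points in the base layer of its cell. -/
noncomputable def originSets (d : ℕ) : Finset (Finset (Option (Label d))) :=
  (insert none (baseLayer α k d)).powerset.filter fun ρ =>
    none ∈ ρ ∧ 2 ≤ ρ.card ∧ ρ.card ≤ α + 1

theorem mem_originSets {ρ : Finset (Option (Label d))} :
    ρ ∈ originSets α k d ↔ ρ ⊆ insert none (baseLayer α k d) ∧ none ∈ ρ ∧ 2 ≤ ρ.card ∧
      ρ.card ≤ α + 1 := by
  simp [originSets]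

/-- Only the sets in `originSets` contain the origin. -/
theorem disjoint_originSets {g : ℕ × ℕ} {r : Task k} {m : Fin k} :
    Disjoint (originSets α k d) (trial d α g r m) := by
  rw [Finset.disjoint_left]
  intro ρ hρ hρ'
  exact none_notMem_region ((mem_trial.1 hρ').1 (mem_originSets.1 hρ).2.1)

end Batches

/-! ### Good sites -/

section GoodSites

variable {d α k : ℕ} {A : Type*} [MeasurableSpace A]

variable (α k) in
/-- The cell of a site contains sufficiently many points with marks in `B`. -/
def IsFull (x : PointData (Piece d) A (EuclideanSpace ℝ (Fin d) × A)) (g : ℕ × ℕ) : Prop :=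
  Fintype.card (Slot α k) ≤ x.1 (cellOf d g, true)

variable (α) in
/-- The cells which are involved in a task contain sufficiently many points. -/
def IsPossible (x : PointData (Piece d) A (EuclideanSpace ℝ (Fin d) × A)) (g : ℕ × ℕ)
    (r : Task k) : Prop :=
  ∀ w ∈ r, IsFull α k x (neighbour w.1 g)

variable (k) in
/-- A site is good if its cell is full and if for all possible tasks there is a successful trial. -/
def IsGood (t : ℝ) (z : ℕ ≃ (Fin d → ℤ)) (e : ℝ) (y : ModelSpace d α A) (g : ℕ × ℕ) : Prop :=
  IsFull α k y.1 g ∧ ∀ r : Task k, IsPossible α y.1 g r →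
    ∃ m, ∀ ρ ∈ trial d α g r m, Bit t z e y ρ

variable (k) in
/-- The mark of the origin is in `B`, its cell is full, and the origin is connected to all points in
the base layer of its cell. -/
def IsRooted (t : ℝ) (z : ℕ ≃ (Fin d → ℤ)) (e : ℝ) (B : Set A) (y : ModelSpace d α A) : Prop :=
  y.1.2.1 ∈ B ∧ IsFull α k y.1 (0, 0) ∧ ∀ ρ ∈ originSets α k d, Bit t z e y ρ

theorem batch_subset_present {x : PointData (Piece d) A (EuclideanSpace ℝ (Fin d) × A)}
    {g : ℕ × ℕ} (h : IsFull α k x g) (y : Fin 3) (m : Fin k) :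
    (batch d α g y m : Set (Option (Label d))) ⊆ present x := by
  intro o ho
  obtain ⟨l, rfl⟩ := mem_batch.1 (Finset.mem_coe.1 ho)
  rintro _ ⟨⟩
  exact (Fin.is_lt _).trans_le h

theorem region_subset_present {x : PointData (Piece d) A (EuclideanSpace ℝ (Fin d) × A)}
    {g : ℕ × ℕ} (h : IsFull α k x g) {r : Task k} (hr : IsPossible α x g r) (m : Fin k) :
    (region d α g r m : Set (Option (Label d))) ⊆ present x := by
  rw [region, Finset.coe_union]
  refine Set.union_subset ?_ (batch_subset_present h _ _)
  rcases r with _ | ⟨dir, j, j'⟩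
  · simp
  · simp only [Option.elim, Finset.coe_union]
    exact Set.union_subset (batch_subset_present h _ _) (batch_subset_present (hr _ rfl) _ _)

theorem isMarked_of_mem_trial {x : PointData (Piece d) A (EuclideanSpace ℝ (Fin d) × A)}
    {g : ℕ × ℕ} (h : IsFull α k x g) {r : Task k} (hr : IsPossible α x g r) {m : Fin k}
    {ρ : Finset (Option (Label d))} (hρ : ρ ∈ trial d α g r m) : IsMarked α x ρ := by
  obtain ⟨h1, h2, h3, -⟩ := mem_trial.1 hρ
  exact ⟨(Finset.coe_subset.2 h1).trans (region_subset_present h hr m), h2, h3⟩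

theorem insert_baseLayer_subset_present
    {x : PointData (Piece d) A (EuclideanSpace ℝ (Fin d) × A)} (h : IsFull α k x (0, 0)) :
    ((insert none (baseLayer α k d) : Finset (Option (Label d))) : Set (Option (Label d))) ⊆
      present x := by
  intro o ho
  rcases Finset.mem_insert.1 (Finset.mem_coe.1 ho) with rfl | ho
  · rintro _ ⟨⟩
  · obtain ⟨m, -, hm⟩ := Finset.mem_biUnion.1 ho
    exact batch_subset_present h _ _ hm

theorem isMarked_of_mem_originSets {x : PointData (Piece d) A (EuclideanSpace ℝ (Fin d) × A)}
    (h : IsFull α k x (0, 0)) {ρ : Finset (Option (Label d))} (hρ : ρ ∈ originSets α k d) :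
    IsMarked α x ρ := by
  obtain ⟨h1, -, h2, h3⟩ := mem_originSets.1 hρ
  exact ⟨(Finset.coe_subset.2 h1).trans (insert_baseLayer_subset_present h), h2, h3⟩

variable {t : ℝ} {z : ℕ ≃ (Fin d → ℤ)} {e : ℝ}

theorem measurableSet_isFull (g : ℕ × ℕ) :
    MeasurableSet {x : PointData (Piece d) A (EuclideanSpace ℝ (Fin d) × A) | IsFull α k x g} :=
  measurableSet_le measurable_const (by fun_prop)

theorem measurableSet_isGood (ht : 0 < t) (g : ℕ × ℕ) :
    MeasurableSet {y : ModelSpace d α A | IsGood k t z e y g} := by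
  have h1 : ∀ g, MeasurableSet {y : ModelSpace d α A | IsFull α k y.1 g} := fun g =>
    measurable_fst (measurableSet_isFull g)
  refine (h1 g).inter (.congr (s := ⋂ r : Task k, {y : ModelSpace d α A | IsPossible α y.1 g r →
    ∃ m, ∀ ρ ∈ trial d α g r m, Bit t z e y ρ}) ?_ (by ext; simp; rfl))
  refine MeasurableSet.iInter fun r => MeasurableSet.imp ?_ ?_
  · rcases r with _ | ⟨dir, j, j'⟩
    · simp [IsPossible]
    · simpa [IsPossible] using h1 (neighbour dir g)
  · refine .congr (s := ⋃ m : Fin k, ⋂ ρ ∈ trial d α g r m, {y : ModelSpace d α A |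
      Bit t z e y ρ}) ?_ (by ext; simp)
    exact MeasurableSet.iUnion fun m => Finset.measurableSet_biInter _ fun ρ _ =>
      measurableSet_bit z ht e ρ

theorem measurableSet_isRooted (ht : 0 < t) {B : Set A} (hB : MeasurableSet B) :
    MeasurableSet {y : ModelSpace d α A | IsRooted k t z e B y} := by
  refine MeasurableSet.inter (s₁ := {y : ModelSpace d α A | y.1.2.1 ∈ B}) ?_
    (MeasurableSet.inter (s₁ := {y : ModelSpace d α A | IsFull α k y.1 (0, 0)}) ?_ ?_)
  · exact hB.preimage (f := fun y : ModelSpace d α A => y.1.2.1) (by fun_prop)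
  · exact measurable_fst (measurableSet_isFull _)
  · refine .congr (s := ⋂ ρ ∈ originSets α k d, {y : ModelSpace d α A |
      Bit t z e y ρ}) ?_ (by ext; simp; rfl)
    exact Finset.measurableSet_biInter _ fun ρ _ => measurableSet_bit z ht e ρ

open Classical in
/-- For given positions, the probability that all sites in a finite set are bad. -/
theorem markLaw_bad_le (hd : 2 ≤ d) {B : Set A}
    {x : PointData (Piece d) A (EuclideanSpace ℝ (Fin d) × A)}
    (hinj : Function.Injective (pos x)) (hK : Set.InjOn (labelCoords t z x) (present x))
    (he0 : 0 ≤ e) (he1 : e ≤ 1) (S : Finset (ℕ × ℕ)) :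
    markLaw (Piece d) (edgeMarkLaw α) {u | IsRooted k t z e B (x, u) ∧
      ∀ g ∈ S, ¬IsGood k t z e (x, u) g} ≤
    (if x.2.1 ∈ B then 1 else 0) * (ENNReal.ofReal e ^ (originSets α k d).card *
      ∏ g ∈ S, ((if IsFull α k x g then 0 else 1) + Fintype.card (Task k) *
        (1 - ENNReal.ofReal e ^ (2 ^ (3 * α))) ^ k)) := by
  by_cases hV : x.2.1 ∈ B ∧ IsFull α k x (0, 0)
  swap
  · have : {u : Option (Label d) → EdgeMarks α | IsRooted k t z e B (x, u) ∧
        ∀ g ∈ S, ¬IsGood k t z e (x, u) g} = ∅ := by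
      ext u
      simp only [IsRooted, Set.mem_ofPred_eq, Set.mem_empty_iff_false, iff_false]
      exact fun h => hV ⟨h.1.1, h.1.2.1⟩
    rw [this, measure_empty]
    exact zero_le
  rw [if_pos hV.1, one_mul]
  -- Sites that are not full are bad already and contribute a factor of at least one to the bound;
  -- marks are used for full sites only.
  set S' := S.filter fun g => IsFull α k x g with hS'
  set w : ℝ≥0∞ := 1 - ENNReal.ofReal e ^ (2 ^ (3 * α)) with hw
  -- A bad full site has a possible task all of whose `k` trials fail; the union bound runs over the
  -- choices of one such task per site.
  let F : Finset (S' → Task k) := Finset.univ.filter fun f => ∀ g, IsPossible α x g.1 (f g)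
  have hsub : {u : Option (Label d) → EdgeMarks α | IsRooted k t z e B (x, u) ∧
      ∀ g ∈ S, ¬IsGood k t z e (x, u) g} ⊆
      ⋃ f ∈ F, {u | (∀ ρ ∈ originSets α k d, Bit t z e (x, u) ρ) ∧
        ∀ i ∈ (Finset.univ : Finset (S' × Fin k)),
          ∃ ρ ∈ trial d α i.1.1 (f i.1) i.2, ¬Bit t z e (x, u) ρ} := by
    rintro u ⟨hroot, hbad⟩
    have h1 : ∀ g : S', ∃ r : Task k, IsPossible α x g.1 r ∧
        ∀ m, ∃ ρ ∈ trial d α g.1 r m, ¬Bit t z e (x, u) ρ := by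
      rintro ⟨g, hg⟩
      obtain ⟨hgS, hfull⟩ := Finset.mem_filter.1 hg
      have h2 := hbad g hgS
      simp only [IsGood, not_and, not_forall, not_exists] at h2
      obtain ⟨r, hr, h3⟩ := h2 hfull
      refine ⟨r, hr, fun m => ?_⟩
      obtain ⟨ρ, hρ, h4⟩ := h3 m
      exact ⟨ρ, hρ, h4⟩
    choose f hf hf' using h1
    exact Set.mem_iUnion₂.2 ⟨f, Finset.mem_filter.2 ⟨Finset.mem_univ _, hf⟩, hroot.2.2,
      fun i _ => hf' i.1 i.2⟩
  have hterm : ∀ f ∈ F, markLaw (Piece d) (edgeMarkLaw α)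
      {u | (∀ ρ ∈ originSets α k d, Bit t z e (x, u) ρ) ∧
        ∀ i ∈ (Finset.univ : Finset (S' × Fin k)),
          ∃ ρ ∈ trial d α i.1.1 (f i.1) i.2, ¬Bit t z e (x, u) ρ} ≤
      ENNReal.ofReal e ^ (originSets α k d).card * (w ^ k) ^ S'.card := by
    intro f hf
    have hf' := (Finset.mem_filter.1 hf).2
    -- With one task per site, the trials and the sets at the origin are pairwise disjoint families,
    -- so their events are independent.
    rw [markLaw_bits_eq z hinj hK he0 he1]
    · refine mul_le_mul_right ?_ _
      calc ∏ i : S' × Fin k, (1 - ENNReal.ofReal e ^ (trial d α i.1.1 (f i.1) i.2).card)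
          ≤ ∏ _i : S' × Fin k, w := by
            refine Finset.prod_le_prod' fun i _ => tsub_le_tsub_left ?_ _
            exact pow_le_pow_right_of_le_one' (ENNReal.ofReal_le_one.2 he1) (card_trial_le hd _ _ _)
        _ = (w ^ k) ^ S'.card := by
            rw [Finset.prod_const, Finset.card_univ, Fintype.card_prod, Fintype.card_coe,
              Fintype.card_fin, mul_comm, pow_mul]
    · exact fun ρ hρ => isMarked_of_mem_originSets hV.2 hρ
    · exact fun i _ ρ hρ =>
        isMarked_of_mem_trial (Finset.mem_filter.1 i.1.2).2 (hf' i.1) hρ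
    · exact fun i _ => disjoint_originSets
    · rintro ⟨g, m⟩ _ ⟨g', m'⟩ _ hne
      refine disjoint_trial hd fun h => hne ?_
      simp only [Prod.mk.injEq] at h
      exact Prod.ext (Subtype.ext h.1) h.2
  calc _ ≤ _ := measure_mono hsub
    _ ≤ ∑ f ∈ F, ENNReal.ofReal e ^ (originSets α k d).card * (w ^ k) ^ S'.card :=
        (measure_biUnion_finset_le _ _).trans (Finset.sum_le_sum hterm)
    _ ≤ ENNReal.ofReal e ^ (originSets α k d).card *
        (Fintype.card (Task k) * w ^ k) ^ S'.card := by
        rw [Finset.sum_const, nsmul_eq_mul, mul_pow, mul_left_comm]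
        refine mul_le_mul_right (mul_le_mul_left ?_ _) _
        have : F.card ≤ Fintype.card (Task k) ^ S'.card := by
          refine (Finset.card_filter_le _ _).trans (le_of_eq ?_)
          rw [Finset.card_univ, Fintype.card_fun, Fintype.card_coe]
        exact_mod_cast this
    _ ≤ _ := by
        refine mul_le_mul_right ?_ _
        -- The full sites supply the factors of the union bound; the remaining factors are at least
        -- one.
        rw [← Finset.prod_filter_mul_prod_filter_not S fun g => IsFull α k x g]
        refine le_mul_of_le_of_one_le ?_ ?_
        · rw [← Finset.prod_const]
          exact Finset.prod_le_prod' fun g _ => le_add_self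
        · refine Finset.one_le_prod' fun g hg => ?_
          rw [if_neg (Finset.mem_filter.1 hg).2]
          exact le_self_add

end GoodSites

/-! ### The probabilities of bad sites -/

section BadSites

variable {d α k : ℕ} {A : Type*} [MeasurableSpace A] {s : ℝ} [hs : Fact (0 < s)] {Θ : Measure A}
  [IsProbabilityMeasure Θ] {B : Set A} {t : ℝ} {z : ℕ ≃ (Fin d → ℤ)} {e : ℝ}

theorem ae_injective_and_injOn (hd : 0 < d) (hB : MeasurableSet B) (ht : 0 < t)
    (lam : Piece d → ℝ≥0) :
    ∀ᵐ x ∂(pointLaw lam Θ (pieceLaw s Θ B)),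
      Function.Injective (pos x) ∧ Set.InjOn (labelCoords t z x) (present x) := by
  filter_upwards [ae_inPieces Θ hB, ae_injective_pos Θ hd] with x hx hinj
  exact ⟨hinj, injOn_labelCoords z ht Θ hx hinj⟩

open Classical in
theorem lintegral_pointLaw_mul (hB : MeasurableSet B) (lam : Piece d → ℝ≥0)
    {F : (Piece d → ℕ) → ℝ≥0∞} (hF : Measurable F) :
    ∫⁻ x, (if x.2.1 ∈ B then 1 else 0) * F x.1 ∂(pointLaw lam Θ (pieceLaw s Θ B)) =
      Θ B * ∫⁻ n, F n ∂(Measure.infinitePi fun r => poissonMeasure (lam r)) := by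
  have h1 : Measurable fun v : A × (Label d → EuclideanSpace ℝ (Fin d) × A) =>
      (if v.1 ∈ B then (1 : ℝ≥0∞) else 0) :=
    Measurable.ite (hB.preimage measurable_fst) measurable_const measurable_const
  simp_rw [mul_comm _ (F _)]
  rw [pointLaw, lintegral_prod_mul hF.aemeasurable h1.aemeasurable, mul_comm]
  congr 1
  have h2 : ∀ v : A × (Label d → EuclideanSpace ℝ (Fin d) × A),
      (if v.1 ∈ B then (1 : ℝ≥0∞) else 0) = (B ×ˢ Set.univ).indicator 1 v := fun v => by
    simp [Set.indicator]
  simp_rw [h2]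
  rw [lintegral_indicator_one (hB.prod .univ), Measure.prod_prod, measure_univ, mul_one]

/-- The rate of points with marks in `B` in a cell. -/
noncomputable def cellRate (d : ℕ) (s : ℝ) (Θ : Measure A) (B : Set A) (β : ℝ≥0) : ℝ≥0 :=
  β * (s.toNNReal ^ d * (Θ B).toNNReal)

theorem pieceRate_true (β : ℝ≥0) (c : Fin d → ℤ) :
    pieceRate s Θ B β (c, true) = cellRate d s Θ B β := by
  simp [pieceRate, markPart, cellRate]

variable (α k) in
/-- The probability that a cell is not full. -/
noncomputable def emptyProb (lam : ℝ≥0) : ℝ≥0∞ :=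
  poissonMeasure lam {n | n < Fintype.card (Slot α k)}

-- The bound for fixed positions is integrated. Different sites use different cells, whose numbers
-- of points are independent, so the expectation of the product factorises.
variable (k) in
theorem measure_bad_le (hd : 2 ≤ d) (hB : MeasurableSet B) (ht : 0 < t) (he0 : 0 ≤ e) (he1 : e ≤ 1)
    (β : ℝ≥0) (S : Finset (ℕ × ℕ)) :
    modelLaw α s Θ B β {y | IsRooted k t z e B y ∧ ∀ g ∈ S, ¬IsGood k t z e y g} ≤
      Θ B * ENNReal.ofReal e ^ (originSets α k d).card *
        (emptyProb α k (cellRate d s Θ B β) + Fintype.card (Task k) *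
          (1 - ENNReal.ofReal e ^ (2 ^ (3 * α))) ^ k) ^ S.card := by
  classical
  have hm : MeasurableSet {y : ModelSpace d α A | IsRooted k t z e B y ∧
      ∀ g ∈ S, ¬IsGood k t z e y g} := by
    refine (measurableSet_isRooted ht hB).inter (.congr (s := ⋂ g ∈ S, {y : ModelSpace d α A |
      IsGood k t z e y g}ᶜ) ?_ (by ext; simp; rfl))
    exact Finset.measurableSet_biInter _ fun g _ => (measurableSet_isGood ht g).compl
  set w : ℝ≥0∞ := Fintype.card (Task k) * (1 - ENNReal.ofReal e ^ (2 ^ (3 * α))) ^ k with hw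
  let h : ℕ → ℝ≥0∞ := fun n => (if Fintype.card (Slot α k) ≤ n then 0 else 1) + w
  let F : (Piece d → ℕ) → ℝ≥0∞ := fun n => ENNReal.ofReal e ^ (originSets α k d).card *
    ∏ r ∈ S.image fun g => (cellOf d g, true), h (n r)
  have hF : Measurable F := by
    refine measurable_const.mul (Finset.measurable_prod _ fun r _ => ?_)
    exact (Measurable.of_discrete (f := h)).comp (measurable_pi_apply r)
  have himg : ∀ f : Piece d → ℝ≥0∞, ∏ r ∈ S.image (fun g => (cellOf d g, true)), f r =
      ∏ g ∈ S, f (cellOf d g, true) := fun f =>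
    Finset.prod_image fun g _ g' _ hgg' => cellOf_injective hd (Prod.ext_iff.1 hgg').1
  rw [modelLaw, Measure.prod_apply hm]
  calc _ ≤ ∫⁻ x, (if x.2.1 ∈ B then 1 else 0) * F x.1
        ∂(pointLaw (pieceRate s Θ B β) Θ (pieceLaw s Θ B)) := by
        refine lintegral_mono_ae ?_
        filter_upwards [ae_injective_and_injOn (z := z) (by omega) hB ht _] with x hx
        refine (markLaw_bad_le hd hx.1 hx.2 he0 he1 S).trans (le_of_eq ?_)
        simp only [F, himg]
        congr! 3 with g
        simp only [h, IsFull, ← hw]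
        congr
    _ = Θ B * (ENNReal.ofReal e ^ (originSets α k d).card *
        ∏ _g ∈ S, (emptyProb α k (cellRate d s Θ B β) + w)) := by
        rw [lintegral_pointLaw_mul hB _ hF, lintegral_const_mul, lintegral_prod_infinitePi, himg]
        · congr 2
          refine Finset.prod_congr rfl fun g _ => ?_
          rw [pieceRate_true, lintegral_add_right _ measurable_const, lintegral_const,
            measure_univ, mul_one]
          congr 1
          have : ∀ n : ℕ, (if Fintype.card (Slot α k) ≤ n then (0 : ℝ≥0∞) else 1) =
              {n : ℕ | n < Fintype.card (Slot α k)}.indicator 1 n := fun n => by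
            by_cases hn : n < Fintype.card (Slot α k)
            · rw [if_neg (by omega), Set.indicator_of_mem (by exact hn)]; rfl
            · rw [if_pos (by omega), Set.indicator_of_notMem (by exact hn)]
          simp_rw [this]
          rw [lintegral_indicator_one .of_discrete, emptyProb]
        · exact fun r => .of_discrete
        · refine Finset.measurable_prod _ fun r _ => ?_
          exact (Measurable.of_discrete (f := h)).comp (measurable_pi_apply r)
    _ = _ := by rw [Finset.prod_const, mul_assoc]

-- The prefactor is the same as in `measure_bad_le`. It is small for large `k`, but only the ratio
-- of the two probabilities will matter.
variable (k) in
theorem measure_isRooted (hd : 2 ≤ d) (hB : MeasurableSet B) (ht : 0 < t) (he0 : 0 ≤ e)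
    (he1 : e ≤ 1) (β : ℝ≥0) :
    modelLaw α s Θ B β {y | IsRooted k t z e B y} =
      Θ B * ENNReal.ofReal e ^ (originSets α k d).card *
        (1 - emptyProb α k (cellRate d s Θ B β)) := by
  classical
  let F : (Piece d → ℕ) → ℝ≥0∞ := fun n => ENNReal.ofReal e ^ (originSets α k d).card *
    {n : Piece d → ℕ | Fintype.card (Slot α k) ≤ n (cellOf d (0, 0), true)}.indicator 1 n
  have hF0 : MeasurableSet {n : Piece d → ℕ | Fintype.card (Slot α k) ≤
      n (cellOf d (0, 0), true)} := measurableSet_le measurable_const (by fun_prop)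
  have hF : Measurable F := measurable_const.mul (measurable_one.indicator hF0)
  rw [modelLaw, Measure.prod_apply (measurableSet_isRooted ht hB)]
  calc _ = ∫⁻ x, (if x.2.1 ∈ B then 1 else 0) * F x.1
        ∂(pointLaw (pieceRate s Θ B β) Θ (pieceLaw s Θ B)) := by
        refine lintegral_congr_ae ?_
        filter_upwards [ae_injective_and_injOn (z := z) (by omega) hB ht _] with x hx
        by_cases hV : x.2.1 ∈ B ∧ IsFull α k x (0, 0)
        · have h1 := markLaw_bits_eq (α := α) z hx.1 hx.2 he0 he1 (originSets α k d)
            (fun _ : Unit => ∅) ∅ (fun ρ hρ => isMarked_of_mem_originSets hV.2 hρ) (by simp)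
            (by simp) (by simp)
          simp only [Finset.notMem_empty, false_imp_iff, implies_true, and_true,
            Finset.prod_empty, mul_one] at h1
          rw [if_pos hV.1, one_mul]
          simp only [F]
          rw [Set.indicator_of_mem (by exact hV.2), Pi.one_apply, mul_one, ← h1]
          congr 1
          ext u
          exact ⟨fun h => h.2.2, fun h => ⟨hV.1, hV.2, h⟩⟩
        · have h1 : Prod.mk x ⁻¹' {y : ModelSpace d α A | IsRooted k t z e B y} = ∅ := by
            ext u
            simp only [Set.mem_preimage, Set.mem_ofPred_eq, Set.mem_empty_iff_false, iff_false]
            exact fun h => hV ⟨h.1, h.2.1⟩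
          rw [h1, measure_empty]
          by_cases hV1 : x.2.1 ∈ B
          · simp only [F]
            rw [Set.indicator_of_notMem (by exact fun h => hV ⟨hV1, h⟩)]
            simp
          · simp [hV1]
    _ = Θ B * (ENNReal.ofReal e ^ (originSets α k d).card *
        (1 - emptyProb α k (cellRate d s Θ B β))) := by
        rw [lintegral_pointLaw_mul hB _ hF, lintegral_const_mul _ (measurable_one.indicator hF0),
          lintegral_indicator_one hF0]
        congr 2
        have h1 : {n : Piece d → ℕ | Fintype.card (Slot α k) ≤ n (cellOf d (0, 0), true)} =
            (fun n => n (cellOf d (0, 0), true)) ⁻¹' {n | n < Fintype.card (Slot α k)}ᶜ := by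
          ext n; simp
        rw [h1, (measurePreserving_eval_infinitePi (fun r : Piece d => poissonMeasure
          (pieceRate s Θ B β r)) (cellOf d (0, 0), true)).measure_preimage
          MeasurableSet.of_discrete.nullMeasurableSet, pieceRate_true,
          prob_compl_eq_one_sub .of_discrete, emptyProb]
    _ = _ := by rw [mul_assoc]

end BadSites

/-! ### Percolation of good sites -/

section GoodPercolation

variable {d α k : ℕ} {A : Type*} [MeasurableSpace A] {s : ℝ} [hs : Fact (0 < s)] {Θ : Measure A}
  [IsProbabilityMeasure Θ] {B : Set A} {t : ℝ} {z : ℕ ≃ (Fin d → ℤ)} {e δ : ℝ}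
  {φ : (j : ℕ) → (Fin (j + 1) → EuclideanSpace ℝ (Fin d) × A) → ℝ}

/-- All points with marks in `B` at distances of at most `δ` are connected with probability at least
`e`. -/
def HasLowerBound (α : ℕ) (φ : (j : ℕ) → (Fin (j + 1) → EuclideanSpace ℝ (Fin d) × A) → ℝ)
    (B : Set A) (δ e : ℝ) : Prop :=
  ∀ (k : Fin α) (p : Fin (k.1 + 2) → EuclideanSpace ℝ (Fin d) × A), (∀ i, (p i).2 ∈ B) →
    (∀ i j, dist (p i).1 (p j).1 ≤ δ) → e ≤ φ (k.1 + 1) p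

/-- A set of labels of points with marks in `B` and small distances. -/
structure IsLocal (x : PointData (Piece d) A (EuclideanSpace ℝ (Fin d) × A)) (B : Set A) (δ : ℝ)
    (F : Finset (Option (Label d))) : Prop where
  subset_present : (F : Set (Option (Label d))) ⊆ present x
  mk_mem : ∀ o ∈ F, mk x o ∈ B
  dist_le : ∀ o ∈ F, ∀ o' ∈ F, dist (pos x o) (pos x o') ≤ δ

theorem IsLocal.mono {x : PointData (Piece d) A (EuclideanSpace ℝ (Fin d) × A)}
    {F F' : Finset (Option (Label d))} (h : IsLocal x B δ F) (hF : F' ⊆ F) : IsLocal x B δ F' :=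
  ⟨(Finset.coe_subset.2 hF).trans h.subset_present, fun o ho => h.mk_mem o (hF ho),
    fun o ho o' ho' => h.dist_le o (hF ho) o' (hF ho')⟩

open Classical in
/-- Two sets of labels correspond to connected `(α-1)`-simplices. -/
def Linked (φ : (j : ℕ) → (Fin (j + 1) → EuclideanSpace ℝ (Fin d) × A) → ℝ) (t : ℝ)
    (z : ℕ ≃ (Fin d → ℤ)) (y : ModelSpace d α A) (σ τ : Finset (Option (Label d))) : Prop :=
  ∃ hσ hτ, (qGraph (complex φ t z (config y)) (α - 1)).Reachable ⟨σ.image (pt y), hσ⟩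
    ⟨τ.image (pt y), hτ⟩

theorem Linked.symm {y : ModelSpace d α A} {σ τ : Finset (Option (Label d))}
    (h : Linked φ t z y σ τ) : Linked φ t z y τ σ := by
  obtain ⟨hσ, hτ, h⟩ := h
  exact ⟨hτ, hσ, h.symm⟩

theorem Linked.trans {y : ModelSpace d α A} {σ τ ρ : Finset (Option (Label d))}
    (h : Linked φ t z y σ τ) (h' : Linked φ t z y τ ρ) : Linked φ t z y σ ρ := by
  obtain ⟨hσ, _, h⟩ := h
  obtain ⟨_, hρ, h'⟩ := h'
  exact ⟨hσ, hρ, h.trans h'⟩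

theorem pt_injective {y : ModelSpace d α A} (hinj : Function.Injective (pos y.1)) :
    Function.Injective (pt y) := fun _ _ h => hinj (Prod.ext_iff.1 h).1

/-- Every nonempty set of at most `α + 1` labels in `F` gives a simplex, so any two
`(α-1)`-simplices in `F` are connected by exchanging vertices. -/
theorem linked_of_isLocal (hα : 1 ≤ α) (hφ : HasLowerBound α φ B δ e) {y : ModelSpace d α A}
    (hinj : Function.Injective (pos y.1)) {F : Finset (Option (Label d))}
    (hF : IsLocal y.1 B δ F)
    (hbit : ∀ ρ ⊆ F, 2 ≤ ρ.card → ρ.card ≤ α + 1 → Bit t z e y ρ)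
    {σ τ : Finset (Option (Label d))} (hσ : σ ⊆ F) (hσc : σ.card = α) (hτ : τ ⊆ F)
    (hτc : τ.card = α) : Linked φ t z y σ τ := by
  classical
  have hface : ∀ ρ ⊆ F, ρ.Nonempty → ρ.card ≤ α + 1 →
      ρ.image (pt y) ∈ (complex φ t z (config y)).faces := fun ρ hρ hne hc =>
    image_mem_faces z hinj hne (hF.mono hρ).subset_present hc
      (fun k l hl => hφ k _ (fun i => (hF.mono hρ).mk_mem _ (hl i))
        fun i j => (hF.mono hρ).dist_le _ (hl i) _ (hl j))
      fun ρ' hρ' h2 => hbit ρ' (hρ'.trans hρ) h2 ((Finset.card_le_card hρ').trans hc)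
  have hcard : ∀ ρ : Finset (Option (Label d)), (ρ.image (pt y)).card = ρ.card := fun ρ =>
    Finset.card_image_of_injective _ (pt_injective hinj)
  have hne : ∀ {ρ : Finset (Option (Label d))}, ρ.card = α → ρ.Nonempty := fun h =>
    Finset.card_pos.1 (by omega)
  refine ⟨⟨?_, ?_⟩, ⟨?_, ?_⟩, ?_⟩
  · convert hface σ hσ (hne hσc) (by omega)
  · convert (hcard σ).trans (by omega : σ.card = α - 1 + 1)
  · convert hface τ hτ (hne hτc) (by omega)
  · convert (hcard τ).trans (by omega : τ.card = α - 1 + 1)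
  · refine qGraph_reachable_of_skeleton (F.image (pt y)) ?_ _ _ ?_ ?_
    · intro ρ hρ hc
      obtain ⟨ρ', hρ', rfl⟩ := Finset.subset_image_iff.1 hρ
      rw [hcard] at hc
      exact hface ρ' hρ' (Finset.card_pos.1 (by omega)) (by omega)
    · convert Finset.image_subset_image hσ
    · convert Finset.image_subset_image hτ

/-- Points in touching cubes of side `s` differ by at most `2 s` in each of the `d` coordinates. -/
theorem dist_le_of_cellsTouch (hδ : 2 * s * √d ≤ δ) {c c' : Fin d → ℤ} (h : CellsTouch c c')
    {x x' : EuclideanSpace ℝ (Fin d)} (hx : x ∈ cell s c) (hx' : x' ∈ cell s c') :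
    dist x x' ≤ δ := by
  have hs0 := hs.out
  refine le_trans ?_ hδ
  rw [EuclideanSpace.dist_eq]
  refine Real.sqrt_le_iff.2 ⟨by positivity, ?_⟩
  rw [mul_pow, Real.sq_sqrt (by positivity), mul_comm]
  calc ∑ i, dist (x i) (x' i) ^ 2 ≤ ∑ _i : Fin d, (2 * s) ^ 2 := by
        refine Finset.sum_le_sum fun i _ => pow_le_pow_left₀ dist_nonneg ?_ 2
        have h1 := abs_le.1 (h i)
        have h2 : (-1 : ℝ) ≤ c i - c' i := by exact_mod_cast h1.1
        have h3 : (c i - c' i : ℝ) ≤ 1 := by exact_mod_cast h1.2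
        have h4 := mul_le_mul_of_nonneg_left h2 hs0.le
        have h5 := mul_le_mul_of_nonneg_left h3 hs0.le
        rw [Real.dist_eq, abs_le]
        constructor <;> nlinarith [hx i, hx' i, (hx i).1, (hx i).2, (hx' i).1, (hx' i).2]
    _ = d * (2 * s) ^ 2 := by simp

theorem cellsTouch_neighbour (dir : Bool) (g : ℕ × ℕ) :
    CellsTouch (cellOf d g) (cellOf d (neighbour dir g)) := by
  intro i
  cases dir <;> simp only [neighbour, cellOf] <;> split_ifs <;> simp

theorem cellsTouch_refl (c : Fin d → ℤ) : CellsTouch c c := fun i => by simp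

theorem exists_lab_of_mem_region {g : ℕ × ℕ} {r : Task k} {m : Fin k} {o : Option (Label d)}
    (ho : o ∈ region d α g r m) : ∃ g' w, o = lab (α := α) (k := k) d g' w ∧
      (g' = g ∨ ∃ v ∈ r, g' = neighbour v.1 g) := by
  rcases r with _ | ⟨dir, j, j'⟩
  · simp only [region, Option.elim, Finset.empty_union, mem_batch] at ho
    obtain ⟨l, rfl⟩ := ho
    exact ⟨_, _, rfl, Or.inl rfl⟩
  · simp only [region, Option.elim, Finset.mem_union, mem_batch] at ho
    rcases ho with (⟨l, rfl⟩ | ⟨l, rfl⟩) | ⟨l, rfl⟩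
    · exact ⟨_, _, rfl, Or.inl rfl⟩
    · exact ⟨_, _, rfl, Or.inr ⟨_, rfl, rfl⟩⟩
    · exact ⟨_, _, rfl, Or.inl rfl⟩

/-- A region lies above a cell and at most one touching cell, in pieces where marks belong to `B`.
-/
theorem isLocal_region (hδ : 2 * s * √d ≤ δ) (hΘB : 0 < Θ B)
    {x : PointData (Piece d) A (EuclideanSpace ℝ (Fin d) × A)} (hin : InPieces s Θ B x)
    {g : ℕ × ℕ} (h : IsFull α k x g) {r : Task k} (hr : IsPossible α x g r) (m : Fin k) :
    IsLocal x B δ (region d α g r m) := by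
  refine ⟨region_subset_present h hr m, ?_, ?_⟩
  · intro o ho
    obtain ⟨g', w, rfl, -⟩ := exists_lab_of_mem_region ho
    exact (hin _).2 hΘB rfl
  · intro o ho o' ho'
    obtain ⟨g₁, w, rfl, h1⟩ := exists_lab_of_mem_region ho
    obtain ⟨g₂, w', rfl, h2⟩ := exists_lab_of_mem_region ho'
    refine dist_le_of_cellsTouch hδ ?_ (hin _).1 (hin _).1
    change CellsTouch (cellOf d g₁) (cellOf d g₂)
    rcases h1 with rfl | ⟨v, hv, rfl⟩ <;> rcases h2 with rfl | ⟨v', hv', rfl⟩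
    · exact cellsTouch_refl _
    · exact cellsTouch_neighbour _ _
    · exact (cellsTouch_neighbour _ _).symm
    · rw [Option.mem_unique hv hv']
      exact cellsTouch_refl _

theorem isLocal_insert_none (hδ : 2 * s * √d ≤ δ) (hΘB : 0 < Θ B)
    {x : PointData (Piece d) A (EuclideanSpace ℝ (Fin d) × A)} (hin : InPieces s Θ B x)
    (hV : x.2.1 ∈ B) (h : IsFull α k x (0, 0)) (m : Fin k) :
    IsLocal x B δ (insert none (batch d α (0, 0) 0 m)) := by
  have h0 := isLocal_region (r := none) hδ hΘB hin h (fun w hw => by simp at hw) m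
  simp only [region, Option.elim, Finset.empty_union] at h0
  have hcell : ∀ o ∈ insert none (batch d α (0, 0) 0 m), pos x o ∈ cell s (cellOf d (0, 0)) := by
    intro o ho
    rcases Finset.mem_insert.1 ho with rfl | ho
    · intro i
      simp [pos, cellOf, hs.out]
    · obtain ⟨l, rfl⟩ := mem_batch.1 ho
      exact (hin ((cellOf d (0, 0), true), _)).1
  refine ⟨?_, ?_, fun o ho o' ho' =>
    dist_le_of_cellsTouch hδ (cellsTouch_refl _) (hcell o ho) (hcell o' ho')⟩
  · rw [Finset.coe_insert]
    refine Set.insert_subset ?_ h0.subset_present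
    rintro _ ⟨⟩
  · intro o ho
    rcases Finset.mem_insert.1 ho with rfl | ho
    · exact hV
    · exact h0.mk_mem o ho

theorem mem_trial_none {g : ℕ × ℕ} {m : Fin k} {ρ : Finset (Option (Label d))}
    (hρ : ρ ⊆ batch d α g 0 m) (h2 : 2 ≤ ρ.card) (hα : ρ.card ≤ α + 1) :
    ρ ∈ trial d α g none m := by
  refine mem_trial.2 ⟨by simpa [region, layerOf] using hρ, h2, hα, ?_⟩
  obtain ⟨o, ho⟩ := Finset.card_pos.1 (by omega : 0 < ρ.card)
  obtain ⟨l, rfl⟩ := mem_batch.1 (hρ ho)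
  exact ⟨l, ho⟩

variable {y : ModelSpace d α A}

/-- A successful batch is connected to the connecting batch of a successful trial. -/
theorem linked_batch (hd : 2 ≤ d) (hα : 1 ≤ α) (hφ : HasLowerBound α φ B δ e)
    (hinj : Function.Injective (pos y.1)) {g g' : ℕ × ℕ} {r : Task k} {m j : Fin k}
    (hloc : IsLocal y.1 B δ (region d α g r m)) (hsub : batch d α g' 0 j ⊆ region d α g r m)
    (hsite : ∀ ρ ∈ trial d α g' none j, Bit t z e y ρ)
    (htrial : ∀ ρ ∈ trial d α g r m, Bit t z e y ρ) :
    Linked φ t z y (batch d α g' 0 j) (batch d α g (layerOf r) m) := by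
  have hsub' : batch d α g (layerOf r) m ⊆ region d α g r m := Finset.subset_union_right
  refine linked_of_isLocal hα hφ hinj (hloc.mono (Finset.union_subset hsub hsub')) ?_
    Finset.subset_union_left (card_batch hd _ _ _) Finset.subset_union_right (card_batch hd _ _ _)
  intro ρ hρ h2 hc
  -- Sets meeting the connecting batch are tested by the trial; all others lie in the base batch and
  -- were tested when it was selected.
  by_cases h : ∃ l : Fin α, lab d g (layerOf r, m, l) ∈ ρ
  · exact htrial ρ (mem_trial.2 ⟨hρ.trans (Finset.union_subset hsub hsub'), h2, hc, h⟩)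
  · refine hsite ρ (mem_trial_none (fun o ho => ?_) h2 hc)
    rcases Finset.mem_union.1 (hρ ho) with h' | h'
    · exact h'
    · obtain ⟨l, rfl⟩ := mem_batch.1 h'
      exact absurd ⟨l, ho⟩ h

/-- If the origin is in good boxes on all levels, then a successful batch in its cell is connected
to batches in infinitely many cells. -/
theorem infinite_linked_of_not_boxBad (hd : 2 ≤ d) (hα : 1 ≤ α)
    (hφ : HasLowerBound α φ B δ e) (hδ : 2 * s * √d ≤ δ) (hΘB : 0 < Θ B)
    (hinj : Function.Injective (pos y.1)) (hin : InPieces s Θ B y.1)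
    (hbox : ∀ n, ¬BoxBad (fun g => ¬IsGood k t z e y g) n (0, 0)) :
    ∃ j : ℕ × ℕ → Fin k, (∀ ρ ∈ trial d α (0, 0) none (j (0, 0)), Bit t z e y ρ) ∧
      {x | Linked φ t z y (batch d α (0, 0) 0 (j (0, 0))) (batch d α x 0 (j x))}.Infinite := by
  have hposs : ∀ g, IsPossible α y.1 g (none : Task k) := fun g w hw => by simp at hw
  have hgood0 : IsGood k t z e y (0, 0) := not_not.1 (hbox 0)
  obtain ⟨m₀, hm₀⟩ := hgood0.2 none (hposs _)
  have hex : ∀ g, ∃ j : Fin k, IsGood k t z e y g → ∀ ρ ∈ trial d α g none j, Bit t z e y ρ := by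
    intro g
    by_cases hg : IsGood k t z e y g
    · obtain ⟨j, hj⟩ := hg.2 none (hposs _)
      exact ⟨j, fun _ => hj⟩
    · exact ⟨m₀, fun h => absurd h hg⟩
  choose j hj using hex
  have hstep : ∀ dir g, IsGood k t z e y g → IsGood k t z e y (neighbour dir g) →
      Linked φ t z y (batch d α g 0 (j g))
        (batch d α (neighbour dir g) 0 (j (neighbour dir g))) := by
    intro dir g hg hg'
    -- Goodness covers every pair of base batches, in particular the two that were selected
    -- afterwards.
    have hp : IsPossible α y.1 g (some (dir, j g, j (neighbour dir g))) := by
      rintro _ ⟨⟩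
      exact hg'.1
    obtain ⟨m, hm⟩ := hg.2 _ hp
    have hloc := isLocal_region hδ hΘB hin hg.1 hp m
    have h1 := linked_batch hd hα hφ hinj (g' := g) (j := j g) hloc
      (fun o ho => Finset.mem_union_left _ (Finset.mem_union_left _ ho)) (hj g hg) hm
    have h2 := linked_batch hd hα hφ hinj (g' := neighbour dir g) (j := j (neighbour dir g)) hloc
      (fun o ho => Finset.mem_union_left _ (Finset.mem_union_right _ ho)) (hj _ hg') hm
    exact h1.trans h2.symm
  have hR : IsLinking (fun g => ¬¬IsGood k t z e y g)
      (fun g h => Linked φ t z y (batch d α g 0 (j g)) (batch d α h 0 (j h))) := by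
    refine ⟨fun g hg => ?_, fun g h => Linked.symm, fun g h k _ => Linked.trans, ?_, ?_⟩
    -- Reflexivity is not automatic: `Linked` includes that the batch really is a simplex.
    · have hloc := isLocal_region hδ hΘB hin (not_not.1 hg).1 (hposs g) (j g)
      have h1 := linked_batch hd hα hφ hinj (g' := g) (j := j g) hloc
        (Finset.subset_union_right (s₂ := batch d α g (layerOf none) (j g)))
        (hj g (not_not.1 hg)) (hj g (not_not.1 hg))
      exact h1
    · exact fun i j h h' => hstep false (i, j) (not_not.1 h) (not_not.1 h')
    · exact fun i j h h' => hstep true (i, j) (not_not.1 h) (not_not.1 h')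
  refine ⟨j, hj _ hgood0, fun hfin => ?_⟩
  -- Finitely many linked sites would have bounded coordinate sums, but some linked site has sum at
  -- least `3 ^ b > b`.
  obtain ⟨b, hb⟩ := (hfin.image fun x => x.1 + x.2).bddAbove
  obtain ⟨x, -, hx, hx'⟩ := exists_far_linked hR hbox b
  have h1 : x.1 + x.2 ≤ b := hb (Set.mem_image_of_mem _ hx')
  exact absurd (hx.trans h1) (not_le.2 (Nat.lt_pow_self (by norm_num)))

/-- If the origin is in good boxes on all levels, there is percolation. -/
theorem percolatesFromOrigin_of_not_boxBad (hd : 2 ≤ d) (hα : 1 ≤ α)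
    (hφ : HasLowerBound α φ B δ e) (hδ : 2 * s * √d ≤ δ) (hΘB : 0 < Θ B)
    (hinj : Function.Injective (pos y.1)) (hin : InPieces s Θ B y.1)
    (hroot : IsRooted k t z e B y)
    (hbox : ∀ n, ¬BoxBad (fun g => ¬IsGood k t z e y g) n (0, 0)) :
    PercolatesFromOrigin (complex φ t z (config y)) (α - 1) := by
  classical
  obtain ⟨j, hj, hXinf⟩ := infinite_linked_of_not_boxBad hd hα hφ hδ hΘB hinj hin hbox
  set X := {x | Linked φ t z y (batch d α (0, 0) 0 (j (0, 0))) (batch d α x 0 (j x))} with hX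
  set β₀ := batch d α (0, 0) 0 (j (0, 0)) with hβ₀
  have hβ₀c : β₀.card = α := card_batch hd _ _ _
  have hnone : none ∉ β₀ := by simp [hβ₀, mem_batch, lab]
  obtain ⟨o₀, ho₀⟩ := Finset.card_pos.1 (by omega : 0 < β₀.card)
  -- Replacing one vertex of the selected batch by the origin gives an `(α-1)`-simplex at the origin
  -- in the same component.
  have hlink : Linked φ t z y (insert none (β₀.erase o₀)) β₀ := by
    refine linked_of_isLocal hα hφ hinj
      (isLocal_insert_none hδ hΘB hin hroot.1 hroot.2.1 (j (0, 0))) ?_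
      (Finset.insert_subset_insert _ (Finset.erase_subset _ _)) ?_ (Finset.subset_insert _ _) hβ₀c
    · intro ρ hρ h2 hc
      -- Sets containing the origin are covered by rootedness, the other ones by the successful
      -- trial of the batch itself.
      by_cases h : none ∈ ρ
      · refine hroot.2.2 ρ (mem_originSets.2
          ⟨hρ.trans (Finset.insert_subset_insert _ ?_), h, h2, hc⟩)
        exact Finset.subset_biUnion_of_mem (fun m : Fin k => batch d α (0, 0) 0 m)
          (Finset.mem_univ (j (0, 0)))
      · exact hj ρ (mem_trial_none ((Finset.subset_insert_iff_of_notMem h).1 hρ) h2 hc)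
    · rw [Finset.card_insert_of_notMem (fun h => hnone (Finset.mem_of_mem_erase h)),
        Finset.card_erase_of_mem ho₀]
      omega
  obtain ⟨hσ, -, -⟩ := id hlink
  refine ⟨⟨_, hσ⟩, ⟨pt y none, Finset.mem_image_of_mem _ (Finset.mem_insert_self _ _), rfl⟩, ?_⟩
  have hmem : ∀ x : X, ∃ hx, (⟨(batch d α x.1 0 (j x.1)).image (pt y), hx⟩ :
      {σ // σ ∈ (complex φ t z (config y)).faces ∧ σ.card = α - 1 + 1}) ∈
        ((qGraph (complex φ t z (config y)) (α - 1)).connectedComponentMk ⟨_, hσ⟩).supp := by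
    rintro ⟨x, hx⟩
    obtain ⟨_, hx', hreach⟩ := hlink.trans hx
    exact ⟨hx', (SimpleGraph.ConnectedComponent.mem_supp_iff _ _).2
      (SimpleGraph.ConnectedComponent.sound hreach.symm)⟩
  choose hf hf' using hmem
  have := hXinf.to_subtype
  refine (Set.infinite_range_of_injective (f := fun x : X =>
    (⟨(batch d α x.1 0 (j x.1)).image (pt y), hf x⟩ :
      {σ // σ ∈ (complex φ t z (config y)).faces ∧ σ.card = α - 1 + 1})) ?_).mono ?_
  -- Batches in different cells consist of different labels, hence of different points.
  · intro x x' h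
    have h1 := Finset.image_injective (pt_injective hinj) (Subtype.ext_iff.1 h)
    have h2 : lab d x.1 (0, j x.1, (⟨0, hα⟩ : Fin α)) ∈ batch d α x'.1 0 (j x'.1) := by
      rw [← h1]
      exact (lab_mem_batch hd).2 ⟨rfl, rfl, rfl⟩
    exact Subtype.ext ((lab_mem_batch hd).1 h2).1
  · rintro _ ⟨x, rfl⟩
    exact hf' x

end GoodPercolation

/-! ### Percolation at large intensities -/

section LargeIntensity

variable {d α : ℕ} {A : Type*} [MeasurableSpace A]
  {φ : (j : ℕ) → (Fin (j + 1) → EuclideanSpace ℝ (Fin d) × A) → ℝ}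

theorem prod_le_of_mem_Icc {ι : Type*} {S : Finset ι} {f : ι → ℝ}
    (hf : ∀ i ∈ S, f i ∈ Set.Icc (0 : ℝ) 1) {i : ι} (hi : i ∈ S) : ∏ j ∈ S, f j ≤ f i := by
  classical
  rw [← Finset.mul_prod_erase S f hi]
  exact mul_le_of_le_one_right (hf i hi).1 (Finset.prod_le_one
    (fun j hj => (hf j (Finset.mem_of_mem_erase hj)).1)
    fun j hj => (hf j (Finset.mem_of_mem_erase hj)).2)

theorem prod_mem_Icc {ι : Type*} {S : Finset ι} {f : ι → ℝ}
    (hf : ∀ i ∈ S, f i ∈ Set.Icc (0 : ℝ) 1) : ∏ j ∈ S, f j ∈ Set.Icc (0 : ℝ) 1 :=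
  ⟨Finset.prod_nonneg fun j hj => (hf j hj).1,
    Finset.prod_le_one (fun j hj => (hf j hj).1) fun j hj => (hf j hj).2⟩

/-- All factors of `kappa` lie in `[0,1]`, so the product is at most any single factor. -/
theorem kappa_le (hφ : IsConnectionFamily α φ) {n m : ℕ} (hm : 1 ≤ m) (hmn : m ≤ n) (hn : n ≤ α)
    (x : Fin (n + 1) → EuclideanSpace ℝ (Fin d) × A) (f : Fin (m + 1) ↪o Fin (n + 1)) :
    kappa φ n x ≤ φ m (x ∘ f) := by
  have h1 : ∀ k ∈ Finset.Icc 1 n, ∀ g : Fin (k + 1) ↪o Fin (n + 1),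
      φ k (x ∘ g) ∈ Set.Icc (0 : ℝ) 1 := fun k hk g => by
    rw [Finset.mem_Icc] at hk
    exact hφ.mem_Icc k hk.1 (hk.2.trans hn) _
  refine (prod_le_of_mem_Icc (fun k hk => prod_mem_Icc fun g _ => h1 k hk g)
    (Finset.mem_Icc.2 ⟨hm, hmn⟩)).trans ?_
  exact prod_le_of_mem_Icc (f := fun g : Fin (m + 1) ↪o Fin (n + 1) => φ m (x ∘ g))
    (fun g _ => h1 m (Finset.mem_Icc.2 ⟨hm, hmn⟩) g) (Finset.mem_univ f)

variable {Θ : Measure A} [IsProbabilityMeasure Θ]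

/-- (V1) concerns `α + 1` points that need not be distinct. Fewer points are padded by repetition,
and the relevant factor of `kappa` is isolated. -/
theorem exists_hasLowerBound (hα : 1 ≤ α) (hφ : IsConnectionFamily α φ) (h : V1 Θ φ (α - 1)) :
    ∃ δ > 0, ∃ e > 0, e ≤ 1 ∧ ∃ B, MeasurableSet B ∧ 0 < Θ B ∧ HasLowerBound α φ B δ e := by
  obtain ⟨δ, hδ, ε, hε, B, hB, hΘB, h⟩ := h
  refine ⟨δ, hδ, min ε 1, lt_min hε one_pos, min_le_right _ _, B, hB, hΘB, fun k p hpB hp => ?_⟩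
  have hk := k.2
  -- The last point is repeated.
  let c : Fin (α - 1 + 2) → Fin (k.1 + 2) := fun i => ⟨min i.1 (k.1 + 1), by omega⟩
  have h1 := h (fun i => (p (c i)).2) (fun i => (p (c i)).1) (fun i => hpB _) (by
    refine Metric.diam_le_of_forall_dist_le hδ.le ?_
    rintro _ ⟨i, rfl⟩ _ ⟨j, rfl⟩
    exact hp _ _)
  refine (min_le_left _ _).trans (h1.trans ((kappa_le hφ (m := k.1 + 1) (by omega) (by omega)
    (by omega) _ (Fin.castLEOrderEmb (by omega))).trans (le_of_eq ?_)))
  congr 1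
  funext i
  have hi := i.2
  have : c (Fin.castLEOrderEmb (by omega) i) = i := by
    ext
    simp only [c, Fin.castLEOrderEmb_apply, Fin.val_castLE]
    omega
  simp only [Function.comp_apply, this]

theorem tendsto_emptyProb (α k : ℕ) :
    Filter.Tendsto (emptyProb α k) Filter.atTop (nhds 0) := by
  have h1 : ∀ n : ℕ, Filter.Tendsto (fun r : ℝ≥0 => poissonMeasure r {n})
      Filter.atTop (nhds 0) := by
    intro n
    have h2 := ((Real.tendsto_pow_mul_exp_neg_atTop_nhds_zero n).comp
      (NNReal.tendsto_coe_atTop.2 Filter.tendsto_id)).div_const (n.factorial : ℝ)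
    rw [zero_div] at h2
    have h3 := ENNReal.tendsto_ofReal h2
    rw [ENNReal.ofReal_zero] at h3
    refine h3.congr fun r => ?_
    rw [poissonMeasure_singleton]
    simp [mul_comm]
  have h2 := tendsto_finsetSum (Finset.range (Fintype.card (Slot α k))) fun n _ => h1 n
  rw [Finset.sum_const_zero] at h2
  refine tendsto_of_tendsto_of_tendsto_of_le_of_le tendsto_const_nhds h2 (fun r => zero_le)
    fun r => ?_
  refine (measure_mono (t := ⋃ n ∈ Finset.range (Fintype.card (Slot α k)), {n})
    fun n hn => ?_).trans (measure_biUnion_finset_le _ _)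
  exact Set.mem_iUnion₂.2 ⟨n, Finset.mem_range.2 hn, rfl⟩

/-- There are `2 k² + 1` tasks, while the probability that all `k` trials fail decays exponentially
in `k`. -/
theorem exists_task_failure_le {e : ℝ} (he0 : 0 < e) (he1 : e ≤ 1) (n : ℕ) {p : ℝ≥0∞} (hp : 0 < p) :
    ∃ k : ℕ, Fintype.card (Task k) * (1 - ENNReal.ofReal e ^ n) ^ k ≤ p := by
  have h0 : 0 < e ^ n := pow_pos he0 n
  have h1 : e ^ n ≤ 1 := pow_le_one₀ he0.le he1
  have hr : |1 - e ^ n| < 1 := by rw [abs_lt]; constructor <;> linarith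
  have h2 := ((tendsto_pow_const_mul_const_pow_of_abs_lt_one 2 hr).const_mul 2).add
    (tendsto_pow_atTop_nhds_zero_of_abs_lt_one hr)
  rw [mul_zero, add_zero] at h2
  have h3 := ENNReal.tendsto_ofReal h2
  rw [ENNReal.ofReal_zero] at h3
  obtain ⟨k, hk⟩ := (h3.eventually_le_const hp).exists
  refine ⟨k, le_trans (le_of_eq ?_) hk⟩
  have h4 : (1 : ℝ≥0∞) - ENNReal.ofReal e ^ n = ENNReal.ofReal (1 - e ^ n) := by
    rw [ENNReal.ofReal_sub _ h0.le, ENNReal.ofReal_one, ENNReal.ofReal_pow he0.le]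
  have h5 : (Fintype.card (Task k) : ℝ≥0∞) = ENNReal.ofReal (2 * (k : ℝ) ^ 2 + 1) := by
    have : (2 * (k : ℝ) ^ 2 + 1) = ((Fintype.card (Task k) : ℕ) : ℝ) := by
      simp [Fintype.card_option, Fintype.card_prod]
      ring
    rw [this, ENNReal.ofReal_natCast]
  rw [h4, h5, ← ENNReal.ofReal_pow (by linarith), ← ENNReal.ofReal_mul (by positivity)]
  congr 1
  ring

variable {s : ℝ} [hs : Fact (0 < s)] {B : Set A} {t : ℝ} {z : ℕ ≃ (Fin d → ℤ)} {e δ : ℝ}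

/-- If bad sites are rare, the explicit model percolates. -/
theorem exists_measurableSet_percolates (hd : 2 ≤ d) (hα : 1 ≤ α) (ht : 0 < t)
    (hB : MeasurableSet B) (hΘB : 0 < Θ B) (he0 : 0 < e) (he1 : e ≤ 1)
    (hφ : HasLowerBound α φ B δ e) (hδ : 2 * s * √d ≤ δ) {k : ℕ}
    (hk : Fintype.card (Task k) * (1 - ENNReal.ofReal e ^ (2 ^ (3 * α))) ^ k ≤ 288⁻¹) {β : ℝ≥0}
    (hβ : emptyProb α k (cellRate d s Θ B β) ≤ 288⁻¹) :
    ∃ M : Set (ModelSpace d α A), MeasurableSet M ∧ 0 < modelLaw α s Θ B β M ∧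
      ∀ y ∈ M, InPieces s Θ B y.1 → PercolatesFromOrigin (complex φ t z (config y)) (α - 1) := by
  set μ := modelLaw (d := d) α s Θ B β with hμ
  set R := {y : ModelSpace d α A | IsRooted k t z e B y} with hR
  have hRm : MeasurableSet R := measurableSet_isRooted ht hB
  set C := Θ B * ENNReal.ofReal e ^ (originSets α k d).card with hC
  have hC0 : C ≠ 0 := mul_ne_zero hΘB.ne' (pow_ne_zero _ (by simpa using he0))
  have hCt : C ≠ ∞ := ENNReal.mul_ne_top (measure_ne_top _ _)
    (ENNReal.pow_ne_top ENNReal.ofReal_ne_top)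
  -- Half of the bound `144⁻¹` of the hierarchical argument is spent on cells that are not full,
  -- half on failing tasks.
  have h288 : (288⁻¹ : ℝ≥0∞) + 288⁻¹ = 144⁻¹ := by
    rw [← two_mul, show (288 : ℝ≥0∞) = 2 * 144 by norm_num, ENNReal.mul_inv (by simp) (by simp),
      ← mul_assoc, ENNReal.mul_inv_cancel (by simp) (by simp), one_mul]
  set E := {y : ModelSpace d α A | ∃ n, BoxBad (fun g => ¬IsGood k t z e y g) n (0, 0)} with hE
  have h1 : μ.restrict R E ≤ C * 72⁻¹ := by
    refine measure_exists_boxBad_le fun S => ?_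
    rw [Measure.restrict_apply' hRm, Set.inter_comm]
    refine (measure_bad_le k hd hB ht he0.le he1 β S).trans ?_
    gcongr
    exact (add_le_add hβ hk).trans h288.le
  have h2 : ∀ᵐ y ∂μ, Function.Injective (pos y.1) :=
    Measure.quasiMeasurePreserving_fst.ae (ae_injective_pos Θ (by omega))
  rw [ae_iff] at h2
  set N := toMeasurable μ {y | ¬Function.Injective (pos y.1)} with hN
  have hN0 : μ N = 0 := by rw [hN, measure_toMeasurable, h2]
  -- A measurable hull replaces `E`, so that the set constructed below is measurable.
  set T := toMeasurable (μ.restrict R) E with hT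
  have hTm : MeasurableSet T := measurableSet_toMeasurable _ _
  refine ⟨(R \ T) \ N, (hRm.diff hTm).diff (measurableSet_toMeasurable _ _), ?_, ?_⟩
  · rw [measure_sdiff_null hN0, pos_iff_ne_zero]
    intro h0
    have h3 : μ R ≤ C * 72⁻¹ := by
      rw [← measure_inter_add_sdiff R hTm, h0, add_zero, Set.inter_comm,
        ← Measure.restrict_apply hTm, hT, measure_toMeasurable]
      exact h1
    have h4 : μ R = C * (1 - emptyProb α k (cellRate d s Θ B β)) :=
      measure_isRooted k hd hB ht he0.le he1 β
    rw [h4, ENNReal.mul_le_mul_iff_right hC0 hCt] at h3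
    -- If bad boxes exhausted the rooted event, cancelling the common constant `C` would give this
    -- impossible inequality.
    have h5 : (1 : ℝ≥0∞) ≤ 72⁻¹ + 288⁻¹ :=
      (tsub_le_iff_right.1 h3).trans (add_le_add_right hβ _)
    have h6 : (72⁻¹ : ℝ≥0∞) + 288⁻¹ < 1 := by
      calc (72⁻¹ : ℝ≥0∞) + 288⁻¹ ≤ 72⁻¹ + 72⁻¹ := by gcongr; norm_num
        _ < 2⁻¹ + 2⁻¹ := by
            have : (72⁻¹ : ℝ≥0∞) < 2⁻¹ := ENNReal.inv_lt_inv.2 (by norm_num)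
            exact ENNReal.add_lt_add this this
        _ = 1 := ENNReal.inv_two_add_inv_two
    exact absurd h5 (not_le.2 h6)
  · rintro y ⟨⟨hy, hyT⟩, hyN⟩ hin
    have hinj : Function.Injective (pos y.1) := by
      by_contra h
      exact hyN (subset_toMeasurable _ _ h)
    refine percolatesFromOrigin_of_not_boxBad hd hα hφ hδ hΘB hinj hin hy fun n hn => ?_
    exact hyT (subset_toMeasurable _ _ ⟨n, hn⟩)

theorem tendsto_cellRate (hΘB : 0 < Θ B) :
    Filter.Tendsto (cellRate d s Θ B) Filter.atTop Filter.atTop := by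
  refine Filter.tendsto_id.atTop_mul_const ?_
  exact mul_pos (pow_pos (Real.toNNReal_pos.2 hs.out) _)
    (ENNReal.toNNReal_pos hΘB.ne' (measure_ne_top _ _))

end LargeIntensity

/-! ### Critical intensities -/

section Critical

variable {d α : ℕ} {A : Type*} [MeasurableSpace A] [StandardBorelSpace A] {Θ : Measure A}
  [IsProbabilityMeasure Θ] {φ : (j : ℕ) → (Fin (j + 1) → EuclideanSpace ℝ (Fin d) × A) → ℝ}
  {t : ℝ} {z : ℕ ≃ (Fin d → ℤ)} {Ω : Type*} [MeasurableSpace Ω] {P : ℝ≥0 → Measure Ω}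
  [∀ β, IsProbabilityMeasure (P β)] {Ψ : Ω → Measure (MPoint d α A)} {V : Ω → A}
  {U : Ω → EdgeMarks α}

/-- The percolation events decrease in `q`, so the sets of subcritical intensities increase. -/
theorem criticalIntensity_le_succ (q : ℕ) :
    criticalIntensity φ t z P Ψ V U q ≤ criticalIntensity φ t z P Ψ V U (q + 1) := by
  refine sSup_le_sSup ?_
  rintro b ⟨β, rfl, h⟩
  exact ⟨β, rfl, measure_mono_null (fun ω hω => PercolatesFromOrigin.of_succ hω) h⟩

variable (hΨ : ∀ β : ℝ≥0, IsPoissonProcess Ψ (intensity α d Θ β) (P β)) (hV : Measurable V)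
  (hU : Measurable U)
  (hVU : ∀ β, HasLaw (fun ω => (V ω, U ω)) (Θ.prod (edgeMarkLaw α)) (P β))
  (hindep : ∀ β, IndepFun Ψ (fun ω => (V ω, U ω)) (P β))

include hΨ hV hU hVU hindep in
theorem criticalIntensity_zero_pos (hd : 2 ≤ d) (hα : 1 ≤ α) (hφ : IsConnectionFamily α φ)
    (h : V2 Θ φ 0) : 0 < criticalIntensity φ t z P Ψ V U 0 := by
  obtain ⟨D, hD, h⟩ := h
  -- The range `D` of the edges serves as side length of the cells.
  have : Fact (0 < D) := ⟨hD⟩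
  obtain ⟨β, hβ, h1⟩ := exists_ae_not_percolates (t := t) (z := z) (s := D) (by omega) hα hφ h
  have h2 := ae_points_of_ae_config (s := D) Θ .univ (hΨ β) hV hU (hVU β) (hindep β)
    (C := {S | ¬PercolatesFromOrigin (complex φ t z S) 0}) h1
  refine (ENNReal.coe_pos.2 hβ).trans_le (le_sSup ⟨β, rfl, ?_⟩)
  rw [ae_iff] at h2
  refine measure_mono_null (fun ω hω => ?_) h2
  exact fun h => h hω

include hΨ hV hU hVU hindep in
theorem criticalIntensity_lt_top (hd : 2 ≤ d) (hα : 1 ≤ α) (hφ : IsConnectionFamily α φ)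
    (ht : 0 < t) (h : V1 Θ φ (α - 1)) : criticalIntensity φ t z P Ψ V U (α - 1) < ∞ := by
  obtain ⟨δ, hδ, e, he0, he1, B, hB, hΘB, hlow⟩ := exists_hasLowerBound hα hφ h
  have hd0 : 0 < √(d : ℝ) := Real.sqrt_pos.2 (by exact_mod_cast (by omega : 0 < d))
  -- With this side length, points in touching cells have distance at most `δ`.
  have : Fact (0 < δ / (2 * √d)) := ⟨by positivity⟩
  have hs : 2 * (δ / (2 * √d)) * √d ≤ δ := le_of_eq (by field_simp)
  -- First `k` makes failing tasks rare; then `β₀` makes cells with fewer than the resulting number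
  -- of slots rare.
  obtain ⟨k, hk⟩ := exists_task_failure_le he0 he1 (2 ^ (3 * α)) (p := 288⁻¹) (by simp)
  obtain ⟨β₀, hβ₀⟩ := Filter.eventually_atTop.1
    (((tendsto_emptyProb α k).comp (tendsto_cellRate (d := d) (s := δ / (2 * √d))
      hΘB)).eventually_le_const (u := 288⁻¹) (by simp))
  refine lt_of_le_of_lt (sSup_le ?_) (ENNReal.coe_lt_top (r := β₀))
  rintro _ ⟨β, rfl, hβ⟩
  -- Percolation has positive probability at every intensity `β ≥ β₀`, so `β₀` is an upper bound.
  by_contra! hlt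
  obtain ⟨M, hM, hM0, hMp⟩ := exists_measurableSet_percolates (t := t) (z := z) hd hα ht hB hΘB
    he0 he1 hlow hs hk (hβ₀ β (by exact_mod_cast hlt.le))
  have h1 := modelLaw_le_measure Θ hB (hΨ β) hV hU (hVU β) (hindep β)
    {S | PercolatesFromOrigin (complex φ t z S) (α - 1)} hM hMp
  exact (hM0.trans_le h1).ne' hβ

end Critical

end SimplicialRCM

theorem mainTheorem2 (d α : ℕ) (hd : 2 ≤ d) (hα : 1 ≤ α)
    -- the mark space
    {A : Type*} [MeasurableSpace A] [StandardBorelSpace A] (Θ : Measure A) [IsProbabilityMeasure Θ]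
    -- the connection functions
    (φ : (j : ℕ) → (Fin (j + 1) → EuclideanSpace ℝ (Fin d) × A) → ℝ)
    (hφ : SimplicialRCM.IsConnectionFamily α φ)
    -- the decomposition into cubes used in the construction
    (t : ℝ) (ht : 0 < t) (z : ℕ ≃ (Fin d → ℤ)) (hz : z 0 = 0)
    -- the Poisson process and the marks of the additional point at the origin
    {Ω : Type*} [MeasurableSpace Ω] (P : ℝ≥0 → Measure Ω) [∀ β, IsProbabilityMeasure (P β)]
    (Ψ : Ω → Measure (SimplicialRCM.MPoint d α A)) (V : Ω → A) (U : Ω → SimplicialRCM.EdgeMarks α)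
    (hΨ : ∀ β : ℝ≥0, SimplicialRCM.IsPoissonProcess Ψ
      (β • (volume : Measure (EuclideanSpace ℝ (Fin d))).prod
        (Θ.prod (SimplicialRCM.edgeMarkLaw α))) (P β))
    (hV : Measurable V) (hU : Measurable U)
    (hVU : ∀ β, HasLaw (fun ω => (V ω, U ω)) (Θ.prod (SimplicialRCM.edgeMarkLaw α)) (P β))
    (hindep : ∀ β, IndepFun Ψ (fun ω => (V ω, U ω)) (P β))
    -- the two properties
    (h1 : SimplicialRCM.V1 Θ φ (α - 1)) (h2 : SimplicialRCM.V2 Θ φ 0) :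
    0 < SimplicialRCM.criticalIntensity φ t z P Ψ V U 0 ∧
    (∀ q, q + 1 < α → SimplicialRCM.criticalIntensity φ t z P Ψ V U q ≤
      SimplicialRCM.criticalIntensity φ t z P Ψ V U (q + 1)) ∧
    SimplicialRCM.criticalIntensity φ t z P Ψ V U (α - 1) < ∞ := by
  exact ⟨SimplicialRCM.criticalIntensity_zero_pos hΨ hV hU hVU hindep hd hα hφ h2,
    fun q _ => SimplicialRCM.criticalIntensity_le_succ q,
    SimplicialRCM.criticalIntensity_lt_top hΨ hV hU hVU hindep hd hα hφ ht h1⟩
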